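/- **Conventions.** Graphs are finite, simple and undirected. First-order (FO) formulas are generated by $\phi \to \exists x.\,\phi \mid \neg\phi \mid \phi\lor\phi \mid x\sim y \mid x=y$, where variables range over vertices and $\sim$ is adjacency; a sentence is a formula without free variables. A path decomposition $B_1,\dots,B_\ell$ of $G=(V,E)$ together with $\rho:V\to[p]=\{1,\dots,p\}$ is *ranked* if no bag contains two distinct vertices of the same rank. It is *normalized* if moreover (i) for all ranks $i<j$ in $[p]$ and every vertex $v$ with $\rho(v)=i$, there are at most two vertices $u$ with $\rho(u)=j$ that appear in a bag together with $v$, and (ii) each bag $B_{m+1}$ $(1\le m<\ell)$ contains a vertex that is not in $B_m$. For positive integers $p,q$ let $\Delta_{p,q}(1)=3p$ and $$\Delta_{p,q}(i+1)=2^{2^{\Delta_{p,q}(i)\cdot 2^{20qp^2}}}\qquad(i\ge 1).$$ **Lemma.** There is an algorithm that takes as input an FO sentence $\phi$ with $q$ quantifiers, a graph $G=(V,E)$, and a normalized ranked path decomposition of $G$ with ranking function $\rho:V\to[p]$, such that some vertex of $G$ appears in at least $3p\cdot\Delta_{p,q}(p)$ bags. The algorithm runs in time polynomial in the size of the input (the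 polynomial being independent of $p$, $q$, $\phi$ and $G$), and outputs a graph $G'=(V',E')$ with $V'\subsetneq V$ and a normalized ranked path decomposition of $G'$ with the same ranking function (that is, $\rho$ restricted to $V'$, with ranks in $[p]$), such that for every FO sentence $\psi$ with at most $q$ quantifiers, $G\models\psi$ if and only if $G'\models\psi$; in particular $G\models\phi$ if and only if $G'\models\phi$. -/

import Mathlib

namespace FOPathwidth

/-! ### First-order logic on graphs -/

/-- First-order formulas over the vocabulary of graphs, with variables `x₀, x₁, …`:
`φ → ∃ x. φ | ¬ φ | φ ∨ φ | x ∼ y | x = y`. -/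
inductive Formula : Type
  | ex (x : ℕ) (φ : Formula) : Formula
  | neg (φ : Formula) : Formula
  | or (φ ψ : Formula) : Formula
  | adj (x y : ℕ) : Formula
  | eq (x y : ℕ) : Formula

namespace Formula

/-- The variables with a free occurrence. -/
def freeVars : Formula → Finset ℕ
  | ex x φ => φ.freeVars.erase x
  | neg φ => φ.freeVars
  | or φ ψ => φ.freeVars ∪ ψ.freeVars
  | adj x y => {x, y}
  | eq x y => {x, y}

/-- A sentence is a formula without free variables. -/
def IsSentence (φ : Formula) : Prop := φ.freeVars = ∅

/-- The number of (occurrences of) quantifiers. -/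
def quantifiers : Formula → ℕ
  | ex _ φ => φ.quantifiers + 1
  | neg φ => φ.quantifiers
  | or φ ψ => φ.quantifiers + ψ.quantifiers
  | adj _ _ => 0
  | eq _ _ => 0

/-- Satisfaction under a partial assignment of vertices to variables (partial, so that it makes
sense for every graph). -/
def Sat {V : Type*} (G : SimpleGraph V) : (ℕ → Option V) → Formula → Prop
  | s, ex x φ => ∃ v : V, Sat G (Function.update s x (some v)) φ
  | s, neg φ => ¬ Sat G s φ
  | s, or φ ψ => Sat G s φ ∨ Sat G s ψ
  | s, adj x y => ∃ u v : V, s x = some u ∧ s y = some v ∧ G.Adj u v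
  | s, eq x y => ∃ v : V, s x = some v ∧ s y = some v

end Formula

/-- `G ⊨ φ` for a sentence `φ`. -/
def Models {V : Type*} (G : SimpleGraph V) (φ : Formula) : Prop :=
  Formula.Sat G (fun _ => none) φ

/-! ### Normalized ranked path decompositions -/

/-- The bags `B₀, …, B_{ℓ-1}` form a path decomposition of `G`. -/
structure IsPathDecomposition {V : Type*} (G : SimpleGraph V) {l : ℕ} (B : Fin l → Set V) :
    Prop where
  vertex_mem : ∀ v : V, ∃ i, v ∈ B i
  edge_mem : ∀ u v : V, G.Adj u v → ∃ i, u ∈ B i ∧ v ∈ B i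
  inter_subset : ∀ i₁ i₂ i₃ : Fin l, i₁ < i₂ → i₂ < i₃ → B i₁ ∩ B i₃ ⊆ B i₂

/-- The bags form a ranked path decomposition of `G` with ranking function `ρ : V → [p]`: no bag
contains two vertices of the same rank (in particular no bag has more than `p` vertices). -/
structure IsRankedPathDecomposition {V : Type*} (G : SimpleGraph V) (p : ℕ) (ρ : V → ℕ)
    {l : ℕ} (B : Fin l → Set V) : Prop extends IsPathDecomposition G B where
  rank_mem : ∀ v : V, 1 ≤ ρ v ∧ ρ v ≤ p
  rank_inj : ∀ i, ∀ u ∈ B i, ∀ v ∈ B i, ρ u = ρ v → u = v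

/-- Normalized ranked path decompositions: a vertex shares bags with at most two vertices of any
given higher rank, and each bag (after the first) has a vertex that is not in the previous bag. -/
structure IsNormalized {V : Type*} (G : SimpleGraph V) (p : ℕ) (ρ : V → ℕ)
    {l : ℕ} (B : Fin l → Set V) : Prop extends IsRankedPathDecomposition G p ρ B where
  higher_rank : ∀ v : V, ∀ j, ρ v < j → j ≤ p →
    {u : V | ρ u = j ∧ ∃ i, u ∈ B i ∧ v ∈ B i}.encard ≤ 2
  new_vertex : ∀ i j : Fin l, (i : ℕ) + 1 = j → ∃ v ∈ B j, v ∉ B i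

/-- The number of bags in which a vertex appears. -/
noncomputable def occurrences {V : Type*} {l : ℕ} (B : Fin l → Set V) (v : V) : ℕ :=
  {i : Fin l | v ∈ B i}.ncard

/-- The bound function `Δ_{p,q}`, indexed from `1`:
`Δ(1) = 3p` and `Δ(i+1) = 2^(2^(Δ(i) * 2^(20 q p²)))`. (The value at `0` is never used.) -/
def Delta (p q : ℕ) : ℕ → ℕ
  | 0 => 0
  | 1 => 3 * p
  | i + 2 => 2 ^ (2 ^ (Delta p q (i + 1) * 2 ^ (20 * q * p ^ 2)))

/-! ### Explicitly given graphs and decompositions, as inputs and outputs of algorithms -/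

/-- A finite graph with bags, written down as lists. Vertices are named by natural numbers. -/
structure Presentation : Type where
  verts : List ℕ
  edges : List (ℕ × ℕ)
  bags : List (List ℕ)

namespace Presentation

/-- Vertices are listed once, edges join two distinct listed vertices, and bags consist of listed
vertices. -/
structure WellFormed (I : Presentation) : Prop where
  verts_nodup : I.verts.Nodup
  edges_mem : ∀ e ∈ I.edges, e.1 ∈ I.verts ∧ e.2 ∈ I.verts ∧ e.1 ≠ e.2
  bags_mem : ∀ b ∈ I.bags, ∀ v ∈ b, v ∈ I.verts

/-- The vertex set. -/
abbrev Vertex (I : Presentation) : Type := {v : ℕ // v ∈ I.verts}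

/-- The (simple, undirected) graph. -/
def graph (I : Presentation) : SimpleGraph I.Vertex :=
  SimpleGraph.fromRel fun u v => (u.1, v.1) ∈ I.edges

/-- The sequence of bags. -/
def bag (I : Presentation) (i : Fin I.bags.length) : Set I.Vertex :=
  {v | v.1 ∈ I.bags[i]}

/-- The presented bags form a normalized ranked path decomposition of the presented graph, with
respect to the restriction of `ρ` to the vertices of the graph. -/
def Normalized (I : Presentation) (p : ℕ) (ρ : ℕ → ℕ) : Prop :=
  IsNormalized I.graph p (fun v : I.Vertex => ρ v.1) I.bag

end Presentation

/-! ### The machine model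

A first-order LISP-like language. Values are binary trees of cells, with natural numbers as atoms.
Every elementary operation takes one step: creating a cell, following a pointer,
incrementing, decrementing or comparing atoms, looking up a variable, branching. In `t` steps an
atom grows by at most `t`, so this is polynomially equivalent to Turing machines. -/

/-- Values: atoms and cells. -/
inductive Val : Type
  | atom (n : ℕ) : Val
  | cell (a b : Val) : Val
  deriving DecidableEq

namespace Val

/-- The number of symbols needed to write a value down (with atoms in binary). -/
def size : Val → ℕ
  | atom n => n.size + 1
  | cell a b => a.size + b.size + 1

/-- First component of a cell. -/
def hd : Val → Val
  | atom _ => atom 0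
  | cell a _ => a

/-- Second component of a cell. -/
def tl : Val → Val
  | atom _ => atom 0
  | cell _ b => b

/-- Increment an atom. -/
def succ : Val → Val
  | atom n => atom (n + 1)
  | cell _ _ => atom 0

/-- Decrement an atom. -/
def pred : Val → Val
  | atom n => atom (n - 1)
  | cell _ _ => atom 0

/-- Comparison of atoms. -/
def atomEq : Val → Val → Val
  | atom m, atom n => if m = n then atom 1 else atom 0
  | _, _ => atom 0

end Val

/-- Programs. Variables are positions in the environment, counted from its most recent entry. -/
inductive Prog : Type
  | var (i : ℕ) : Prog
  | num (n : ℕ) : Prog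
  | cell (a b : Prog) : Prog
  | hd (a : Prog) : Prog
  | tl (a : Prog) : Prog
  | succ (a : Prog) : Prog
  | pred (a : Prog) : Prog
  | atomEq (a b : Prog) : Prog
  | ite (c a b : Prog) : Prog
  | letin (a b : Prog) : Prog
  | loop (a : Prog) : Prog

/-- `Eval M env v t`: in the environment `env` the program `M` halts with value `v` after exactly
`t` steps. In `ite` the atom `0` means false and every other value means true. `letin a b` adds
the value of `a` to the environment and runs `b`. `loop a` runs `a` repeatedly, the most recent
entry of the environment being the loop variable: the first component of the value of `a` tells
whether to go on (true) or to stop (false), and the second component is the new value of the loop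
variable, or the result. -/
inductive Eval : Prog → List Val → Val → ℕ → Prop
  | var (i : ℕ) (env : List Val) : Eval (.var i) env (env.getD i (.atom 0)) 1
  | num (n : ℕ) (env : List Val) : Eval (.num n) env (.atom n) 1
  | cell {a b : Prog} {env : List Val} {x y : Val} {s t : ℕ} :
      Eval a env x s → Eval b env y t → Eval (.cell a b) env (.cell x y) (s + t + 1)
  | hd {a : Prog} {env : List Val} {x : Val} {t : ℕ} :
      Eval a env x t → Eval (.hd a) env x.hd (t + 1)
  | tl {a : Prog} {env : List Val} {x : Val} {t : ℕ} :
      Eval a env x t → Eval (.tl a) env x.tl (t + 1)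
  | succ {a : Prog} {env : List Val} {x : Val} {t : ℕ} :
      Eval a env x t → Eval (.succ a) env x.succ (t + 1)
  | pred {a : Prog} {env : List Val} {x : Val} {t : ℕ} :
      Eval a env x t → Eval (.pred a) env x.pred (t + 1)
  | atomEq {a b : Prog} {env : List Val} {x y : Val} {s t : ℕ} :
      Eval a env x s → Eval b env y t → Eval (.atomEq a b) env (x.atomEq y) (s + t + 1)
  | ite_true {c a b : Prog} {env : List Val} {x y : Val} {s t : ℕ} :
      Eval c env x s → x ≠ .atom 0 → Eval a env y t → Eval (.ite c a b) env y (s + t + 1)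
  | ite_false {c a b : Prog} {env : List Val} {x y : Val} {s t : ℕ} :
      Eval c env x s → x = .atom 0 → Eval b env y t → Eval (.ite c a b) env y (s + t + 1)
  | letin {a b : Prog} {env : List Val} {x y : Val} {s t : ℕ} :
      Eval a env x s → Eval b (x :: env) y t → Eval (.letin a b) env y (s + t + 1)
  | loop_stop {a : Prog} {env : List Val} {x y : Val} {t : ℕ} :
      Eval a (x :: env) y t → y.hd = .atom 0 → Eval (.loop a) (x :: env) y.tl (t + 1)
  | loop_step {a : Prog} {env : List Val} {x y z : Val} {s t : ℕ} :
      Eval a (x :: env) y s → y.hd ≠ .atom 0 → Eval (.loop a) (y.tl :: env) z t →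
        Eval (.loop a) (x :: env) z (s + t + 1)

/-! ### Inputs and outputs as values -/

/-- A list as a chain of cells that ends with the atom `0`. -/
def encodeList {α : Type*} (f : α → Val) : List α → Val
  | [] => .atom 0
  | a :: as => .cell (f a) (encodeList f as)

/-- A pair of numbers as a cell. -/
def encodePair (e : ℕ × ℕ) : Val := .cell (.atom e.1) (.atom e.2)

/-- A formula as its tree, with a number for each kind of node. -/
def encodeFormula : Formula → Val
  | .ex x φ => .cell (.atom 0) (.cell (.atom x) (encodeFormula φ))
  | .neg φ => .cell (.atom 1) (encodeFormula φ)
  | .or φ ψ => .cell (.atom 2) (.cell (encodeFormula φ) (encodeFormula ψ))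
  | .adj x y => .cell (.atom 3) (.cell (.atom x) (.atom y))
  | .eq x y => .cell (.atom 4) (.cell (.atom x) (.atom y))

/-- A graph with bags and ranks: the lists of vertices, edges and bags, and the table of
the pairs `(v, ρ v)` for the vertices `v` of the graph. -/
def encodeRanked (I : Presentation) (ρ : ℕ → ℕ) : Val :=
  .cell (encodeList Val.atom I.verts) <|
  .cell (encodeList encodePair I.edges) <|
  .cell (encodeList (encodeList Val.atom) I.bags)
    (encodeList encodePair (I.verts.map fun v => (v, ρ v)))

/-- The complete input: the formula, the number of ranks, the graph with bags and ranks. -/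
def encodeInput (φ : Formula) (p : ℕ) (I : Presentation) (ρ : ℕ → ℕ) : Val :=
  .cell (encodeFormula φ) (.cell (.atom p) (encodeRanked I ρ))

end FOPathwidth

open FOPathwidth

/-! Take the least rank `i` for which some vertex `v` of rank `i` lies in at least `3p·Δ(i)` bags.
It is not `1`: every further bag of a rank-1 vertex brings a new vertex of higher rank, and there
are at most `2p` of these (`rank_one_short`). Put `D = 3p·Δ(i-1)`. Vertices of rank below `i` lie in
fewer than `D` bags, and `v` meets at most `2p` vertices of higher rank. So a part of the stretch of
`v`, shorter by a factor of at most `3^(2p)`, contains each of these in all of its bags or in none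
(`exists_constant_part`). In that part every vertex is constant or short-lived.

Describe a bag by a letter that records, in terms of ranks, which vertices are present, which are
adjacent and which were in the previous bag; there are at most `2^(3p²)` letters. With `R = 2·3^q·D`
the part is long enough for a factor in which every window of `2R+1` letters occurs often
(`exists_frequent_factor`). By pigeonhole two windows near its beginning agree (`exists_suitable`).
If they end in the bags `a < b`, the bags `a+1, …, b` are removed and `b` is glued to `a` by rank.

Sentences with `q` quantifiers do not notice the cut, by an Ehrenfeucht–Fraïssé game on bag
positions (`Similar.exists_response`). A move near a matched position is answered with the same
offset, any other move by an occurrence of its window that is far from all matched positions. The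
radius of agreement shrinks by a factor of three per round and ends at `2D`, which suffices to
follow short-lived vertices and their edges (`partner_injective`, `partner_adj`). Constant vertices
are represented by bags outside of the zone and answer themselves. Normality survives because the
letters before `a` and before `b` agree (`cut_neighbors`, `exists_new`).

The algorithm computes neither `Δ` nor `q`. Whether a place is suitable for a parameter `g` is a
polynomial-time test, and a suitable place is harmless for every `q` with `2·3^q ≤ g`
(`Suitable.models_iff`). All places are tried in descending order of `g`. Since a place with `g =
2·3^q` exists, the first one found is good enough, and the formula is never read. -/

namespace FOPathwidth

/-! ### Polynomial-time functions -/

/-- Types whose elements are written down as values. -/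
class Enc (α : Type) where
  /-- The value that represents an element. -/
  enc : α → Val

open Enc

/-- Natural numbers as labels, written as atoms. (Natural numbers as such are written in unary.) -/
def Lab : Type := ℕ

/-- A number as a label. -/
def label (n : ℕ) : Lab := n

instance : DecidableEq Lab := inferInstanceAs (DecidableEq ℕ)

instance : Enc Lab := ⟨Val.atom⟩
instance : Enc Bool := ⟨fun b => .atom b.toNat⟩
instance : Enc ℕ := ⟨fun n => encodeList (fun _ : Unit => .atom 0) (List.replicate n ())⟩
instance {α β : Type} [Enc α] [Enc β] : Enc (α × β) := ⟨fun x => .cell (enc x.1) (enc x.2)⟩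
instance {α : Type} [Enc α] : Enc (List α) := ⟨encodeList enc⟩

/-- The size of the value that represents an element. -/
def esize {α : Type} [Enc α] (a : α) : ℕ := (enc a).size

/-! ### Sizes of encodings -/

section Size

variable {α β : Type} [Enc α] [Enc β]

theorem esize_pair (a : α) (b : β) : esize (a, b) = esize a + esize b + 1 := rfl

theorem esize_nil : esize ([] : List α) = 1 := by
  simp [esize, enc, encodeList, Val.size]

theorem esize_cons (a : α) (l : List α) : esize (a :: l) = esize a + esize l + 1 := rfl

theorem esize_append (l m : List α) : esize (l ++ m) + 1 = esize l + esize m := by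
  induction l with
  | nil => simp [esize_nil]; ring
  | cons a l ih => rw [List.cons_append, esize_cons, esize_cons]; omega

theorem length_le_esize (l : List α) : l.length ≤ esize l := by
  induction l with
  | nil => simp
  | cons a l ih => rw [List.length_cons, esize_cons]; omega

theorem esize_le_of_mem {a : α} {l : List α} (h : a ∈ l) : esize a ≤ esize l := by
  induction l with
  | nil => simp at h
  | cons b l ih =>
    rw [esize_cons]
    rcases List.mem_cons.1 h with rfl | h
    · omega
    · have := ih h; omega

theorem esize_sublist {l m : List α} (h : l.Sublist m) : esize l ≤ esize m := by
  induction h with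
  | slnil => exact le_rfl
  | cons a _ ih => rw [esize_cons]; omega
  | cons_cons a _ ih => rw [esize_cons, esize_cons]; omega

theorem esize_bool (b : Bool) : esize b ≤ 2 := by
  cases b <;> decide

theorem esize_nat (n : ℕ) : esize n = 2 * n + 1 := by
  have h1 : (Val.atom 0).size = 1 := by decide
  have h : ∀ n : ℕ, (encodeList (fun _ : Unit => Val.atom 0) (List.replicate n ())).size
      = 2 * n + 1 := by
    intro n
    induction n with
    | zero => simp [encodeList, h1]
    | succ n ih =>
      rw [List.replicate_succ, encodeList, Val.size, ih, h1]; ring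
  exact h n

theorem esize_reverse (l : List α) : esize l.reverse = esize l := by
  induction l with
  | nil => rfl
  | cons a l ih =>
    have := esize_append l.reverse [a]
    rw [List.reverse_cons, esize_cons]
    rw [esize_cons, esize_nil] at this
    omega

end Size

theorem esize_flatMap_le {α β : Type} [Enc β] {f : α → List β} {l : List α} {B : ℕ}
    (h : ∀ a ∈ l, esize (f a) ≤ B) : esize (l.flatMap f) ≤ l.length * B + 1 := by
  induction l with
  | nil => simp [esize_nil]
  | cons a l ih =>
    have h1 := esize_append (f a) (l.flatMap f)
    have h2 := h a (by simp)
    have h3 := ih fun b hb => h b (by simp [hb])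
    rw [List.flatMap_cons, List.length_cons, add_mul]
    omega

/-- Bounds that are at most a fixed power of the argument plus two. -/
def PolyBdd (b : ℕ → ℕ) : Prop := ∃ c, ∀ n, b n ≤ (n + 2) ^ c

namespace PolyBdd

variable {b b' : ℕ → ℕ}

theorem pow (c : ℕ) : PolyBdd fun n => (n + 2) ^ c := ⟨c, fun _ => le_rfl⟩

theorem id : PolyBdd fun n => n := ⟨1, fun n => by simp⟩

theorem const (k : ℕ) : PolyBdd fun _ => k :=
  ⟨k, fun n => (Nat.lt_two_pow_self (n := k)).le.trans (Nat.pow_le_pow_left (by omega) k)⟩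

theorem mul (h : PolyBdd b) (h' : PolyBdd b') : PolyBdd fun n => b n * b' n := by
  obtain ⟨c, hc⟩ := h
  obtain ⟨d, hd⟩ := h'
  exact ⟨c + d, fun n => by rw [pow_add]; exact Nat.mul_le_mul (hc n) (hd n)⟩

theorem add (h : PolyBdd b) (h' : PolyBdd b') : PolyBdd fun n => b n + b' n := by
  obtain ⟨c, hc⟩ := h
  obtain ⟨d, hd⟩ := h'
  refine ⟨c + d + 1, fun n => ?_⟩
  have h1 : 1 ≤ (n + 2) ^ c := Nat.one_le_pow _ _ (by omega)
  have h2 : 1 ≤ (n + 2) ^ d := Nat.one_le_pow _ _ (by omega)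
  have h3 : (n + 2) ^ (c + d + 1) = (n + 2) ^ c * (n + 2) ^ d * (n + 2) := by ring
  rw [h3]
  nlinarith [hc n, hd n, Nat.mul_le_mul h1 h2,
    mul_nonneg (Nat.zero_le ((n + 2) ^ c * (n + 2) ^ d)) (Nat.zero_le n),
    Nat.le_mul_of_pos_right ((n + 2) ^ c) h2, Nat.le_mul_of_pos_left ((n + 2) ^ d) h1]

theorem comp (h : PolyBdd b) (h' : PolyBdd b') (hm : Monotone b) : PolyBdd fun n => b (b' n) := by
  obtain ⟨c, hc⟩ := h
  obtain ⟨d, hd⟩ := h'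
  obtain ⟨e, he⟩ := (pow d).add (const 2)
  refine ⟨e * c, fun n => ?_⟩
  calc b (b' n) ≤ b ((n + 2) ^ d) := hm (hd n)
    _ ≤ ((n + 2) ^ d + 2) ^ c := hc _
    _ ≤ ((n + 2) ^ e) ^ c := Nat.pow_le_pow_left (he n) c
    _ = (n + 2) ^ (e * c) := by rw [pow_mul]

theorem exists_monotone (h : PolyBdd b) : ∃ b', PolyBdd b' ∧ Monotone b' ∧ ∀ n, b n ≤ b' n := by
  obtain ⟨c, hc⟩ := h
  exact ⟨fun n => (n + 2) ^ c, pow c, fun m n hmn => Nat.pow_le_pow_left (by omega) c, hc⟩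

end PolyBdd

/-- Functions computed in polynomial time, with results of polynomial size. The program reads its
argument from the most recent entry of the environment. -/
@[fun_prop]
def PT {α β : Type} [Enc α] [Enc β] (f : α → β) : Prop :=
  ∃ (M : Prog) (b : ℕ → ℕ), PolyBdd b ∧ Monotone b ∧ ∀ a : α, esize (f a) ≤ b (esize a) ∧
    ∀ rest, ∃ t ≤ b (esize a), Eval M (enc a :: rest) (enc (f a)) t

theorem exists_constant_prog (v : Val) : ∃ M t, ∀ env, Eval M env v t := by
  induction v with
  | atom n => exact ⟨.num n, 1, fun env => .num n env⟩
  | cell x y ihx ihy =>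
    obtain ⟨M, s, hM⟩ := ihx
    obtain ⟨N, t, hN⟩ := ihy
    exact ⟨.cell M N, s + t + 1, fun env => .cell (hM env) (hN env)⟩

theorem Val.atomEq_atom (m n : ℕ) :
    Val.atomEq (.atom m) (.atom n) = .atom (decide (m = n)).toNat := by
  by_cases h : m = n <;> simp [Val.atomEq, h]

namespace PT

variable {α β γ δ σ : Type} [Enc α] [Enc β] [Enc γ] [Enc δ] [Enc σ]

/-- `PT` demands a monotone bound because composition applies it to an estimate for the size of an
intermediate result. A majorant `(n + 2) ^ c` provides monotonicity for free. -/
theorem intro {f : α → β} (M : Prog) {b : ℕ → ℕ} (hb : PolyBdd b)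
    (h1 : ∀ a, esize (f a) ≤ b (esize a))
    (h2 : ∀ a rest, ∃ t ≤ b (esize a), Eval M (enc a :: rest) (enc (f a)) t) : PT f := by
  obtain ⟨b', hb', hm, hle⟩ := hb.exists_monotone
  exact ⟨M, b', hb', hm, fun a => ⟨(h1 a).trans (hle _), fun rest =>
    let ⟨t, ht, he⟩ := h2 a rest
    ⟨t, ht.trans (hle _), he⟩⟩⟩

theorem size_bound {f : α → β} (hf : PT f) :
    ∃ b : ℕ → ℕ, PolyBdd b ∧ Monotone b ∧ ∀ a, esize (f a) ≤ b (esize a) := by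
  obtain ⟨M, b, hb, hm, h⟩ := hf
  exact ⟨b, hb, hm, fun a => (h a).1⟩

@[fun_prop]
theorem id : PT fun a : α => a :=
  intro (.var 0) (PolyBdd.id.add (.const 1)) (fun a => by simp)
    fun a rest => ⟨1, by simp, by simpa using Eval.var 0 (enc a :: rest)⟩

@[fun_prop]
theorem const (k : β) : PT fun _ : α => k := by
  obtain ⟨M, t, hM⟩ := exists_constant_prog (enc k)
  exact intro M (.const (esize k + t)) (fun a => by simp) fun a rest => ⟨t, by simp, hM _⟩

@[fun_prop]
theorem comp {g : β → γ} {f : α → β} (hg : PT g) (hf : PT f) : PT fun a => g (f a) := by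
  obtain ⟨M, b, hb, hbm, h⟩ := hf
  obtain ⟨N, c, hc, hcm, h'⟩ := hg
  refine intro (.letin M N) ((hb.add (hc.comp hb hcm)).add (.const 1)) (fun a => ?_)
    fun a rest => ?_
  · have := ((h' (f a)).1).trans (hcm (h a).1)
    omega
  · obtain ⟨s, hs, hM⟩ := (h a).2 rest
    obtain ⟨t, ht, hN⟩ := (h' (f a)).2 (enc a :: rest)
    refine ⟨s + t + 1, ?_, .letin hM hN⟩
    have := ht.trans (hcm (h a).1)
    omega

@[fun_prop]
theorem pair {f : α → β} {g : α → γ} (hf : PT f) (hg : PT g) : PT fun a => (f a, g a) := by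
  obtain ⟨M, b, hb, hbm, h⟩ := hf
  obtain ⟨N, c, hc, hcm, h'⟩ := hg
  refine intro (.cell M N) ((hb.add hc).add (.const 1)) (fun a => ?_) fun a rest => ?_
  · have := (h a).1
    have := (h' a).1
    rw [esize_pair]
    omega
  · obtain ⟨s, hs, hM⟩ := (h a).2 rest
    obtain ⟨t, ht, hN⟩ := (h' a).2 rest
    exact ⟨s + t + 1, by omega, .cell hM hN⟩

@[fun_prop]
theorem fst : PT (Prod.fst : α × β → α) :=
  intro (.hd (.var 0)) (PolyBdd.id.add (.const 2))
    (fun a => by have := esize_pair a.1 a.2; simp only [Prod.mk.eta] at this; omega)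
    fun a rest => ⟨2, by simp, .hd (Eval.var 0 (enc a :: rest))⟩

@[fun_prop]
theorem snd : PT (Prod.snd : α × β → β) :=
  intro (.tl (.var 0)) (PolyBdd.id.add (.const 2))
    (fun a => by have := esize_pair a.1 a.2; simp only [Prod.mk.eta] at this; omega)
    fun a rest => ⟨2, by simp, .tl (Eval.var 0 (enc a :: rest))⟩

theorem bcond {p : α → Bool} {f g : α → β} (hp : PT p) (hf : PT f) (hg : PT g) :
    PT fun a => bif p a then f a else g a := by
  obtain ⟨L, d, hd, hdm, h''⟩ := hp
  obtain ⟨M, b, hb, hbm, h⟩ := hf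
  obtain ⟨N, c, hc, hcm, h'⟩ := hg
  refine intro (.ite L M N) (((hb.add hc).add hd).add (.const 1)) (fun a => ?_) fun a rest => ?_
  · have := (h a).1
    have := (h' a).1
    cases p a <;> simp only [cond_true, cond_false] <;> omega
  · obtain ⟨r, hr, hL⟩ := (h'' a).2 rest
    cases hpa : p a
    · obtain ⟨t, ht, hN⟩ := (h' a).2 rest
      exact ⟨r + t + 1, by omega, .ite_false hL (by rw [hpa]; rfl) hN⟩
    · obtain ⟨t, ht, hM⟩ := (h a).2 rest
      exact ⟨r + t + 1, by omega, .ite_true hL (by rw [hpa]; simp [enc]) hM⟩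

@[fun_prop]
theorem and {p q : α → Bool} (hp : PT p) (hq : PT q) : PT fun a => p a && q a := by
  have := bcond hp hq (const false)
  convert this using 2 with a
  cases p a <;> rfl

@[fun_prop]
theorem or {p q : α → Bool} (hp : PT p) (hq : PT q) : PT fun a => p a || q a := by
  have := bcond hp (const true) hq
  convert this using 2 with a
  cases p a <;> rfl

@[fun_prop]
theorem not {p : α → Bool} (hp : PT p) : PT fun a => !p a := by
  have := bcond hp (const false) (const true)
  convert this using 2 with a
  cases p a <;> rfl

theorem lab_eq {f g : α → Lab} (hf : PT f) (hg : PT g) : PT fun a => decide (f a = g a) := by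
  have h : PT fun x : Lab × Lab => decide (x.1 = x.2) := by
    refine intro (.atomEq (.hd (.var 0)) (.tl (.var 0))) (.const 5)
      (fun a => (esize_bool _).trans (by norm_num)) fun a rest => ⟨5, le_rfl, ?_⟩
    have := Eval.atomEq (.hd (Eval.var 0 (enc a :: rest))) (.tl (Eval.var 0 (enc a :: rest)))
    convert this using 1
    exact (Val.atomEq_atom a.1 a.2).symm
  exact h.comp (hf.pair hg)

-- A nonempty list and the pair of its head and tail are written as the same value, so the program
-- for the pair serves unchanged.
@[fun_prop]
theorem cons {f : α → β} {l : α → List β} (hf : PT f) (hl : PT l) : PT fun a => f a :: l a := by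
  obtain ⟨M, b, hb, hbm, h⟩ := hf.pair hl
  exact ⟨M, b, hb, hbm, h⟩

/-- Iteration over a list with a state of polynomial size. -/
theorem foldl {l : α → List β} {s : α → σ} {g : α → σ → β → σ} (hl : PT l) (hs : PT s)
    (hg : PT fun x : α × σ × β => g x.1 x.2.1 x.2.2)
    (hsize : ∃ c : ℕ → ℕ, PolyBdd c ∧ ∀ a m, m <+: l a → esize (m.foldl (g a) (s a)) ≤ c (esize a)) :
    PT fun a => (l a).foldl (g a) (s a) := by
  obtain ⟨c, hc, hcs⟩ := hsize
  obtain ⟨L, bl, hbl, hblm, hL⟩ := hl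
  obtain ⟨S, bs, hbs, hbsm, hS⟩ := hs
  obtain ⟨G, bg, hbg, hbgm, hG⟩ := hg
  -- The loop variable is the cell (remaining list, (state, argument)); the loop stops when the
  -- remaining list is the atom `0`.
  let body : Prog := .ite (.hd (.var 0))
    (.cell (.num 1) (.cell (.tl (.hd (.var 0)))
      (.cell (.letin (.cell (.tl (.tl (.var 0))) (.cell (.hd (.tl (.var 0))) (.hd (.hd (.var 0))))) G)
        (.tl (.tl (.var 0))))))
    (.cell (.num 0) (.hd (.tl (.var 0))))
  let stepb : ℕ → ℕ := fun n => bg (n + (c n + bl n + 2) + 0)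
  have hstepb : PolyBdd stepb :=
    hbg.comp (((PolyBdd.id.add ((hc.add hbl).add (.const 2)))).add (.const 0)) hbgm
  -- `m` is the part already consumed, `r` the rest; the induction is on `r`.
  have key : ∀ a rest, ∀ (r m : List β), m ++ r = l a →
      ∃ t ≤ (r.length + 1) * (stepb (esize a) + 50),
        Eval (.loop body) (.cell (enc r) (.cell (enc (m.foldl (g a) (s a))) (enc a)) :: rest)
          (enc ((l a).foldl (g a) (s a))) t := by
    intro a rest r
    induction r with
    | nil =>
      intro m hm
      rw [List.append_nil] at hm
      subst hm
      set w : Val := .cell (enc ([] : List β)) (.cell (enc ((l a).foldl (g a) (s a))) (enc a)) with hw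
      have e0 : Eval (.var 0) (w :: rest) w 1 := Eval.var 0 (w :: rest)
      have e1 := Eval.ite_false (a := .cell (.num 1) (.cell (.tl (.hd (.var 0)))
        (.cell (.letin (.cell (.tl (.tl (.var 0)))
          (.cell (.hd (.tl (.var 0))) (.hd (.hd (.var 0))))) G) (.tl (.tl (.var 0))))))
        (Eval.hd e0) (by rfl) (.cell (Eval.num 0 (w :: rest)) (.hd (.tl e0)))
      exact ⟨_, (by simp), Eval.loop_stop e1 rfl⟩
    | cons b r ih =>
      intro m hm
      obtain ⟨t, ht, hE⟩ := ih (m ++ [b]) (by simpa using hm)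
      set w : Val := .cell (enc (b :: r)) (.cell (enc (m.foldl (g a) (s a))) (enc a)) with hw
      have e0 : Eval (.var 0) (w :: rest) w 1 := Eval.var 0 (w :: rest)
      obtain ⟨u, hu, hGe⟩ := (hG (a, m.foldl (g a) (s a), b)).2 (w :: rest)
      have e1 : Eval (.cell (.tl (.tl (.var 0))) (.cell (.hd (.tl (.var 0))) (.hd (.hd (.var 0)))))
          (w :: rest) (enc (a, m.foldl (g a) (s a), b)) _ :=
        .cell (.tl (.tl e0)) (.cell (.hd (.tl e0)) (.hd (.hd e0)))
      have e2 := Eval.ite_true (b := .cell (.num 0) (.hd (.tl (.var 0))))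
        (Eval.hd e0) (by simp [hw, Val.hd, enc, encodeList])
        (.cell (Eval.num 1 (w :: rest)) (.cell (.tl (.hd e0)) (.cell (.letin e1 hGe) (.tl (.tl e0)))))
      rw [List.foldl_append] at hE
      refine ⟨_, ?_, .loop_step e2 (by simp [Val.hd]) hE⟩
      have h1 : esize (a, m.foldl (g a) (s a), b) ≤ esize a + (c (esize a) + bl (esize a) + 2) + 0 := by
        rw [esize_pair, esize_pair]
        have := hcs a m ⟨b :: r, hm⟩
        have h2 : esize b ≤ esize (l a) := esize_le_of_mem (by rw [← hm]; simp)
        have := (hL a).1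
        omega
      have h2 : u ≤ stepb (esize a) := hu.trans (hbgm h1)
      rw [List.length_cons, add_mul (r.length + 1), one_mul]
      omega
  refine intro (.letin (.cell L (.cell S (.var 0))) (.loop body))
    (b := fun n => (bl n + 1) * (stepb n + 50) + bl n + bs n + c n + 10)
    (((((hbl.add (.const 1)).mul (hstepb.add (.const 50))).add hbl).add hbs).add hc |>.add (.const 10))
    (fun a => ?_) fun a rest => ?_
  · have := hcs a (l a) (List.prefix_refl _)
    omega
  · obtain ⟨t1, ht1, e1⟩ := (hL a).2 rest
    obtain ⟨t2, ht2, e2⟩ := (hS a).2 rest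
    obtain ⟨t3, ht3, e3⟩ := key a (enc a :: rest) (l a) [] rfl
    refine ⟨_, ?_, .letin (.cell e1 (.cell e2 (Eval.var 0 (enc a :: rest)))) e3⟩
    have h1 : (l a).length ≤ bl (esize a) := (length_le_esize _).trans (hL a).1
    have := Nat.mul_le_mul_right (stepb (esize a) + 50) (Nat.add_le_add_right h1 1)
    omega

theorem foldl_bool {l : α → List β} {s : α → Bool} {g : α → Bool → β → Bool} (hl : PT l)
    (hs : PT s) (hg : PT fun x : α × Bool × β => g x.1 x.2.1 x.2.2) :
    PT fun a => (l a).foldl (g a) (s a) :=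
  foldl hl hs hg ⟨fun _ => 2, .const 2, fun _ _ _ => esize_bool _⟩

@[fun_prop]
theorem any {l : α → List β} {p : α → β → Bool} (hl : PT l) (hp : PT fun x : α × β => p x.1 x.2) :
    PT fun a => (l a).any (p a) := by
  have h := foldl_bool (g := fun a s b => s || p a b) hl (const false)
    (or (by fun_prop) (hp.comp (g := fun x : α × β => p x.1 x.2)
      (f := fun x : α × Bool × β => (x.1, x.2.2)) (by fun_prop)))
  convert h using 2 with a
  have key : ∀ (m : List β) (s : Bool), m.foldl (fun s b => s || p a b) s = (s || m.any (p a)) := by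
    intro m
    induction m with
    | nil => simp
    | cons b m ih => intro s; simp [ih, Bool.or_assoc]
  simp [key]

@[fun_prop]
theorem all {l : α → List β} {p : α → β → Bool} (hl : PT l) (hp : PT fun x : α × β => p x.1 x.2) :
    PT fun a => (l a).all (p a) := by
  have h := not (any (p := fun a b => !p a b) hl (not hp))
  convert h using 2 with a
  rw [List.not_any_eq_all_not]
  simp

/-- Consing one entry after the other reverses the list; this one loop yields both `reverse` and
`append`. -/
theorem revAppend {l m : α → List β} (hl : PT l) (hm : PT m) :
    PT fun a => (l a).foldl (fun s b => b :: s) (m a) := by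
  refine foldl hl hm (by fun_prop) ?_
  obtain ⟨b, hb, hbm, hbl⟩ := hl.size_bound
  obtain ⟨c, hc, hcm, hcl⟩ := hm.size_bound
  refine ⟨_, hb.add hc, fun a k hk => ?_⟩
  have h1 := esize_append k.reverse (m a)
  have h2 := esize_reverse k
  have h3 := esize_sublist hk.sublist
  have := hbl a
  have := hcl a
  rw [List.foldl_flip_cons_eq_append']
  omega

@[fun_prop]
theorem reverse {l : α → List β} (hl : PT l) : PT fun a => (l a).reverse := by
  have := revAppend hl (const [])
  simpa [List.foldl_flip_cons_eq_append'] using this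

@[fun_prop]
theorem append {l m : α → List β} (hl : PT l) (hm : PT m) : PT fun a => l a ++ m a := by
  have := revAppend (reverse hl) hm
  simpa [List.foldl_flip_cons_eq_append'] using this

@[fun_prop]
theorem flatMap {l : α → List β} {f : α → β → List γ} (hl : PT l)
    (hf : PT fun x : α × β => f x.1 x.2) : PT fun a => (l a).flatMap (f a) := by
  have key : ∀ a (m : List β), m.foldl (fun s b => s ++ f a b) [] = m.flatMap (f a) := by
    intro a m
    simp [List.flatMap_eq_foldl]
  have h := foldl (s := fun _ => ([] : List γ)) (g := fun a s b => s ++ f a b) hl (const [])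
    (append (by fun_prop) (hf.comp (g := fun x : α × β => f x.1 x.2)
      (f := fun x : α × List γ × β => (x.1, x.2.2)) (by fun_prop))) ?_
  · simpa only [key] using h
  · obtain ⟨b, hb, hbm, hbl⟩ := hl.size_bound
    obtain ⟨c, hc, hcm, hcl⟩ := hf.size_bound
    refine ⟨_, (hb.mul (hc.comp ((PolyBdd.id.add hb).add (.const 1)) hcm)).add (.const 1),
      fun a m hm => ?_⟩
    rw [key]
    have h1 : m.length ≤ b (esize a) :=
      hm.length_le.trans ((length_le_esize _).trans (hbl a))
    refine (esize_flatMap_le (B := c (esize a + b (esize a) + 1)) fun x hx => ?_).trans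
      (Nat.add_le_add_right (Nat.mul_le_mul_right _ h1) 1)
    refine (hcl (a, x)).trans (hcm ?_)
    have h2 : esize x ≤ esize (l a) := esize_le_of_mem (hm.subset hx)
    have := hbl a
    rw [esize_pair]
    omega

@[fun_prop]
theorem map {l : α → List β} {f : α → β → γ} (hl : PT l)
    (hf : PT fun x : α × β => f x.1 x.2) : PT fun a => (l a).map (f a) := by
  have := flatMap (f := fun a b => [f a b]) hl (cons hf (const []))
  simpa only [List.flatMap_singleton', ← List.map_eq_flatMap] using this

@[fun_prop]
theorem filter {l : α → List β} {p : α → β → Bool} (hl : PT l)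
    (hp : PT fun x : α × β => p x.1 x.2) : PT fun a => (l a).filter (p a) := by
  have h := flatMap (f := fun a b => bif p a b then [b] else []) hl
    (bcond hp (by fun_prop) (by fun_prop))
  convert h using 2 with a
  induction l a with
  | nil => rfl
  | cons b m ih => cases hb : p a b <;> simp [hb, ih]

@[fun_prop]
theorem headD {l : α → List β} {d : α → β} (hl : PT l) (hd : PT d) :
    PT fun a => (l a).headD (d a) := by
  have hd1 : PT fun x : List β × β => x.1.headD x.2 := by
    refine intro (.ite (.hd (.var 0)) (.hd (.hd (.var 0))) (.tl (.var 0)))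
      (PolyBdd.id.add (.const 10)) ?_ ?_
    · rintro ⟨m, b⟩
      cases m with
      | nil => simp only [List.headD_nil, esize_pair]; omega
      | cons x m => simp only [List.headD_cons, esize_pair, esize_cons]; omega
    · rintro ⟨m, b⟩ rest
      have e0 := Eval.var 0 (enc (m, b) :: rest)
      cases m with
      | nil => exact ⟨_, by omega, .ite_false (.hd e0) rfl (.tl e0)⟩
      | cons x m => exact ⟨_, by omega, .ite_true (.hd e0) (by simp [enc, encodeList, Val.hd])
          (.hd (.hd e0))⟩
  exact hd1.comp (hl.pair hd)

@[fun_prop]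
theorem tail {l : α → List β} (hl : PT l) : PT fun a => (l a).tail := by
  have ht : PT fun x : List β => x.tail := by
    refine intro (.tl (.var 0)) (PolyBdd.id.add (.const 10)) ?_ ?_
    · intro m
      have := esize_sublist (List.tail_sublist m)
      omega
    · intro m rest
      have e0 := Eval.var 0 (enc m :: rest)
      have hm : enc m.tail = (enc m).tl := by cases m <;> rfl
      exact ⟨1 + 1, by omega, by rw [hm]; exact Eval.tl e0⟩
  exact ht.comp hl

/-! ### Arithmetic on unary numbers -/

/-- `false` is written as the atom `0`, so both sides are the same chain of cells. List programs
thereby become programs for unary arithmetic. -/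
theorem nat_eq_replicate (n : ℕ) : enc n = enc (List.replicate n false) := by
  induction n with
  | zero => rfl
  | succ n ih =>
    change Val.cell _ _ = Val.cell _ _
    congr 1

/-- Programs see only values. Structures and tuples, or numbers and lists, are exchanged through
this lemma. -/
theorem of_enc_eq {f : α → β} {g : α → γ} (hf : PT f) (h : ∀ a, enc (f a) = enc (g a)) : PT g := by
  obtain ⟨M, b, hb, hbm, hM⟩ := hf
  refine ⟨M, b, hb, hbm, fun a => ?_⟩
  have := hM a
  rwa [esize, h] at this

theorem unary {f : α → ℕ} (hf : PT f) : PT fun a => List.replicate (f a) false :=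
  of_enc_eq hf fun _ => nat_eq_replicate _

theorem of_unary {f : α → ℕ} (hf : PT fun a => List.replicate (f a) false) : PT f :=
  of_enc_eq hf fun _ => (nat_eq_replicate _).symm

@[fun_prop]
theorem length {l : α → List β} (hl : PT l) : PT fun a => (l a).length := by
  refine of_unary ?_
  have := map (f := fun _ _ => false) hl (const false)
  simpa only [List.map_const'] using this

@[fun_prop]
theorem add {f g : α → ℕ} (hf : PT f) (hg : PT g) : PT fun a => f a + g a := by
  refine of_unary ?_
  have := append (unary hf) (unary hg)
  simpa only [List.replicate_append_replicate] using this

@[fun_prop]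
theorem mul {f g : α → ℕ} (hf : PT f) (hg : PT g) : PT fun a => f a * g a := by
  have h := length (flatMap (f := fun a _ => List.replicate (g a) false) (unary hf)
    (unary (hg.comp fst)))
  simpa [List.length_flatMap] using h

@[fun_prop]
theorem range {f : α → ℕ} (hf : PT f) : PT fun a => List.range (f a) := by
  -- Each round shifts the present list up by one and puts `0` in front.
  have key : ∀ n : ℕ, (List.replicate n false).foldl (fun s _ => 0 :: s.map (1 + ·)) ([] : List ℕ)
      = List.range n := by
    intro n
    induction n with
    | zero => rfl
    | succ n ih =>
      rw [List.replicate_succ', List.foldl_append, ih, List.range_succ_eq_map]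
      simp [add_comm]
  have h := foldl (s := fun _ => ([] : List ℕ)) (g := fun _ s (_ : Bool) => 0 :: s.map (1 + ·))
    (unary hf) (const []) (by fun_prop) ?_
  · simpa only [key] using h
  · obtain ⟨b, hb, hbm, hbl⟩ := hf.size_bound
    refine ⟨fun n => b n * (2 * b n + 1) + 1,
      (hb.mul (((PolyBdd.const 2).mul hb).add (.const 1))).add (.const 1), fun a m hm => ?_⟩
    obtain ⟨k, hk⟩ : ∃ k, m = List.replicate k false :=
      ⟨m.length, List.eq_replicate_of_mem fun x hx => List.eq_of_mem_replicate (hm.subset hx)⟩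
    have hkf : k ≤ f a := by simpa [hk] using hm.length_le
    have hfb : 2 * f a + 1 ≤ b (esize a) := by rw [← esize_nat]; exact hbl a
    rw [hk, key, ← List.flatMap_singleton' (List.range k)]
    refine (esize_flatMap_le (B := 2 * b (esize a) + 1) fun x hx => ?_).trans ?_
    · rw [esize_cons, esize_nil, esize_nat]
      have := List.mem_range.1 hx
      omega
    · rw [List.length_range]
      exact Nat.add_le_add_right (Nat.mul_le_mul_right _ (by omega)) 1

@[fun_prop]
theorem drop {f : α → ℕ} {l : α → List β} (hf : PT f) (hl : PT l) :
    PT fun a => (l a).drop (f a) := by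
  have key : ∀ (n : ℕ) (m : List β), (List.replicate n false).foldl (fun s _ => s.tail) m
      = m.drop n := by
    intro n
    induction n with
    | zero => simp
    | succ n ih => intro m; rw [List.replicate_succ, List.foldl_cons, ih]; simp [List.drop_tail]
  have h := foldl (s := l) (g := fun _ s (_ : Bool) => s.tail) (unary hf) hl (by fun_prop) ?_
  · simpa only [key] using h
  · obtain ⟨b, hb, hbm, hbl⟩ := hl.size_bound
    refine ⟨b, hb, fun a m hm => ?_⟩
    obtain ⟨k, hk⟩ : ∃ k, m = List.replicate k false :=
      ⟨m.length, List.eq_replicate_of_mem fun x hx => List.eq_of_mem_replicate (hm.subset hx)⟩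
    rw [hk, key]
    exact (esize_sublist (List.drop_sublist _ _)).trans (hbl a)

@[fun_prop]
theorem take {f : α → ℕ} {l : α → List β} (hf : PT f) (hl : PT l) :
    PT fun a => (l a).take (f a) := by
  -- The entries to be removed from the end are as many as `drop` leaves of the list; they are
  -- dropped from its reversal.
  have h := reverse (drop (add (length (drop hf hl)) (const 0)) (reverse hl))
  convert h using 2 with a
  rw [List.drop_reverse, List.reverse_reverse]
  simp only [List.length_drop, add_zero]
  rcases le_total (f a) (l a).length with h | h
  · congr 1; omega
  · rw [List.take_of_length_le h, List.take_of_length_le (by omega)]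

theorem le {f g : α → ℕ} (hf : PT f) (hg : PT g) : PT fun a => decide (f a ≤ g a) := by
  have h := not (any (p := fun _ _ => true) (drop hg (unary hf)) (const true))
  convert h using 2 with a
  rw [List.drop_replicate]
  rcases Nat.lt_or_ge (g a) (f a) with h | h
  · obtain ⟨k, hk⟩ : ∃ k, f a - g a = k + 1 := ⟨f a - g a - 1, by omega⟩
    simp [hk, List.replicate_succ, h]
  · simp [h, Nat.sub_eq_zero_of_le h]

theorem lt {f g : α → ℕ} (hf : PT f) (hg : PT g) : PT fun a => decide (f a < g a) :=
  le (add hf (const 1)) hg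

end PT

/-! ### The algorithm -/

namespace Reduction

/-- A graph with bags and a table of ranks. -/
structure Instance where
  verts : List Lab
  edges : List (Lab × Lab)
  bags : List (List Lab)
  ranks : List (Lab × Lab)

instance : Enc Instance := ⟨fun I => Enc.enc (I.verts, I.edges, I.bags, I.ranks)⟩

/-- A place where the graph might be cut: the cut bags are `a + 1, …, a + d`, and the surroundings
are the bags `x, …, y`, in which the vertices that are not everywhere appear at most `D` times.
The radius of the neighbourhoods is `g * D`. -/
structure Place where
  g : ℕ
  D : ℕ
  x : ℕ
  y : ℕ
  a : ℕ
  d : ℕ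

instance : Enc Place := ⟨fun c => Enc.enc (c.g, c.D, c.x, c.y, c.a, c.d)⟩

/-- Membership in a list of labels. -/
def mem (u : Lab) (l : List Lab) : Bool := l.any fun v => decide (u = v)

/-- The rank according to a table. -/
def rank (tab : List (Lab × Lab)) (u : Lab) : Lab :=
  ((tab.filter fun e => decide (e.1 = u)).map Prod.snd).headD (label 0)

/-- Adjacency according to a list of edges. -/
def adj (edges : List (Lab × Lab)) (u v : Lab) : Bool :=
  edges.any fun e => (decide (e.1 = u) && decide (e.2 = v)) || (decide (e.1 = v) && decide (e.2 = u))

/-- A bag in a list of bags. -/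
def bagAt (bags : List (List Lab)) (i : ℕ) : List Lab := (bags.drop i).headD []

/-- The bag before a given one. -/
def prevBag (bags : List (List Lab)) (i : ℕ) : List Lab := (([] :: bags).drop i).headD []

/-- What happens in a bag, in terms of ranks: presence, adjacency, and presence in the previous
bag. -/
def letter (I : Instance) (i : ℕ) : List (Lab × Lab × Lab) :=
  (bagAt I.bags i).flatMap fun u => (bagAt I.bags i).flatMap fun v =>
    (label 0, rank I.ranks u, rank I.ranks v) ::
      ((bif adj I.edges u v then [(label 1, rank I.ranks u, rank I.ranks v)] else []) ++
      (bif mem u (prevBag I.bags i) then [(label 2, rank I.ranks u, rank I.ranks v)] else []))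

/-- Membership of triples in lists. -/
def memTriple (s : Lab × Lab × Lab) (l : List (Lab × Lab × Lab)) : Bool :=
  l.any fun t => decide (s.1 = t.1) && (decide (s.2.1 = t.2.1) && decide (s.2.2 = t.2.2))

/-- Two bags look the same. -/
def sameLetter (I : Instance) (i j : ℕ) : Bool :=
  ((letter I i).all fun s => memTriple s (letter I j)) &&
    ((letter I j).all fun s => memTriple s (letter I i))

/-- `n` bags from `i` on look the same as from `j` on. -/
def sameWindow (I : Instance) (n i j : ℕ) : Bool :=
  (List.range n).all fun t => sameLetter I (i + t) (j + t)

/-- The numerical requirements on a place. -/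
def checkNumbers (I : Instance) (c : Place) : Bool :=
  decide (1 ≤ c.g) && (decide (1 ≤ c.D) && (decide (1 ≤ c.d) &&
  (decide (c.x + 5 * (c.g * c.D) ≤ c.a) &&
  (decide (c.a + c.d + 4 * (c.g * c.D) ≤ c.y) && decide (c.y < I.bags.length)))))

/-- Vertices that are not everywhere appear at most `D` times. -/
def checkShort (I : Instance) (c : Place) : Bool :=
  (List.range I.bags.length).all fun j =>
    !(decide (c.x ≤ j) && decide (j + c.D ≤ c.y)) ||
      (bagAt I.bags j).all fun v => !(mem v (bagAt I.bags (j + c.D))) ||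
        (mem v (bagAt I.bags c.x) && mem v (bagAt I.bags c.y))

/-- The two ends of the cut look the same. -/
def checkEnds (I : Instance) (c : Place) : Bool :=
  (List.range I.bags.length).all fun i =>
    !(decide (i ≤ c.a) && decide (c.a ≤ i + 2 * (c.g * c.D))) || sameLetter I i (i + c.d)

/-- Each window occurs often outside of the cut. -/
def checkFrequent (I : Instance) (c : Place) : Bool :=
  (List.range I.bags.length).all fun s =>
    !(decide (c.x + 2 * (c.g * c.D) ≤ s) && decide (s + 4 * (c.g * c.D) ≤ c.y)) ||
      decide (c.g * (4 * (c.g * c.D) + 1) + 1 ≤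
        ((List.range I.bags.length).filter fun s' =>
          (decide (c.x + 4 * (c.g * c.D) ≤ s') && decide (s' + 6 * (c.g * c.D) ≤ c.y)) &&
          ((decide (s' + 2 * (c.g * c.D) ≤ c.a) || decide (c.a + c.d < s')) &&
          sameWindow I (2 * (c.g * c.D) + 1) s s')).length)

/-- A place is suitable for a cut. -/
def check (I : Instance) (c : Place) : Bool :=
  checkNumbers I c && (checkShort I c && (checkEnds I c && checkFrequent I c))

/-- The places with a given value of `g`. -/
def places (n g : ℕ) : List Place :=
  (List.range n).flatMap fun D => (List.range n).flatMap fun x => (List.range n).flatMap fun y =>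
    (List.range n).flatMap fun a => (List.range n).map fun d => ⟨g, D, x, y, a, d⟩

/-- All places, by descending value of `g`. -/
def allPlaces (n : ℕ) : List Place := (List.range n).reverse.flatMap fun g => places n g

/-- The first suitable place. -/
def search (I : Instance) : Place :=
  ((allPlaces I.bags.length).filter fun c => check I c).headD ⟨0, 0, 0, 0, 0, 0⟩

/-- Vertices of the bag `b` are replaced by the vertices of the same rank in the bag `a`. -/
def glue (ranks : List (Lab × Lab)) (ba bb : List Lab) (u : Lab) : Lab :=
  bif mem u bb then (ba.filter fun w => decide (rank ranks w = rank ranks u)).headD u else u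

/-- The bags after the cut. -/
def cutBags (I : Instance) (a d : ℕ) : List (List Lab) :=
  I.bags.take (a + 1) ++ (I.bags.drop (a + d + 1)).map fun b =>
    b.map fun u => glue I.ranks (bagAt I.bags a) (bagAt I.bags (a + d)) u

/-- Both ends of an edge are in one of the bags. -/
def covered (bags : List (List Lab)) (e : Lab × Lab) : Bool :=
  bags.any fun b => mem e.1 b && mem e.2 b

/-- The edges after the cut. -/
def cutEdges (I : Instance) (a d : ℕ) : List (Lab × Lab) :=
  (I.edges.filter fun e => covered (I.bags.take (a + 1)) e) ++
    (I.edges.filter fun e => covered (I.bags.drop (a + d + 1)) e).map fun e =>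
      (glue I.ranks (bagAt I.bags a) (bagAt I.bags (a + d)) e.1,
        glue I.ranks (bagAt I.bags a) (bagAt I.bags (a + d)) e.2)

/-- A vertex is in some bag after the cut. -/
def kept (I : Instance) (a d : ℕ) (v : Lab) : Bool := (cutBags I a d).any fun b => mem v b

/-- The instance without the bags `a + 1, …, a + d`. -/
def cut (I : Instance) (a d : ℕ) : Instance where
  verts := I.verts.filter fun v => kept I a d v
  edges := cutEdges I a d
  bags := cutBags I a d
  ranks := I.ranks.filter fun e => kept I a d e.1

/-- The algorithm. -/
def reduce (I : Instance) : Instance := cut I (search I).a (search I).d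

/-! ### Polynomial running time of the algorithm -/

section PolynomialTime

variable {α : Type} [Enc α]

theorem pt_instance : PT fun I : Instance => (I.verts, I.edges, I.bags, I.ranks) :=
  PT.of_enc_eq PT.id fun _ => rfl

theorem pt_verts : PT Instance.verts := PT.comp (g := Prod.fst) PT.fst pt_instance
theorem pt_edges : PT Instance.edges := (PT.fst.comp PT.snd).comp pt_instance
theorem pt_bags : PT Instance.bags := (PT.fst.comp (PT.snd.comp PT.snd)).comp pt_instance
theorem pt_ranks : PT Instance.ranks := (PT.snd.comp (PT.snd.comp PT.snd)).comp pt_instance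

attribute [fun_prop] pt_verts pt_edges pt_bags pt_ranks

@[fun_prop]
theorem pt_instance_mk {v : α → List Lab} {e : α → List (Lab × Lab)} {b : α → List (List Lab)}
    {r : α → List (Lab × Lab)} (hv : PT v) (he : PT e) (hb : PT b) (hr : PT r) :
    PT fun a => Instance.mk (v a) (e a) (b a) (r a) :=
  PT.of_enc_eq (hv.pair (he.pair (hb.pair hr))) fun _ => rfl

theorem pt_place : PT fun c : Place => (c.g, c.D, c.x, c.y, c.a, c.d) :=
  PT.of_enc_eq PT.id fun _ => rfl

theorem pt_g : PT Place.g :=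
  PT.comp (g := fun p : ℕ × ℕ × ℕ × ℕ × ℕ × ℕ => p.1) (by fun_prop) pt_place
theorem pt_D : PT Place.D :=
  PT.comp (g := fun p : ℕ × ℕ × ℕ × ℕ × ℕ × ℕ => p.2.1) (by fun_prop) pt_place
theorem pt_x : PT Place.x :=
  PT.comp (g := fun p : ℕ × ℕ × ℕ × ℕ × ℕ × ℕ => p.2.2.1) (by fun_prop) pt_place
theorem pt_y : PT Place.y :=
  PT.comp (g := fun p : ℕ × ℕ × ℕ × ℕ × ℕ × ℕ => p.2.2.2.1) (by fun_prop) pt_place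
theorem pt_a : PT Place.a :=
  PT.comp (g := fun p : ℕ × ℕ × ℕ × ℕ × ℕ × ℕ => p.2.2.2.2.1) (by fun_prop) pt_place
theorem pt_d : PT Place.d :=
  PT.comp (g := fun p : ℕ × ℕ × ℕ × ℕ × ℕ × ℕ => p.2.2.2.2.2) (by fun_prop) pt_place

attribute [fun_prop] pt_g pt_D pt_x pt_y pt_a pt_d PT.le PT.lt PT.lab_eq PT.bcond

@[fun_prop]
theorem pt_place_mk {g D x y a d : α → ℕ} (hg : PT g) (hD : PT D) (hx : PT x) (hy : PT y)
    (ha : PT a) (hd : PT d) : PT fun i => Place.mk (g i) (D i) (x i) (y i) (a i) (d i) :=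
  PT.of_enc_eq (hg.pair (hD.pair (hx.pair (hy.pair (ha.pair hd))))) fun _ => rfl

@[fun_prop]
theorem pt_mem {u : α → Lab} {l : α → List Lab} (hu : PT u) (hl : PT l) :
    PT fun a => mem (u a) (l a) := by
  unfold mem; fun_prop

@[fun_prop]
theorem pt_rank {t : α → List (Lab × Lab)} {u : α → Lab} (ht : PT t) (hu : PT u) :
    PT fun a => rank (t a) (u a) := by
  unfold rank; fun_prop

@[fun_prop]
theorem pt_adj {e : α → List (Lab × Lab)} {u v : α → Lab} (he : PT e) (hu : PT u) (hv : PT v) :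
    PT fun a => adj (e a) (u a) (v a) := by
  unfold adj; fun_prop

@[fun_prop]
theorem pt_bagAt {b : α → List (List Lab)} {i : α → ℕ} (hb : PT b) (hi : PT i) :
    PT fun a => bagAt (b a) (i a) := by
  unfold bagAt; fun_prop

@[fun_prop]
theorem pt_prevBag {b : α → List (List Lab)} {i : α → ℕ} (hb : PT b) (hi : PT i) :
    PT fun a => prevBag (b a) (i a) := by
  unfold prevBag; fun_prop

@[fun_prop]
theorem pt_letter {I : α → Instance} {i : α → ℕ} (hI : PT I) (hi : PT i) :
    PT fun a => letter (I a) (i a) := by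
  unfold letter; fun_prop

@[fun_prop]
theorem pt_memTriple {s : α → Lab × Lab × Lab} {l : α → List (Lab × Lab × Lab)} (hs : PT s)
    (hl : PT l) : PT fun a => memTriple (s a) (l a) := by
  unfold memTriple; fun_prop

@[fun_prop]
theorem pt_sameLetter {I : α → Instance} {i j : α → ℕ} (hI : PT I) (hi : PT i) (hj : PT j) :
    PT fun a => sameLetter (I a) (i a) (j a) := by
  unfold sameLetter; fun_prop

@[fun_prop]
theorem pt_sameWindow {I : α → Instance} {n i j : α → ℕ} (hI : PT I) (hn : PT n) (hi : PT i)
    (hj : PT j) : PT fun a => sameWindow (I a) (n a) (i a) (j a) := by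
  unfold sameWindow; fun_prop

@[fun_prop]
theorem pt_check {I : α → Instance} {c : α → Place} (hI : PT I) (hc : PT c) :
    PT fun a => check (I a) (c a) := by
  unfold check
  refine PT.and ?_ (PT.and ?_ (PT.and ?_ ?_))
  · unfold checkNumbers; fun_prop
  · unfold checkShort; fun_prop
  · unfold checkEnds; fun_prop
  · unfold checkFrequent; fun_prop

@[fun_prop]
theorem pt_search {I : α → Instance} (hI : PT I) : PT fun a => search (I a) := by
  unfold search allPlaces places; fun_prop

@[fun_prop]
theorem pt_glue {r : α → List (Lab × Lab)} {ba bb : α → List Lab} {u : α → Lab} (hr : PT r)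
    (hba : PT ba) (hbb : PT bb) (hu : PT u) : PT fun a => glue (r a) (ba a) (bb a) (u a) := by
  unfold glue; fun_prop

@[fun_prop]
theorem pt_cutBags {I : α → Instance} {a d : α → ℕ} (hI : PT I) (ha : PT a) (hd : PT d) :
    PT fun i => cutBags (I i) (a i) (d i) := by
  unfold cutBags; fun_prop

@[fun_prop]
theorem pt_cut {I : α → Instance} {a d : α → ℕ} (hI : PT I) (ha : PT a) (hd : PT d) :
    PT fun i => cut (I i) (a i) (d i) := by
  unfold cut cutEdges kept covered; fun_prop

theorem pt_reduce : PT reduce := by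
  unfold reduce; fun_prop

end PolynomialTime

end Reduction

/-! ### Back and forth -/

/-- Ehrenfeucht–Fraïssé with an abstract invariant: `P k l` means that the pairs in `l` were played
and `k` rounds are left. Each quantifier costs one round, and both sides of a disjunction start from
the same position. -/
theorem sat_iff_of_backAndForth {V V' : Type*} {G : SimpleGraph V} {G' : SimpleGraph V'}
    {P : ℕ → List (V × V') → Prop}
    (atom : ∀ k l, P k l → ∀ e ∈ l, ∀ f ∈ l,
      (e.1 = f.1 ↔ e.2 = f.2) ∧ (G.Adj e.1 f.1 ↔ G'.Adj e.2 f.2))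
    (forth : ∀ k l, P (k + 1) l → ∀ v, ∃ v', P k ((v, v') :: l))
    (back : ∀ k l, P (k + 1) l → ∀ v', ∃ v, P k ((v, v') :: l))
    (φ : Formula) : ∀ (k : ℕ) (l : List (V × V')) (s : ℕ → Option V) (s' : ℕ → Option V'),
      P k l → φ.quantifiers ≤ k →
      (∀ x, (s x = none ∧ s' x = none) ∨ ∃ e ∈ l, s x = some e.1 ∧ s' x = some e.2) →
      (Formula.Sat G s φ ↔ Formula.Sat G' s' φ) := by
  induction φ with
  | ex x φ ih =>
    intro k l s s' hP hk hs
    obtain ⟨k, rfl⟩ : ∃ k', k = k' + 1 :=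
      ⟨k - 1, by simp only [Formula.quantifiers] at hk; omega⟩
    have key : ∀ v v', P k ((v, v') :: l) →
        (Formula.Sat G (Function.update s x (some v)) φ ↔
          Formula.Sat G' (Function.update s' x (some v')) φ) := by
      intro v v' h
      refine ih k _ _ _ h (by simp only [Formula.quantifiers] at hk; omega) fun y => ?_
      rcases eq_or_ne y x with rfl | hy
      · exact .inr ⟨(v, v'), by simp, by simp, by simp⟩
      · rw [Function.update_of_ne hy, Function.update_of_ne hy]
        exact (hs y).imp_right fun ⟨e, he, h⟩ => ⟨e, List.mem_cons_of_mem _ he, h⟩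
    simp only [Formula.Sat]
    constructor
    · rintro ⟨v, hv⟩
      obtain ⟨v', h⟩ := forth k l hP v
      exact ⟨v', (key v v' h).1 hv⟩
    · rintro ⟨v', hv⟩
      obtain ⟨v, h⟩ := back k l hP v'
      exact ⟨v, (key v v' h).2 hv⟩
  | neg φ ih =>
    intro k l s s' hP hk hs
    simp only [Formula.Sat]
    exact not_congr (ih k l s s' hP hk hs)
  | or φ ψ ihφ ihψ =>
    intro k l s s' hP hk hs
    simp only [Formula.quantifiers] at hk
    simp only [Formula.Sat]
    exact or_congr (ihφ k l s s' hP (by omega) hs) (ihψ k l s s' hP (by omega) hs)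
  | adj x y =>
    intro k l s s' hP hk hs
    simp only [Formula.Sat]
    rcases hs x with ⟨h, h'⟩ | ⟨e, he, h, h'⟩
    · simp [h, h']
    rcases hs y with ⟨g, g'⟩ | ⟨f, hf, g, g'⟩
    · simp [g, g']
    simp [h, h', g, g', (atom k l hP e he f hf).2]
  | eq x y =>
    intro k l s s' hP hk hs
    simp only [Formula.Sat]
    rcases hs x with ⟨h, h'⟩ | ⟨e, he, h, h'⟩
    · simp [h, h']
    rcases hs y with ⟨g, g'⟩ | ⟨f, hf, g, g'⟩
    · simp [g, g']
    have := (atom k l hP e he f hf).1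
    simp only [h, h', g, g', Option.some.injEq]
    constructor
    · rintro ⟨v, rfl, h2⟩; exact ⟨_, rfl, (this.1 h2.symm).symm⟩
    · rintro ⟨v, rfl, h2⟩; exact ⟨_, rfl, (this.2 h2.symm).symm⟩

/-! ### Graphs with bags -/

/-- A graph with a two-way infinite sequence of bags. -/
structure BagGraph where
  bag : ℤ → Set ℕ
  Adj : ℕ → ℕ → Prop

namespace BagGraph

/-- The bags form a ranked path decomposition. -/
structure Ranked (G : BagGraph) (ρ : ℕ → ℕ) : Prop where
  cover : ∀ u v, G.Adj u v → ∃ k, u ∈ G.bag k ∧ v ∈ G.bag k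
  symm : ∀ u v, G.Adj u v → G.Adj v u
  interval : ∀ v i j k, i ≤ j → j ≤ k → v ∈ G.bag i → v ∈ G.bag k → v ∈ G.bag j
  rank_inj : ∀ k, ∀ u ∈ G.bag k, ∀ v ∈ G.bag k, ρ u = ρ v → u = v

/-- What happens in a bag, in terms of ranks: presence, adjacency, and presence in the previous
bag. -/
def letter (G : BagGraph) (ρ : ℕ → ℕ) (m : ℤ) : Set (ℕ × ℕ × ℕ) :=
  {t | ∃ u ∈ G.bag m, ∃ v ∈ G.bag m, t.2 = (ρ u, ρ v) ∧
    (t.1 = 0 ∨ t.1 = 1 ∧ G.Adj u v ∨ t.1 = 2 ∧ u ∈ G.bag (m - 1))}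

variable {G G' : BagGraph} {ρ : ℕ → ℕ} {m m' : ℤ} {u v u' v' : ℕ}

/-- The tag `0` records presence. Letters mention ranks only; within a bag a rank determines its
vertex, which is how the following lemmas get back to vertices. -/
theorem exists_rank_eq_of_letter_eq (h : G.letter ρ m = G'.letter ρ m') (hu : u ∈ G.bag m) :
    ∃ u' ∈ G'.bag m', ρ u' = ρ u := by
  have h1 : ((0, ρ u, ρ u) : ℕ × ℕ × ℕ) ∈ G.letter ρ m := ⟨u, hu, u, hu, rfl, .inl rfl⟩
  rw [h] at h1
  obtain ⟨w, hw, _, _, h2, _⟩ := h1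
  exact ⟨w, hw, (congrArg Prod.fst h2).symm⟩

theorem adj_of_letter_eq (hG' : G'.Ranked ρ) (h : G.letter ρ m = G'.letter ρ m')
    (hu : u ∈ G.bag m) (hv : v ∈ G.bag m) (hu' : u' ∈ G'.bag m') (hv' : v' ∈ G'.bag m')
    (hru : ρ u' = ρ u) (hrv : ρ v' = ρ v) (hadj : G.Adj u v) : G'.Adj u' v' := by
  have h1 : ((1, ρ u, ρ v) : ℕ × ℕ × ℕ) ∈ G.letter ρ m :=
    ⟨u, hu, v, hv, rfl, .inr (.inl ⟨rfl, hadj⟩)⟩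
  rw [h] at h1
  obtain ⟨w, hw, z, hz, h2, h3⟩ := h1
  have e1 : w = u' := hG'.rank_inj m' w hw u' hu' ((congrArg Prod.fst h2).symm.trans hru.symm)
  have e2 : z = v' := hG'.rank_inj m' z hz v' hv' ((congrArg Prod.snd h2).symm.trans hrv.symm)
  subst e1 e2
  simpa using h3

theorem mem_pred_of_letter_eq (hG' : G'.Ranked ρ) (h : G.letter ρ m = G'.letter ρ m')
    (hu : u ∈ G.bag m) (hu' : u' ∈ G'.bag m') (hru : ρ u' = ρ u) (hp : u ∈ G.bag (m - 1)) :
    u' ∈ G'.bag (m' - 1) := by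
  have h1 : ((2, ρ u, ρ u) : ℕ × ℕ × ℕ) ∈ G.letter ρ m :=
    ⟨u, hu, u, hu, rfl, .inr (.inr ⟨rfl, hp⟩)⟩
  rw [h] at h1
  obtain ⟨w, hw, z, hz, h2, h3⟩ := h1
  have e1 : w = u' := hG'.rank_inj m' w hw u' hu' ((congrArg Prod.fst h2).symm.trans hru.symm)
  subst e1
  simpa using h3

/-- The vertex of this rank in the bag `m'` was already in the bag `m' - 1`, by the tag `2`, and is
therefore `u'`. This is the step to the right in following a vertex; `mem_pred_of_letter_eq` is the
step to the left. -/
theorem mem_of_letter_eq_of_pred (hG' : G'.Ranked ρ) (h : G.letter ρ m = G'.letter ρ m')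
    (hu : u ∈ G.bag m) (hp : u ∈ G.bag (m - 1)) (hu' : u' ∈ G'.bag (m' - 1))
    (hru : ρ u' = ρ u) : u' ∈ G'.bag m' := by
  obtain ⟨w, hw, hwr⟩ := exists_rank_eq_of_letter_eq h hu
  have := mem_pred_of_letter_eq hG' h hu hw hwr hp
  rwa [← hG'.rank_inj _ w this u' hu' (hwr.trans hru.symm)]

/-- If two stretches look the same, corresponding vertices are in corresponding bags. -/
theorem mem_of_letters_eq (hG : G.Ranked ρ) (hG' : G'.Ranked ρ) {i k e : ℤ}
    (h : ∀ j, min i k ≤ j → j ≤ max i k → G.letter ρ j = G'.letter ρ (j + e))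
    (hi : v ∈ G.bag i) (hk : v ∈ G.bag k) (hi' : v' ∈ G'.bag (i + e)) (hr : ρ v' = ρ v) :
    v' ∈ G'.bag (k + e) := by
  rcases le_total i k with hik | hik
  · rw [min_eq_left hik, max_eq_right hik] at h
    induction k, hik using Int.leInduction with
    | base => exact hi'
    | succ k hk1 ih =>
      have hk2 : v ∈ G.bag k := hG.interval v i k (k + 1) hk1 (by omega) hi hk
      have := ih (fun j h1 h2 => h j h1 (by omega)) hk2
      refine mem_of_letter_eq_of_pred hG' (h (k + 1) (by omega) le_rfl) hk ?_ ?_ hr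
      · simpa using hk2
      · convert this using 2; ring
  · rw [min_eq_right hik, max_eq_left hik] at h
    induction k, hik using Int.leInductionDown with
    | base => exact hi'
    | pred k hk1 ih =>
      have hk2 : v ∈ G.bag k := hG.interval v (k - 1) k i (by omega) hk1 hk hi
      have := ih (fun j h1 h2 => h j (by omega) h2) hk2
      have := mem_pred_of_letter_eq hG' (h k (by omega) hk1) hk2 this hr hk
      convert this using 2; ring

/-! ### The game on positions -/

/-- Pairs of positions have the same surroundings, and distances up to `2 * r` are preserved. -/
structure Inv {C : Type*} (c c' : ℤ → C) (Q : ℤ → ℤ → Prop) (r : ℕ) : Prop where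
  win : ∀ m m', Q m m' → ∀ t : ℤ, -r ≤ t → t ≤ r → c (m + t) = c' (m' + t)
  dist : ∀ m m' n n', Q m m' → Q n n' →
    |m - n| ≤ 2 * r ∨ |m' - n'| ≤ 2 * r → m - n = m' - n'

/-- The positions outside of the zone correspond naturally to each other, and the positions that
were played correspond to each other. -/
def Matched (x y y' : ℤ) (qs : List (ℤ × ℤ)) (m m' : ℤ) : Prop :=
  (m < x ∧ m' = m) ∨ (y < m ∧ m' - y' = m - y) ∨ (m, m') ∈ qs

theorem Inv.swap {C : Type*} {c c' : ℤ → C} {x y y' : ℤ} {qs : List (ℤ × ℤ)} {r : ℕ}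
    (h : Inv c c' (Matched x y y' qs) r) :
    Inv c' c (Matched x y' y (qs.map Prod.swap)) r := by
  have key : ∀ m m', Matched x y' y (qs.map Prod.swap) m m' → Matched x y y' qs m' m := by
    rintro m m' (⟨h1, rfl⟩ | ⟨h1, h2⟩ | h1)
    · exact .inl ⟨h1, rfl⟩
    · exact .inr (.inl ⟨by omega, by omega⟩)
    · refine .inr (.inr ?_)
      obtain ⟨e, he, h2⟩ := List.mem_map.1 h1
      obtain ⟨rfl, rfl⟩ : e.2 = m ∧ e.1 = m' := by simpa [Prod.ext_iff] using h2
      exact he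
  refine ⟨fun m m' hm t h1 h2 => (h.win m' m (key _ _ hm) t h1 h2).symm,
    fun m m' n n' hm hn hd => (h.dist m' m n' n (key _ _ hm) (key _ _ hn) hd.symm).symm⟩

/-- Two words that agree near and outside of the ends of their zones `[x, y]` and `[x, y']`, such
that each window in the first zone occurs often inside the second zone. -/
structure Similar {C : Type*} (c c' : ℤ → C) (x y y' : ℤ) (R K : ℕ) : Prop where
  left : ∀ m, m < x + R → c m = c' m
  right : ∀ m, y - R < m → c m = c' (m + (y' - y))
  long : x + 2 * R ≤ y
  long' : x + 2 * R ≤ y'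
  frequent : ∀ m, x ≤ m → m ≤ y → ∃ T : Finset ℤ, K < T.card ∧ ∀ n ∈ T,
    x + 2 * R ≤ n ∧ n + 2 * R ≤ y' ∧ ∀ t : ℤ, -R ≤ t → t ≤ R → c (m + t) = c' (n + t)

/-- Natural pairs on opposite sides are never within `2 * r` of each other, since both zones have
length at least `2 * R`. -/
theorem Similar.inv_nil {C : Type*} {c c' : ℤ → C} {x y y' : ℤ} {R K r : ℕ}
    (h : Similar c c' x y y' R K) (hr : r ≤ R) : Inv c c' (Matched x y y' []) r := by
  have := h.long
  have := h.long'
  constructor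
  · rintro m m' (⟨h1, rfl⟩ | ⟨h1, h2⟩ | h1) t ht1 ht2
    · exact h.left _ (by omega)
    · rw [h.right _ (by omega)]
      congr 1; omega
    · simp at h1
  · rintro m m' n n' (⟨h1, rfl⟩ | ⟨h1, h2⟩ | h1) (⟨h3, rfl⟩ | ⟨h3, h4⟩ | h3) h5
    all_goals simp only [abs_le, List.not_mem_nil] at *
    all_goals omega

/-- A move within `2 * r` of a matched position is answered with the same offset: the radius `3 * r`
there covers the window of the move, and its distance clause reaches far enough. A move far from all
matched positions is answered by an occurrence of its window in the other zone. Each played position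
blocks at most `4 * R + 1` of them, and more than `K` are available. -/
theorem Similar.exists_response {C : Type*} {c c' : ℤ → C} {x y y' : ℤ} {R K r : ℕ}
    {qs : List (ℤ × ℤ)} (h : Similar c c' x y y' R K) (hr : r ≤ R)
    (hK : qs.length * (4 * R + 1) ≤ K) (hinv : Inv c c' (Matched x y y' qs) (3 * r)) (m : ℤ) :
    ∃ m', Inv c c' (Matched x y y' ((m, m') :: qs)) r := by
  have main : (∃ m', (∀ t : ℤ, -r ≤ t → t ≤ r → c (m + t) = c' (m' + t)) ∧
      ∀ n n', Matched x y y' qs n n' →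
        |m - n| ≤ 2 * r ∨ |m' - n'| ≤ 2 * r → m - n = m' - n') := by
    by_cases hnear : ∃ n n', Matched x y y' qs n n' ∧ |m - n| ≤ 2 * r
    · obtain ⟨n, n', hn, hmn⟩ := hnear
      rw [abs_le] at hmn
      refine ⟨n' + (m - n), fun t ht1 ht2 => ?_, fun k k' hk hd => ?_⟩
      · have := hinv.win n n' hn (m - n + t) (by push_cast; omega) (by push_cast; omega)
        convert this using 2 <;> ring
      · have := hinv.dist n n' k k' hn hk (by
          push_cast
          simp only [abs_le] at hd ⊢
          omega)
        omega
    · push Not at hnear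
      -- Outside of the zone `m` would be matched itself, at distance `0`.
      have hx : x ≤ m := by
        by_contra hlt
        have := hnear m m (.inl ⟨by omega, rfl⟩)
        simp at this
        omega
      have hy : m ≤ y := by
        by_contra hlt
        have := hnear m (m - y + y') (.inr (.inl ⟨by omega, by ring⟩))
        simp at this
        omega
      obtain ⟨T, hT, hTw⟩ := h.frequent m hx hy
      let bad : Finset ℤ := (qs.toFinset).biUnion fun e => Finset.Icc (e.2 - 2 * r) (e.2 + 2 * r)
      have hbad : bad.card ≤ K := by
        refine (Finset.card_biUnion_le_card_mul _ _ (4 * R + 1) fun e _ => ?_).trans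
          ((Nat.mul_le_mul_right _ (List.toFinset_card_le qs)).trans hK)
        rw [Int.card_Icc]
        omega
      obtain ⟨m', hm'T, hm'⟩ := Finset.exists_mem_notMem_of_card_lt_card (hbad.trans_lt hT)
      obtain ⟨h1, h2, h3⟩ := hTw m' hm'T
      refine ⟨m', fun t ht1 ht2 => h3 t (by omega) (by omega), fun n n' hn hd => ?_⟩
      have hfar := hnear n n' hn
      rcases hd with hd | hd
      · omega
      · exfalso
        -- The occurrences in `T` keep a distance of `2 * R` from the ends of the zone, so only the
        -- played positions had to be avoided.
        rcases hn with ⟨h4, rfl⟩ | ⟨h4, h5⟩ | h4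
        · rw [abs_le] at hd; omega
        · rw [abs_le] at hd; omega
        · refine hm' (Finset.mem_biUnion.2 ⟨(n, n'), by simpa using h4, ?_⟩)
          rw [abs_le] at hd
          simp only [Finset.mem_Icc]; omega
  obtain ⟨m', h1, h2⟩ := main
  have key : ∀ n n', Matched x y y' ((m, m') :: qs) n n' →
      (n = m ∧ n' = m') ∨ Matched x y y' qs n n' := by
    rintro n n' (h3 | h3 | h3)
    · exact .inr (.inl h3)
    · exact .inr (.inr (.inl h3))
    · rcases List.mem_cons.1 h3 with h3 | h3
      · exact .inl (by simpa using h3)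
      · exact .inr (.inr (.inr h3))
  refine ⟨m', fun n n' hn t ht1 ht2 => ?_, fun n n' k k' hn hk hd => ?_⟩
  · rcases key n n' hn with ⟨rfl, rfl⟩ | hn1
    · exact h1 t ht1 ht2
    · exact hinv.win n n' hn1 t (by push_cast; omega) (by push_cast; omega)
  · rcases key n n' hn with ⟨rfl, rfl⟩ | hn1 <;> rcases key k k' hk with ⟨rfl, rfl⟩ | hk1
    · simp
    · exact h2 k k' hk1 hd
    · have := h2 n n' hn1 (by rwa [abs_sub_comm n, abs_sub_comm n'] at hd)
      omega
    · refine hinv.dist n n' k k' hn1 hk1 ?_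
      push_cast
      simp only [abs_le] at hd ⊢
      omega

/-! ### The game on vertices -/

/-- The zone `[x, y]`: the vertices of `S` are in all of its bags, and all other vertices of its
bags appear in few bags. -/
structure Zone (G : BagGraph) (ρ : ℕ → ℕ) (S : Set ℕ) (D : ℕ) (x y : ℤ) : Prop where
  ranked : G.Ranked ρ
  const : ∀ s ∈ S, ∀ m, x - 1 ≤ m → m ≤ y + 1 → s ∈ G.bag m
  short : ∀ v ∉ S, ∀ m k, x - D ≤ m → m ≤ y + D → v ∈ G.bag m → v ∈ G.bag k → |m - k| ≤ D

/-- The graphs agree outside of the zones. -/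
structure AgreeOutside (G G' : BagGraph) (x y y' : ℤ) : Prop where
  left : ∀ m, m < x → G.bag m = G'.bag m
  right : ∀ m, y < m → G.bag m = G'.bag (m + (y' - y))
  adj : ∀ u v m n, u ∈ G.bag m → v ∈ G.bag n → (m < x ∨ y < m) → (n < x ∨ y < n) →
    (G.Adj u v ↔ G'.Adj u v)

theorem AgreeOutside.symm {x y y' : ℤ} (h : AgreeOutside G G' x y y') :
    AgreeOutside G' G x y' y := by
  have left : ∀ m, m < x → G'.bag m = G.bag m := fun m hm => (h.left m hm).symm
  have right : ∀ m, y' < m → G'.bag m = G.bag (m + (y - y')) := fun m hm => by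
    rw [h.right _ (by omega)]; congr 1; ring
  refine ⟨left, right, fun u v m n hu hv hm hn => ?_⟩
  have key : ∀ w k, w ∈ G'.bag k → (k < x ∨ y' < k) → ∃ j, w ∈ G.bag j ∧ (j < x ∨ y < j) := by
    rintro w k hw (hk | hk)
    · exact ⟨k, left k hk ▸ hw, .inl hk⟩
    · exact ⟨k + (y - y'), right k hk ▸ hw, .inr (by omega)⟩
  obtain ⟨i, hi, hi'⟩ := key u m hu hm
  obtain ⟨j, hj, hj'⟩ := key v n hv hn
  exact (h.adj u v i j hi hj hi' hj').symm

/-- Corresponding vertices. -/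
def Partner (G G' : BagGraph) (ρ : ℕ → ℕ) (S : Set ℕ) (x y : ℤ) (Q : ℤ → ℤ → Prop)
    (v v' : ℕ) : Prop :=
  ρ v' = ρ v ∧ ∃ m m', Q m m' ∧ v ∈ G.bag m ∧ v' ∈ G'.bag m' ∧ (v ∈ S → m < x ∨ y < m)

variable {S : Set ℕ} {D : ℕ} {x y y' : ℤ} {qs : List (ℤ × ℤ)} {r : ℕ}

/-- The natural counterpart of `m` is matched with `m` as well; a different one would violate the
distance clause at distance `0`. -/
theorem Inv.outside {C : Type*} {c c' : ℤ → C} (h : Inv c c' (Matched x y y' qs) r)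
    (hm : Matched x y y' qs m m') (hout : m < x ∨ y < m) :
    (m < x ∧ m' = m) ∨ (y < m ∧ m' = m + (y' - y)) := by
  rcases hout with hlt | hlt
  · left
    have := h.dist m m' m m hm (.inl ⟨hlt, rfl⟩) (.inl (by simp))
    omega
  · right
    have := h.dist m m' m (m + (y' - y)) hm (.inr (.inl ⟨hlt, by ring⟩)) (.inl (by simp))
    omega

theorem Inv.inside {C : Type*} {c c' : ℤ → C} (h : Inv c c' (Matched x y y' qs) r)
    (hm : Matched x y y' qs m m') (hx : x ≤ m) (hy : m ≤ y) : x ≤ m' ∧ m' ≤ y' := by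
  constructor
  · by_contra hlt
    have := h.dist m m' m' m' hm (.inl ⟨by omega, rfl⟩) (.inr (by simp))
    omega
  · by_contra hlt
    have := h.dist m m' (m' + (y - y')) m' hm (.inr (.inl ⟨by omega, by ring⟩)) (.inr (by simp))
    omega

/-- Because the graphs agree there, `v` itself lies in the bag `m'` of `G'`, where ranks are
injective. In particular constant vertices answer themselves. -/
theorem eq_of_outside (hZ' : Zone G' ρ S D x y') (hout : AgreeOutside G G' x y y')
    (hinv : Inv (G.letter ρ) (G'.letter ρ) (Matched x y y' qs) r)
    (hm : Matched x y y' qs m m') (hv : v ∈ G.bag m) (hv' : v' ∈ G'.bag m') (hr : ρ v' = ρ v)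
    (hmo : m < x ∨ y < m) : v' = v := by
  refine hZ'.ranked.rank_inj m' v' hv' v ?_ hr
  rcases hinv.outside hm hmo with ⟨h1, rfl⟩ | ⟨h1, rfl⟩
  · rwa [← hout.left _ h1]
  · rwa [← hout.right _ h1]

/-- Only the clause about `S` needs an argument. If `v' ∈ S` and `m'` is in the zone, so is `m`;
then `v'` is in the bag `m` with the rank of `v`, hence equals `v`, and the clause for `v ∈ S`
places `m` outside. -/
theorem Partner.symm (hZ : Zone G ρ S D x y)
    (hinv : Inv (G.letter ρ) (G'.letter ρ) (Matched x y y' qs) r)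
    (h : Partner G G' ρ S x y (Matched x y y' qs) v v') :
    Partner G' G ρ S x y' (Matched x y' y (qs.map Prod.swap)) v' v := by
  obtain ⟨hr, m, m', hm, hv, hv', hS⟩ := h
  refine ⟨hr.symm, m', m, ?_, hv', hv, fun hvS => ?_⟩
  · rcases hm with ⟨h1, rfl⟩ | ⟨h1, h2⟩ | h1
    · exact .inl ⟨h1, rfl⟩
    · exact .inr (.inl ⟨by omega, by omega⟩)
    · exact .inr (.inr (List.mem_map.2 ⟨_, h1, rfl⟩))
  · by_contra hcon
    have hin := hinv.swap.inside (m := m') (m' := m) ?_ (by omega) (by omega)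
    · have h1 := hZ.const v' hvS m (by omega) (by omega)
      have h2 := hZ.ranked.rank_inj m v' h1 v hv hr
      have := hS (h2 ▸ hvS)
      omega
    · rcases hm with ⟨h1, rfl⟩ | ⟨h1, h2⟩ | h1
      · exact .inl ⟨h1, rfl⟩
      · exact .inr (.inl ⟨by omega, by omega⟩)
      · exact .inr (.inr (List.mem_map.2 ⟨_, h1, rfl⟩))

/-- If both positions are outside of the zone, both partners are `u`. Otherwise `u ∉ S`, so the
positions are at most `D` apart; the letters agree in between, and the partner at one position can
be followed to the other. -/
theorem partner_injective (hZ : Zone G ρ S D x y) (hZ' : Zone G' ρ S D x y')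
    (hout : AgreeOutside G G' x y y') (hD : 2 * D ≤ r)
    (hinv : Inv (G.letter ρ) (G'.letter ρ) (Matched x y y' qs) r)
    (h : Partner G G' ρ S x y (Matched x y y' qs) u u')
    (h' : Partner G G' ρ S x y (Matched x y y' qs) u v') : u' = v' := by
  obtain ⟨hr, m, m', hm, hu, hu', hS⟩ := h
  obtain ⟨hs, n, n', hn, hv, hv', hT⟩ := h'
  by_cases hmo : (m < x ∨ y < m) ∧ (n < x ∨ y < n)
  · rw [eq_of_outside hZ' hout hinv hm hu hu' hr hmo.1,
      eq_of_outside hZ' hout hinv hn hv hv' hs hmo.2]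
  have huS : u ∉ S := fun huS => hmo ⟨hS huS, hT huS⟩
  have hmn : |m - n| ≤ D := by
    by_cases h1 : m < x ∨ y < m
    · rw [abs_sub_comm]
      exact hZ.short u huS n m (by omega) (by omega) hv hu
    · exact hZ.short u huS m n (by omega) (by omega) hu hv
  have hdist := hinv.dist m m' n n' hm hn (.inl (by omega))
  rw [abs_le] at hmn
  have := mem_of_letters_eq hZ.ranked hZ'.ranked (i := m) (k := n) (e := m' - m) (v := u) (v' := u')
    (fun j h1 h2 => ?_) hu hv (by convert hu' using 2; ring) hr
  · exact hZ'.ranked.rank_inj n' u' (by convert this using 2; omega) v' hv' (hr.trans hs.symm)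
  · have := hinv.win m m' hm (j - m) (by omega) (by omega)
    convert this using 2 <;> ring

/-- If `u ∈ S`, then `u' = u` and the letters at `n` and `n'` record the edge. Otherwise the edge
lies in a bag at distance at most `D` from both positions. These are then at most `2 * D` apart, so
they have the same offset in both graphs, and both vertices can be followed to the bag of the edge.
-/
theorem partner_adj_of_inside (hZ : Zone G ρ S D x y) (hZ' : Zone G' ρ S D x y')
    (hout : AgreeOutside G G' x y y') (hD : 2 * D ≤ r)
    (hinv : Inv (G.letter ρ) (G'.letter ρ) (Matched x y y' qs) r)
    (h : Partner G G' ρ S x y (Matched x y y' qs) u u') {n n' : ℤ}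
    (hn : Matched x y y' qs n n') (hv : v ∈ G.bag n) (hv' : v' ∈ G'.bag n') (hs : ρ v' = ρ v)
    (hvS : v ∉ S) (hx : x ≤ n) (hy : n ≤ y) (hadj : G.Adj u v) : G'.Adj u' v' := by
  obtain ⟨hr, m, m', hm, hu, hu', hS⟩ := h
  have hin := hinv.inside hn hx hy
  by_cases huS : u ∈ S
  · have e := eq_of_outside hZ' hout hinv hm hu hu' hr (hS huS)
    subst e
    have := hinv.win n n' hn 0 (by omega) (by omega)
    rw [add_zero, add_zero] at this
    exact adj_of_letter_eq hZ'.ranked this (hZ.const u' huS n (by omega) (by omega)) hv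
      (hZ'.const u' huS n' (by omega) (by omega)) hv' rfl hs hadj
  · obtain ⟨k, huk, hvk⟩ := hZ.ranked.cover u v hadj
    have hnk := hZ.short v hvS n k (by omega) (by omega) hv hvk
    rw [abs_le] at hnk
    have hkm := hZ.short u huS k m (by omega) (by omega) huk hu
    rw [abs_le] at hkm
    have hdist := hinv.dist m m' n n' hm hn (.inl (by rw [abs_le]; omega))
    have hwin : ∀ j, |j - m| ≤ r ∨ |j - n| ≤ r →
        G.letter ρ j = G'.letter ρ (j + (m' - m)) := by
      simp only [abs_le]
      rintro j (hj | hj)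
      · have := hinv.win m m' hm (j - m) (by omega) (by omega)
        convert this using 2 <;> ring
      · have := hinv.win n n' hn (j - n) (by omega) (by omega)
        convert this using 2
        · ring
        · omega
    have hu'k := mem_of_letters_eq hZ.ranked hZ'.ranked (i := m) (k := k) (e := m' - m) (v := u)
      (v' := u') (fun j h1 h2 => hwin j (.inl (by rw [abs_le]; omega))) hu huk
      (by convert hu' using 2; ring) hr
    have hv'k := mem_of_letters_eq hZ.ranked hZ'.ranked (i := n) (k := k) (e := m' - m) (v := v)
      (v' := v') (fun j h1 h2 => hwin j (.inr (by rw [abs_le]; omega))) hv hvk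
      (by convert hv' using 2; omega) hs
    exact adj_of_letter_eq hZ'.ranked (hwin k (.inl (by rw [abs_le]; omega))) huk hvk hu'k hv'k
      hr hs hadj

theorem partner_adj (hZ : Zone G ρ S D x y) (hZ' : Zone G' ρ S D x y')
    (hout : AgreeOutside G G' x y y') (hD : 2 * D ≤ r)
    (hinv : Inv (G.letter ρ) (G'.letter ρ) (Matched x y y' qs) r)
    (h : Partner G G' ρ S x y (Matched x y y' qs) u u')
    (h' : Partner G G' ρ S x y (Matched x y y' qs) v v') (hadj : G.Adj u v) : G'.Adj u' v' := by
  obtain ⟨hr, m, m', hm, hu, hu', hS⟩ := id h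
  obtain ⟨hs, n, n', hn, hv, hv', hT⟩ := id h'
  by_cases hno : n < x ∨ y < n
  · by_cases hmo : m < x ∨ y < m
    · rw [eq_of_outside hZ' hout hinv hm hu hu' hr hmo,
        eq_of_outside hZ' hout hinv hn hv hv' hs hno]
      exact (hout.adj u v m n hu hv hmo hno).1 hadj
    · exact hZ'.ranked.symm _ _ (partner_adj_of_inside hZ hZ' hout hD hinv h' hm hu hu' hr
        (fun h => hmo (hS h)) (by omega) (by omega) (hZ.ranked.symm _ _ hadj))
  · exact partner_adj_of_inside hZ hZ' hout hD hinv h hn hv hv' hs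
      (fun h => hno (hT h)) (by omega) (by omega) hadj

/-- A constant vertex is played at `x - 1`, just before the zone, as `Partner` demands; for any
other vertex every bag will do. -/
theorem exists_partner {R K : ℕ} (hZ : Zone G ρ S D x y)
    (hsim : Similar (G.letter ρ) (G'.letter ρ) x y y' R K) (hr : r ≤ R)
    (hK : qs.length * (4 * R + 1) ≤ K)
    (hinv : Inv (G.letter ρ) (G'.letter ρ) (Matched x y y' qs) (3 * r)) (hv : v ∈ G.bag m) :
    ∃ e v', Inv (G.letter ρ) (G'.letter ρ) (Matched x y y' (e :: qs)) r ∧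
      Partner G G' ρ S x y (Matched x y y' (e :: qs)) v v' := by
  obtain ⟨k, hk, hkS⟩ : ∃ k, v ∈ G.bag k ∧ (v ∈ S → k < x ∨ y < k) := by
    by_cases hvS : v ∈ S
    · have := hsim.long
      exact ⟨x - 1, hZ.const v hvS _ le_rfl (by omega), fun _ => .inl (by omega)⟩
    · exact ⟨m, hv, fun h => absurd h hvS⟩
  obtain ⟨k', hinv'⟩ := hsim.exists_response hr hK hinv k
  have hkk : Matched x y y' ((k, k') :: qs) k k' := .inr (.inr (by simp))
  have h0 := hinv'.win k k' hkk 0 (by omega) (by omega)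
  rw [add_zero, add_zero] at h0
  obtain ⟨v', hv', hr'⟩ := exists_rank_eq_of_letter_eq h0 hk
  exact ⟨(k, k'), v', hinv', hr', k, k', hkk, hk, hv', hkS⟩

theorem Partner.cons {e : ℤ × ℤ} (h : Partner G G' ρ S x y (Matched x y y' qs) v v') :
    Partner G G' ρ S x y (Matched x y y' (e :: qs)) v v' := by
  obtain ⟨hr, m, m', hm, h⟩ := h
  exact ⟨hr, m, m', hm.imp_right (Or.imp_right (List.mem_cons_of_mem _)), h⟩

/-- Two graphs with bags that agree outside of a zone and have the same frequent windows in the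
zone satisfy the same sentences with few quantifiers. -/
theorem models_iff {V V' : Type*} {H : SimpleGraph V} {H' : SimpleGraph V'} {f : V → ℕ}
    {f' : V' → ℕ} (hf : f.Injective) (hf' : f'.Injective)
    (hmem : ∀ u, (∃ v, f v = u) ↔ ∃ m, u ∈ G.bag m)
    (hmem' : ∀ u, (∃ v, f' v = u) ↔ ∃ m, u ∈ G'.bag m)
    (hadj : ∀ u v, H.Adj u v ↔ G.Adj (f u) (f v))
    (hadj' : ∀ u v, H'.Adj u v ↔ G'.Adj (f' u) (f' v))
    {q R K : ℕ} (hR : 3 ^ q * (2 * D) ≤ R) (hK : q * (4 * R + 1) ≤ K)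
    (hZ : Zone G ρ S D x y) (hZ' : Zone G' ρ S D x y') (hout : AgreeOutside G G' x y y')
    (hsim : Similar (G.letter ρ) (G'.letter ρ) x y y' R K)
    (hsim' : Similar (G'.letter ρ) (G.letter ρ) x y' y R K)
    {φ : Formula} (hφ : φ.quantifiers ≤ q) : Models H φ ↔ Models H' φ := by
  -- With `k` rounds left the radius is `3 ^ k * (2 * D)`: every round costs a factor of three, and
  -- `2 * D` is what adjacency needs at the end.
  let P : ℕ → List (V × V') → Prop := fun k l => k ≤ q ∧ ∃ qs : List (ℤ × ℤ), qs.length + k = q ∧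
    Inv (G.letter ρ) (G'.letter ρ) (Matched x y y' qs) (3 ^ k * (2 * D)) ∧
    ∀ e ∈ l, Partner G G' ρ S x y (Matched x y y' qs) (f e.1) (f' e.2)
  have hpow : ∀ k ≤ q, 3 ^ k * (2 * D) ≤ R := fun k hk =>
    (Nat.mul_le_mul_right _ (Nat.pow_le_pow_right (by norm_num) hk)).trans hR
  have hlen : ∀ (qs : List (ℤ × ℤ)) k, qs.length + k = q → qs.length * (4 * R + 1) ≤ K :=
    fun qs k h => (Nat.mul_le_mul_right _ (by omega)).trans hK
  have hD : ∀ k, 2 * D ≤ 3 ^ k * (2 * D) := fun k =>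
    Nat.le_mul_of_pos_left _ (by positivity)
  have hswap : ∀ qs : List (ℤ × ℤ), (qs.map Prod.swap).map Prod.swap = qs := fun qs => by
    simp [Function.comp_def]
  refine sat_iff_of_backAndForth (P := P) ?_ ?_ ?_ φ q [] _ _
    ⟨le_rfl, [], by simp, hsim.inv_nil (hpow q le_rfl), by simp⟩ hφ fun x => .inl ⟨rfl, rfl⟩
  · rintro k l ⟨hk, qs, hqs, hinv, hl⟩ e he e' he'
    have h1 := hl e he
    have h2 := hl e' he'
    have h1' := h1.symm hZ hinv
    have h2' := h2.symm hZ hinv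
    refine ⟨⟨fun h => hf' ?_, fun h => hf ?_⟩, ?_⟩
    · rw [← h] at h2
      exact partner_injective hZ hZ' hout (hD k) hinv h1 h2
    · rw [← h] at h2'
      exact partner_injective hZ' hZ hout.symm (hD k) hinv.swap h1' h2'
    · rw [hadj, hadj']
      exact ⟨partner_adj hZ hZ' hout (hD k) hinv h1 h2,
        partner_adj hZ' hZ hout.symm (hD k) hinv.swap h1' h2'⟩
  · rintro k l ⟨hk, qs, hqs, hinv, hl⟩ v
    obtain ⟨m, hm⟩ := (hmem (f v)).1 ⟨v, rfl⟩
    obtain ⟨e, w, hinv', hw⟩ := exists_partner hZ hsim (hpow k (by omega)) (hlen qs _ hqs)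
      (by rwa [← mul_assoc, ← pow_succ']) hm
    obtain ⟨-, -, n, -, -, hn, -⟩ := id hw
    obtain ⟨v', rfl⟩ := (hmem' w).2 ⟨n, hn⟩
    refine ⟨v', by omega, e :: qs, by simp; omega, hinv', ?_⟩
    rintro d hd
    rcases List.mem_cons.1 hd with rfl | hd
    · exact hw
    · exact (hl d hd).cons
  · rintro k l ⟨hk, qs, hqs, hinv, hl⟩ v'
    obtain ⟨m, hm⟩ := (hmem' (f' v')).1 ⟨v', rfl⟩
    -- The roles of the two graphs are exchanged to find the answer, and then exchanged back.
    obtain ⟨e, w, hinv', hw⟩ := exists_partner (qs := qs.map Prod.swap) hZ' hsim'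
      (hpow k (by omega)) (hlen _ (k + 1) (by simpa using hqs))
      (by rw [← mul_assoc, ← pow_succ']; exact hinv.swap) hm
    obtain ⟨-, -, n, -, -, hn, -⟩ := id hw
    obtain ⟨v, rfl⟩ := (hmem w).2 ⟨n, hn⟩
    have hw' := hw.symm hZ' hinv'
    have hinv'' := hinv'.swap
    rw [List.map_cons, hswap] at hw' hinv''
    refine ⟨v, by omega, e.swap :: qs, by simp; omega, hinv'', ?_⟩
    rintro d hd
    rcases List.mem_cons.1 hd with rfl | hd
    · exact hw'
    · exact (hl d hd).cons

end BagGraph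

namespace BagGraph

/-! ### Cutting out a stretch of bags -/

/-- The bags `a + 1, …, b` are removed, and the bag `b` is glued to the bag `a` with the map `f`. -/
def cut (G : BagGraph) (f : ℕ → ℕ) (a b : ℤ) : BagGraph where
  bag m := if m ≤ a then G.bag m else f '' G.bag (m + (b - a))
  Adj u v := (∃ m ≤ a, u ∈ G.bag m ∧ v ∈ G.bag m ∧ G.Adj u v) ∨
    ∃ m > b, ∃ u₀ ∈ G.bag m, ∃ v₀ ∈ G.bag m, G.Adj u₀ v₀ ∧ f u₀ = u ∧ f v₀ = v

/-- The map `f` identifies vertices of the bag `b` with vertices of the bag `a` of the same rank,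
and the two bags look the same. -/
structure Gluing (G : BagGraph) (ρ : ℕ → ℕ) (f : ℕ → ℕ) (a b : ℤ) : Prop where
  ranked : G.Ranked ρ
  lt : a < b
  mem : ∀ u ∈ G.bag b, f u ∈ G.bag a
  rank : ∀ u ∈ G.bag b, ρ (f u) = ρ u
  eq : ∀ u ∉ G.bag b, f u = u
  letter_eq : G.letter ρ a = G.letter ρ b

variable {G : BagGraph} {ρ f : ℕ → ℕ} {a b m k : ℤ} {u v w : ℕ}

namespace Gluing

theorem rank_eq (h : Gluing G ρ f a b) (u : ℕ) : ρ (f u) = ρ u := by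
  by_cases hu : u ∈ G.bag b
  · exact h.rank u hu
  · rw [h.eq u hu]

theorem eq_of_mem (h : Gluing G ρ f a b) (hu : u ∈ G.bag b) (hw : w ∈ G.bag a)
    (hr : ρ w = ρ u) : f u = w :=
  h.ranked.rank_inj a _ (h.mem u hu) _ hw ((h.rank u hu).trans hr.symm)

/-- A vertex not in the bag `b` is not moved, and would then occupy bags on both sides of `b`. -/
theorem mem_right (h : Gluing G ρ f a b) (hm : b ≤ m) (hu : u ∈ G.bag m) (hk : k ≤ a)
    (hf : f u ∈ G.bag k) : u ∈ G.bag b := by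
  by_contra hb
  rw [h.eq u hb] at hf
  have := h.lt
  exact hb (h.ranked.interval u k b m (by omega) hm hf hu)

/-- By `mem_right` both vertices are in the bag `b`, where ranks separate them, or neither is, and
`f` moves none of them. -/
theorem injOn (h : Gluing G ρ f a b) (hm : b ≤ m) (hk : b ≤ k) (hu : u ∈ G.bag m)
    (hw : w ∈ G.bag k) (he : f u = f w) : u = w := by
  by_cases hub : u ∈ G.bag b
  · have hwb := h.mem_right hk hw le_rfl (he ▸ h.mem u hub)
    exact h.ranked.rank_inj b u hub w hwb (by rw [← h.rank_eq u, he, h.rank_eq])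
  · by_cases hwb : w ∈ G.bag b
    · exact absurd (h.mem_right hm hu le_rfl (he ▸ h.mem w hwb)) hub
    · rwa [h.eq u hub, h.eq w hwb] at he

theorem cut_bag_of_le (hm : m ≤ a) : (G.cut f a b).bag m = G.bag m := if_pos hm

theorem cut_bag_of_lt (hm : a < m) : (G.cut f a b).bag m = f '' G.bag (m + (b - a)) :=
  if_neg (by omega)

theorem adj_glue_iff (h : Gluing G ρ f a b) (hu : u ∈ G.bag b) (hv : v ∈ G.bag b) :
    G.Adj (f u) (f v) ↔ G.Adj u v :=
  ⟨adj_of_letter_eq h.ranked h.letter_eq (h.mem u hu) (h.mem v hv) hu hv (h.rank u hu).symm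
    (h.rank v hv).symm,
   adj_of_letter_eq h.ranked h.letter_eq.symm hu hv (h.mem u hu) (h.mem v hv) (h.rank u hu)
    (h.rank v hv)⟩

/-- No edge is created between vertices on the left: an edge that comes from the right with both
ends in the bag `m` joins two vertices of the bag `b`, and equality of letters turns it into an edge
that was already there. -/
theorem cut_adj_left (h : Gluing G ρ f a b) (hm : m ≤ a) (hu : u ∈ G.bag m) (hv : v ∈ G.bag m) :
    (G.cut f a b).Adj u v ↔ G.Adj u v := by
  constructor
  · rintro (⟨k, hk, _, _, hadj⟩ | ⟨k, hk, u₀, hu₀, v₀, hv₀, hadj, rfl, rfl⟩)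
    · exact hadj
    · exact (h.adj_glue_iff (h.mem_right hk.le hu₀ hm hu) (h.mem_right hk.le hv₀ hm hv)).2 hadj
  · exact fun hadj => .inl ⟨m, hm, hu, hv, hadj⟩

theorem cut_adj_right (h : Gluing G ρ f a b) (hm : b < m) (hu : u ∈ G.bag m) (hv : v ∈ G.bag m) :
    (G.cut f a b).Adj (f u) (f v) ↔ G.Adj u v := by
  constructor
  · rintro (⟨k, hk, hu', hv', hadj⟩ | ⟨k, hk, u₀, hu₀, v₀, hv₀, hadj, e, e'⟩)
    · exact (h.adj_glue_iff (h.mem_right hm.le hu hk hu') (h.mem_right hm.le hv hk hv')).1 hadj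
    · rwa [← h.injOn hk.le hm.le hu₀ hu e, ← h.injOn hk.le hm.le hv₀ hv e']
  · exact fun hadj => .inr ⟨m, hm, u, hu, v, hv, hadj, rfl, rfl⟩

/-- A vertex on both sides of the cut is the image of a vertex of the bag `b`. So its occurrences on
the left reach `a`, those on the right begin directly after it, and they form an interval. -/
theorem cut_ranked (h : Gluing G ρ f a b) : (G.cut f a b).Ranked ρ := by
  have hab := h.lt
  refine ⟨?_, ?_, ?_, ?_⟩
  · rintro u v (⟨m, hm, hu, hv, _⟩ | ⟨m, hm, u, hu, v, hv, _, rfl, rfl⟩)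
    · exact ⟨m, by rwa [cut_bag_of_le hm], by rwa [cut_bag_of_le hm]⟩
    · refine ⟨m - (b - a), ?_⟩
      rw [cut_bag_of_lt (by omega), sub_add_cancel]
      exact ⟨⟨u, hu, rfl⟩, ⟨v, hv, rfl⟩⟩
  · rintro u v (⟨m, hm, hu, hv, hadj⟩ | ⟨m, hm, u, hu, v, hv, hadj, rfl, rfl⟩)
    · exact .inl ⟨m, hm, hv, hu, h.ranked.symm _ _ hadj⟩
    · exact .inr ⟨m, hm, v, hv, u, hu, h.ranked.symm _ _ hadj, rfl, rfl⟩
  · intro v i j k hij hjk hi hk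
    by_cases hka : k ≤ a
    · rw [cut_bag_of_le (by omega)] at hi hk ⊢
      exact h.ranked.interval v i j k hij hjk hi hk
    rw [cut_bag_of_lt (by omega)] at hk
    obtain ⟨w, hw, rfl⟩ := hk
    by_cases hia : i ≤ a
    · rw [cut_bag_of_le hia] at hi
      have hwb := h.mem_right (by omega) hw hia hi
      by_cases hja : j ≤ a
      · rw [cut_bag_of_le hja]
        exact h.ranked.interval _ i j a hij hja hi (h.mem w hwb)
      · rw [cut_bag_of_lt (by omega)]
        exact ⟨w, h.ranked.interval w b _ _ (by omega) (by omega) hwb hw, rfl⟩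
    · rw [cut_bag_of_lt (by omega)] at hi ⊢
      obtain ⟨z, hz, e⟩ := hi
      obtain rfl := h.injOn (by omega) (by omega) hz hw e
      exact ⟨z, h.ranked.interval z _ _ _ (by omega) (by omega) hz hw, rfl⟩
  · intro k u hu v hv hr
    by_cases hka : k ≤ a
    · rw [cut_bag_of_le hka] at hu hv
      exact h.ranked.rank_inj k u hu v hv hr
    · rw [cut_bag_of_lt (by omega)] at hu hv
      obtain ⟨u, hu, rfl⟩ := hu
      obtain ⟨v, hv, rfl⟩ := hv
      rw [h.rank_eq, h.rank_eq] at hr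
      rw [h.ranked.rank_inj _ u hu v hv hr]

theorem cut_letter_left (h : Gluing G ρ f a b) (hm : m ≤ a) :
    (G.cut f a b).letter ρ m = G.letter ρ m := by
  ext t
  simp only [letter, cut_bag_of_le hm, cut_bag_of_le (show m - 1 ≤ a by omega), Set.mem_ofPred_eq]
  constructor <;> rintro ⟨u, hu, v, hv, h1, h2⟩ <;> refine ⟨u, hu, v, hv, h1, ?_⟩
  · rwa [← h.cut_adj_left hm hu hv]
  · rwa [h.cut_adj_left hm hu hv]

/-- The delicate case is `m = a + 1`, where `a` replaces `b` as the previous bag; it is the reason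
why letters survive the cut. -/
theorem cut_mem_pred_iff (h : Gluing G ρ f a b) (hm : a < m) (hu : u ∈ G.bag (m + (b - a))) :
    f u ∈ (G.cut f a b).bag (m - 1) ↔ u ∈ G.bag (m + (b - a) - 1) := by
  by_cases hm1 : m - 1 ≤ a
  · obtain rfl : m = a + 1 := by omega
    rw [cut_bag_of_le hm1]
    have e1 : a + 1 + (b - a) - 1 = b := by ring
    have e2 : a + 1 - 1 = a := by ring
    rw [e1, e2]
    exact ⟨fun hf => h.mem_right (by omega) hu le_rfl hf, fun hb => h.mem u hb⟩
  · rw [cut_bag_of_lt (by omega)]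
    have e1 : m - 1 + (b - a) = m + (b - a) - 1 := by ring
    rw [e1]
    constructor
    · rintro ⟨w, hw, e⟩
      rwa [← h.injOn (by omega) (by omega) hw hu e]
    · exact fun hw => ⟨u, hw, rfl⟩

theorem cut_letter_right (h : Gluing G ρ f a b) (hm : a < m) :
    (G.cut f a b).letter ρ m = G.letter ρ (m + (b - a)) := by
  ext t
  simp only [letter, cut_bag_of_lt hm, Set.mem_ofPred_eq, Set.exists_mem_image]
  constructor <;> rintro ⟨u, hu, v, hv, h1, h2⟩ <;> refine ⟨u, hu, v, hv, ?_, ?_⟩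
  · rwa [h.rank_eq, h.rank_eq] at h1
  · rwa [h.cut_adj_right (by omega) hu hv, h.cut_mem_pred_iff hm hu] at h2
  · rwa [h.rank_eq, h.rank_eq]
  · rwa [h.cut_adj_right (by omega) hu hv, h.cut_mem_pred_iff hm hu]

theorem exists_new (h : Gluing G ρ f a b) (hl : m ≤ a → ∃ u ∈ G.bag m, u ∉ G.bag (m - 1))
    (hr : a < m → ∃ u ∈ G.bag (m + (b - a)), u ∉ G.bag (m + (b - a) - 1)) :
    ∃ u ∈ (G.cut f a b).bag m, u ∉ (G.cut f a b).bag (m - 1) := by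
  by_cases hm : m ≤ a
  · rw [cut_bag_of_le hm, cut_bag_of_le (by omega)]
    exact hl hm
  · obtain ⟨u, hu, hu'⟩ := hr (by omega)
    refine ⟨f u, ?_, ?_⟩
    · rw [cut_bag_of_lt (by omega)]; exact ⟨u, hu, rfl⟩
    · rwa [h.cut_mem_pred_iff (by omega) hu]

/-- A vertex that is new in one of the removed bags is removed. -/
theorem notMem_cut_bag (h : Gluing G ρ f a b) (hk : a < k) (hkb : k ≤ b) (hu : u ∈ G.bag k)
    (hu' : u ∉ G.bag (k - 1)) : u ∉ (G.cut f a b).bag m := by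
  have hleft : ∀ j ≤ a, u ∉ G.bag j := fun j hj hj' =>
    hu' (h.ranked.interval u j (k - 1) k (by omega) (by omega) hj' hu)
  by_cases hm : m ≤ a
  · rw [cut_bag_of_le hm]
    exact hleft m hm
  · rw [cut_bag_of_lt (by omega)]
    rintro ⟨w, hw, rfl⟩
    by_cases hwb : w ∈ G.bag b
    · exact hleft a le_rfl (h.mem w hwb)
    · rw [h.eq w hwb] at hu
      exact hwb (h.ranked.interval w k b _ hkb (by omega) hu hw)

end Gluing

/-- The vertices of rank `j` that share a bag with a given vertex. -/
def neighbors (G : BagGraph) (ρ : ℕ → ℕ) (j v : ℕ) : Set ℕ :=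
  {u | ρ u = j ∧ ∃ k, u ∈ G.bag k ∧ v ∈ G.bag k}

/-! ### The cut is not seen -/

/-- A gluing inside a zone, such that the bags before `a` and before `b` look the same. -/
structure ZoneGluing (G : BagGraph) (ρ f : ℕ → ℕ) (S : Set ℕ) (D : ℕ) (x y a b : ℤ) : Prop
    extends Gluing G ρ f a b where
  zone : Zone G ρ S D x y
  left : x + D ≤ a
  right : b + D ≤ y
  window : ∀ t : ℤ, 0 ≤ t → t ≤ D → G.letter ρ (a - t) = G.letter ρ (b - t)

variable {S : Set ℕ} {D : ℕ} {x y : ℤ}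

namespace ZoneGluing

/-- The cut is at least `D` away from the ends of the zone, so such a vertex spans too many bags to
be short-lived. -/
theorem mem_of_outside (h : ZoneGluing G ρ f S D x y a b) (hu : u ∈ G.bag m) (hm : m < x ∨ y < m)
    (hk : u ∈ G.bag k) (hak : a ≤ k) (hkb : k ≤ b) : u ∈ S := by
  by_contra huS
  have h1 := h.left
  have h2 := h.right
  have := h.zone.short u huS k m (by omega) (by omega) hk hu
  rw [abs_le] at this
  omega

theorem glue_const (h : ZoneGluing G ρ f S D x y a b) (hu : u ∈ S) : f u = u := by
  have h1 := h.left
  have h2 := h.right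
  have h3 := h.lt
  exact h.eq_of_mem (h.zone.const u hu b (by omega) (by omega))
    (h.zone.const u hu a (by omega) (by omega)) rfl

theorem const_of_glue (h : ZoneGluing G ρ f S D x y a b) (hu : f u ∈ S) : f u = u := by
  have h1 := h.left
  have h2 := h.right
  have h3 := h.lt
  by_cases hub : u ∈ G.bag b
  · exact h.ranked.rank_inj b _ (h.zone.const _ hu b (by omega) (by omega)) _ hub (h.rank u hub)
  · exact h.eq u hub

theorem glue_of_outside (h : ZoneGluing G ρ f S D x y a b) (hu : u ∈ G.bag m)
    (hm : m < x ∨ y < m) : f u = u := by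
  by_cases hub : u ∈ G.bag b
  · exact h.glue_const (h.mem_of_outside hu hm hub h.lt.le le_rfl)
  · exact h.eq u hub

theorem eq_of_glue_outside (h : ZoneGluing G ρ f S D x y a b) (hu : f u ∈ G.bag m)
    (hm : m < x ∨ y < m) : f u = u := by
  by_cases hub : u ∈ G.bag b
  · exact h.const_of_glue (h.mem_of_outside hu hm (h.mem u hub) le_rfl h.lt.le)
  · exact h.eq u hub

/-- Vertices that appear outside of the zone are fixed by `f`. An edge between two of them whose bag
was removed is not lost: both ends are constant, and the bag `a` contains them. -/
theorem agreeOutside (h : ZoneGluing G ρ f S D x y a b) :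
    AgreeOutside G (G.cut f a b) x y (y - (b - a)) := by
  have h1 := h.left
  have h2 := h.right
  have h3 := h.lt
  refine ⟨fun m hm => (Gluing.cut_bag_of_le (by omega)).symm, fun m hm => ?_, ?_⟩
  · rw [Gluing.cut_bag_of_lt (by omega)]
    have e : m + (y - (b - a) - y) + (b - a) = m := by ring
    rw [e]
    ext u
    constructor
    · exact fun hu => ⟨u, hu, h.glue_of_outside hu (.inr hm)⟩
    · rintro ⟨w, hw, rfl⟩
      rwa [h.glue_of_outside hw (.inr hm)]
  · intro u v m n hu hv hm hn
    constructor
    · intro hadj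
      obtain ⟨k, huk, hvk⟩ := h.ranked.cover u v hadj
      by_cases hka : k ≤ a
      · exact .inl ⟨k, hka, huk, hvk, hadj⟩
      by_cases hkb : b < k
      · exact .inr ⟨k, hkb, u, huk, v, hvk, hadj, h.glue_of_outside hu hm, h.glue_of_outside hv hn⟩
      · refine .inl ⟨a, le_rfl, ?_, ?_, hadj⟩
        · exact h.zone.const u (h.mem_of_outside hu hm huk (by omega) (by omega)) a
            (by omega) (by omega)
        · exact h.zone.const v (h.mem_of_outside hv hn hvk (by omega) (by omega)) a
            (by omega) (by omega)
    · rintro (⟨k, _, _, _, hadj⟩ | ⟨k, hk, u₀, hu₀, v₀, hv₀, hadj, rfl, rfl⟩)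
      · exact hadj
      · rwa [h.eq_of_glue_outside hu hm, h.eq_of_glue_outside hv hn]

/-- A vertex that was glued from both sides looks like the vertex on the right. -/
theorem mem_bag_shift (h : ZoneGluing G ρ f S D x y a b) (hub : u ∈ G.bag b) (hm : m ≤ a)
    (ham : a ≤ m + D) (hu : f u ∈ G.bag m) : u ∈ G.bag (m + (b - a)) := by
  refine mem_of_letters_eq h.ranked h.ranked (i := a) (k := m) (v := f u) (fun j h1 h2 => ?_)
    (h.mem u hub) hu (by convert hub using 2; ring) (h.rank u hub).symm
  have := h.window (a - j) (by omega) (by omega)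
  convert this using 2 <;> ring

/-- A vertex with too many bags across the cut would come from such a vertex in `G`: its stretch
before `a` is repeated before `b`, since the letters there agree. -/
theorem cut_zone (h : ZoneGluing G ρ f S D x y a b) :
    Zone (G.cut f a b) ρ S D x (y - (b - a)) := by
  have h1 := h.left
  have h2 := h.right
  have h3 := h.lt
  have hcut := h.cut_ranked
  refine ⟨hcut, fun s hs m hm hm' => ?_, ?_⟩
  · by_cases hma : m ≤ a
    · rw [Gluing.cut_bag_of_le hma]
      exact h.zone.const s hs m hm (by omega)
    · rw [Gluing.cut_bag_of_lt (by omega)]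
      exact ⟨s, h.zone.const s hs _ (by omega) (by omega), h.glue_const hs⟩
  -- By the interval property only two bags at distance exactly `D + 1` have to be considered.
  have key : ∀ v ∉ S, ∀ i j m : ℤ, j = i + D + 1 → (m = i ∨ m = j) → x - D ≤ m →
      m ≤ y - (b - a) + D → v ∈ (G.cut f a b).bag i → v ∈ (G.cut f a b).bag j → False := by
    intro v hv i j m hij hm hxm hmy hi hj
    have contra : ∀ w ∉ S, ∀ i' : ℤ, (i' = i ∧ m ≤ y + D ∨ i' = i + (b - a)) →
        w ∈ G.bag i' → w ∈ G.bag (i' + D + 1) → False := by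
      intro w hw i' hi' hwi hwj
      rcases hm with hm | hm
      · have := h.zone.short w hw i' (i' + D + 1) (by omega) (by omega) hwi hwj
        rw [abs_le] at this
        omega
      · have := h.zone.short w hw (i' + D + 1) i' (by omega) (by omega) hwj hwi
        rw [abs_le] at this
        omega
    by_cases hja : j ≤ a
    · rw [Gluing.cut_bag_of_le (by omega)] at hi hj
      exact contra v hv i (.inl ⟨rfl, by omega⟩) hi (hij ▸ hj)
    rw [Gluing.cut_bag_of_lt (by omega)] at hj
    obtain ⟨w, hw, rfl⟩ := hj
    have hwS : w ∉ S := fun hwS => hv (by rwa [h.glue_const hwS])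
    refine contra w hwS (i + (b - a)) (.inr rfl) ?_ (by convert hw using 2; omega)
    by_cases hia : i ≤ a
    · rw [Gluing.cut_bag_of_le hia] at hi
      exact h.mem_bag_shift (h.mem_right (by omega) hw hia hi) hia (by omega) hi
    · rw [Gluing.cut_bag_of_lt (by omega)] at hi
      obtain ⟨z, hz, e⟩ := hi
      rwa [← h.injOn (by omega) (by omega) hz hw e]
  intro v hv m k hxm hmy hvm hvk
  rw [abs_le]
  constructor
  · by_contra hlt
    exact key v hv m (m + D + 1) m rfl (.inl rfl) hxm hmy hvm
      (hcut.interval v m _ k (by omega) (by omega) hvm hvk)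
  · by_contra hlt
    exact key v hv (m - D - 1) m m (by ring) (.inr rfl) hxm hmy
      (hcut.interval v k _ m (by omega) (by omega) hvk hvm) hvm

theorem encard_le_of_rel {α : Type*} {s t : Set α} (r : α → α → Prop)
    (h : ∀ b ∈ t, ∃ a ∈ s, r a b) (hr : ∀ a b b', r a b → r a b' → b = b') :
    t.encard ≤ s.encard := by
  choose! g hg hgr using h
  refine Set.encard_le_encard_of_injOn (f := g) hg fun b hb b' hb' e => ?_
  exact hr (g b) b b' (hgr b hb) (e ▸ hgr b' hb')

/-- Gluing might combine the neighbours of two vertices. But if `v` is short-lived, whatever it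
meets shortly before `a` is mirrored before `b`, so the neighbours of `w`, the vertex of the bag `b`
that is glued to `v`, account for all of them. A constant vertex gains no neighbours, and a vertex
that is not in the bag `a` lives on one side only. -/
theorem cut_neighbors (h : ZoneGluing G ρ f S D x y a b) {j : ℕ}
    (hv : ∃ m, v ∈ (G.cut f a b).bag m) :
    ∃ w, ρ w = ρ v ∧ (∃ m, w ∈ G.bag m) ∧
      ((G.cut f a b).neighbors ρ j v).encard ≤ (G.neighbors ρ j w).encard := by
  have h1 := h.left
  have h2 := h.right
  have h3 := h.lt
  by_cases hva : v ∈ G.bag a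
  · obtain ⟨w, hwb, hwr⟩ := exists_rank_eq_of_letter_eq h.letter_eq hva
    have hfw := h.eq_of_mem hwb hva hwr.symm
    refine ⟨w, hwr, ⟨b, hwb⟩, ?_⟩
    by_cases hwS : w ∈ S
    · rw [h.glue_const hwS] at hfw
      subst hfw
      refine Set.encard_le_encard ?_
      rintro u ⟨hu, k, hk, hk'⟩
      refine ⟨hu, ?_⟩
      by_cases hka : k ≤ a
      · rw [Gluing.cut_bag_of_le hka] at hk hk'
        exact ⟨k, hk, hk'⟩
      · rw [Gluing.cut_bag_of_lt (by omega)] at hk hk'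
        obtain ⟨z, hz, rfl⟩ := hk
        obtain ⟨s, hs, e⟩ := hk'
        have hs' : s = w := h.injOn (by omega) le_rfl hs hwb (e.trans (h.glue_const hwS).symm)
        subst hs'
        by_cases hzb : z ∈ G.bag b
        · exact ⟨a, h.mem z hzb, hva⟩
        · rw [h.eq z hzb]
          exact ⟨_, hz, hs⟩
    · have hvS : v ∉ S := fun hvS => by
        rw [← hfw] at hvS
        exact hwS (h.const_of_glue hvS ▸ hvS)
      -- `z` accounts for `u` if it mirrors `u` before `b`, or if it comes from the right and is
      -- mapped to `u`. By `step` and `step'` no `z` accounts for two vertices.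
      refine encard_le_of_rel (fun z u => ρ u = ρ z ∧
        ((∃ m, m ≤ a ∧ a ≤ m + D ∧ u ∈ G.bag m ∧ z ∈ G.bag (m + (b - a))) ∨
          ∃ m > b, z ∈ G.bag m ∧ f z = u)) ?_ ?_
      · rintro u ⟨hu, k, hk, hk'⟩
        by_cases hka : k ≤ a
        · rw [Gluing.cut_bag_of_le hka] at hk hk'
          have hak := h.zone.short v hvS a k (by omega) (by omega) hva hk'
          rw [abs_le] at hak
          have hwin := h.window (a - k) (by omega) (by omega)
          have e1 : a - (a - k) = k := by ring
          have e2 : b - (a - k) = k + (b - a) := by ring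
          rw [e1, e2] at hwin
          obtain ⟨z, hz, hzr⟩ := exists_rank_eq_of_letter_eq hwin hk
          refine ⟨z, ⟨hzr.trans hu, _, hz, ?_⟩, hzr.symm, .inl ⟨k, hka, by omega, hk, hz⟩⟩
          exact h.mem_bag_shift hwb hka (by omega) (hfw ▸ hk')
        · rw [Gluing.cut_bag_of_lt (by omega)] at hk hk'
          obtain ⟨z, hz, rfl⟩ := hk
          obtain ⟨s, hs, e⟩ := hk'
          have hs' : s = w := h.injOn (by omega) le_rfl hs hwb (e.trans hfw.symm)
          subst hs'
          exact ⟨z, ⟨(h.rank_eq z).symm.trans hu, _, hz, hs⟩, h.rank_eq z,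
            .inr ⟨_, by omega, hz, rfl⟩⟩
      · have step : ∀ z u m, ρ u = ρ z → m ≤ a → a ≤ m + D → u ∈ G.bag m →
            z ∈ G.bag (m + (b - a)) → ∀ n, m ≤ n → n ≤ a → z ∈ G.bag (n + (b - a)) →
            u ∈ G.bag n := by
          intro z u m hr hma ham hu hz n hmn hna hzn
          have := mem_of_letters_eq h.ranked h.ranked (i := m + (b - a)) (k := n + (b - a))
            (e := a - b) (v := z) (v' := u) (fun j h4 h5 => ?_) hz hzn
            (by convert hu using 2; ring) hr
          · convert this using 2; ring
          · have := h.window (b - j) (by omega) (by omega)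
            convert this.symm using 2 <;> ring
        have step' : ∀ z u m k, ρ u = ρ z → m ≤ a → a ≤ m + D → u ∈ G.bag m →
            z ∈ G.bag (m + (b - a)) → k > b → z ∈ G.bag k → f z = u := by
          intro z u m k hr hma ham hu hz hk hzk
          have hzb := h.ranked.interval z _ b k (by omega) (by omega) hz hzk
          exact h.eq_of_mem hzb (step z u m hr hma ham hu hz a hma le_rfl
            (by convert hzb using 2; ring)) hr
        rintro z u u' ⟨hr, ⟨m, hma, ham, hu, hz⟩ | ⟨m, hm, hz, rfl⟩⟩
          ⟨hr', ⟨n, hna, han, hu', hz'⟩ | ⟨n, hn, hz', rfl⟩⟩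
        · rcases le_total m n with hmn | hmn
          · exact h.ranked.rank_inj n u (step z u m hr hma ham hu hz n hmn hna hz') u' hu'
              (hr.trans hr'.symm)
          · exact h.ranked.rank_inj m u hu u' (step z u' n hr' hna han hu' hz' m hmn hma hz)
              (hr.trans hr'.symm)
        · exact (step' z u m n hr hma ham hu hz hn hz').symm
        · exact step' z u' n m hr' hna han hu' hz' hm hz
        · rfl
  · obtain ⟨m, hm⟩ := hv
    by_cases hma : m ≤ a
    · rw [Gluing.cut_bag_of_le hma] at hm
      refine ⟨v, rfl, ⟨m, hm⟩, Set.encard_le_encard ?_⟩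
      rintro u ⟨hu, k, hk, hk'⟩
      by_cases hka : k ≤ a
      · rw [Gluing.cut_bag_of_le hka] at hk hk'
        exact ⟨hu, k, hk, hk'⟩
      · rw [Gluing.cut_bag_of_lt (by omega)] at hk'
        obtain ⟨s, hs, rfl⟩ := hk'
        exact absurd (h.mem s (h.mem_right (by omega) hs hma hm)) hva
    · rw [Gluing.cut_bag_of_lt (by omega)] at hm
      obtain ⟨w, hw, rfl⟩ := hm
      have hwb : w ∉ G.bag b := fun hwb => hva (h.mem w hwb)
      refine ⟨w, (h.rank_eq w).symm, ⟨_, hw⟩, encard_le_of_rel (fun z u => f z = u) ?_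
        fun z u u' e e' => e.symm.trans e'⟩
      rintro u ⟨hu, k, hk, hk'⟩
      by_cases hka : k ≤ a
      · rw [Gluing.cut_bag_of_le hka] at hk'
        exact absurd (h.mem_right (by omega) hw hka hk') hwb
      · rw [Gluing.cut_bag_of_lt (by omega)] at hk hk'
        obtain ⟨z, hz, rfl⟩ := hk
        obtain ⟨s, hs, e⟩ := hk'
        obtain rfl := h.injOn (by omega) (by omega) hs hw e
        exact ⟨z, ⟨(h.rank_eq z).symm.trans hu, _, hz, hs⟩, rfl⟩

end ZoneGluing

/-! ### Cutting words -/

/-- The word `c'` arises from `c` by removing the letters `a + 1, …, b`; the letters before `a` and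
before `b` are the same; and all windows of radius `R` in the zone occur often away from the
cut. -/
structure WordCut {C : Type*} (c c' : ℤ → C) (x y a b : ℤ) (R K : ℕ) : Prop where
  lt : a < b
  left : x + 2 * R ≤ a
  right : b + R ≤ y
  eq_left : ∀ m ≤ a, c' m = c m
  eq_right : ∀ m > a, c' m = c (m + (b - a))
  window : ∀ t : ℤ, 0 ≤ t → t ≤ 2 * R → c (a - t) = c (b - t)
  frequent : ∀ m, x ≤ m → m ≤ y → ∃ T : Finset ℤ, K < T.card ∧ ∀ n ∈ T,
    x + 2 * R ≤ n ∧ n + 2 * R ≤ y ∧ (n + R ≤ a ∨ b < n - R) ∧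
      ∀ t : ℤ, -R ≤ t → t ≤ R → c (m + t) = c (n + t)

namespace WordCut

variable {C : Type*} {c c' : ℤ → C} {R K : ℕ}

/-- Occurrences that avoid the cut survive it, those on the right shifted by `b - a`; the two kinds
stay on different sides and do not collide. -/
theorem similar (h : WordCut c c' x y a b R K) : Similar c c' x y (y - (b - a)) R K := by
  have h1 := h.left
  have h2 := h.right
  have h3 := h.lt
  refine ⟨fun m hm => (h.eq_left m (by omega)).symm, fun m hm => ?_, by omega, by omega, ?_⟩
  · rw [h.eq_right _ (by omega)]
    congr 1; ring
  · intro m hx hy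
    obtain ⟨T, hT, hTw⟩ := h.frequent m hx hy
    refine ⟨T.image fun n => if n + R ≤ a then n else n - (b - a), ?_, ?_⟩
    · rwa [Finset.card_image_of_injOn]
      intro n hn n' hn' e
      have := hTw n hn
      have := hTw n' hn'
      simp only at e
      split_ifs at e <;> omega
    · intro n' hn'
      obtain ⟨n, hn, rfl⟩ := Finset.mem_image.1 hn'
      obtain ⟨h4, h5, h6, h7⟩ := hTw n hn
      split_ifs with hna
      · refine ⟨h4, by omega, fun t ht1 ht2 => ?_⟩
        rw [h7 t ht1 ht2, h.eq_left _ (by omega)]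
      · refine ⟨by omega, by omega, fun t ht1 ht2 => ?_⟩
        rw [h7 t ht1 ht2, h.eq_right _ (by omega)]
        congr 1; ring

/-- The cut creates no new windows: one that reaches beyond `a` is the old window at `m + (b - a)`,
because its letters up to `a` also stand before `b`. -/
theorem similar' (h : WordCut c c' x y a b R K) : Similar c' c x (y - (b - a)) y R K := by
  have h1 := h.left
  have h2 := h.right
  have h3 := h.lt
  refine ⟨fun m hm => h.eq_left m (by omega), fun m hm => ?_, by omega, by omega, ?_⟩
  · rw [h.eq_right _ (by omega)]
    congr 1; ring
  · intro m hx hy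
    obtain ⟨n, hxn, hny, hn⟩ : ∃ n, x ≤ n ∧ n ≤ y ∧
        ∀ t : ℤ, -R ≤ t → t ≤ R → c' (m + t) = c (n + t) := by
      by_cases hma : m + R ≤ a
      · exact ⟨m, hx, by omega, fun t _ _ => h.eq_left _ (by omega)⟩
      · refine ⟨m + (b - a), by omega, by omega, fun t ht1 ht2 => ?_⟩
        by_cases hmt : m + t ≤ a
        · rw [h.eq_left _ hmt]
          have := h.window (a - (m + t)) (by omega) (by omega)
          convert this using 2 <;> ring
        · rw [h.eq_right _ (by omega)]
          congr 1; ring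
    obtain ⟨T, hT, hTw⟩ := h.frequent n hxn hny
    refine ⟨T, hT, fun k hk => ?_⟩
    obtain ⟨h4, h5, h6, h7⟩ := hTw k hk
    exact ⟨h4, h5, fun t ht1 ht2 => (hn t ht1 ht2).trans (h7 t ht1 ht2)⟩

end WordCut

end BagGraph

/-! ### Presented graphs as graphs with bags -/

namespace Presentation

/-- The graph with its bags, as a graph on the natural numbers with a two-way infinite sequence of
bags. -/
def bagGraph (I : Presentation) : BagGraph where
  bag m := {v | 0 ≤ m ∧ v ∈ I.bags.getD m.toNat []}
  Adj u v := u ≠ v ∧ ((u, v) ∈ I.edges ∨ (v, u) ∈ I.edges)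

variable {I : Presentation} {ρ : ℕ → ℕ} {p : ℕ}

theorem mem_bag_natCast {v i : ℕ} : v ∈ I.bagGraph.bag i ↔ v ∈ I.bags.getD i [] := by
  simp [bagGraph]

theorem mem_bag_iff {v : ℕ} {m : ℤ} :
    v ∈ I.bagGraph.bag m ↔ ∃ i : Fin I.bags.length, (i : ℤ) = m ∧ v ∈ I.bags[i] := by
  constructor
  · rintro ⟨h0, h⟩
    have hlt : m.toNat < I.bags.length := by
      by_contra hlt
      rw [List.getD_eq_default _ _ (by omega)] at h
      simp at h
    refine ⟨⟨m.toNat, hlt⟩, by simpa using h0, ?_⟩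
    rwa [List.getD_eq_getElem _ _ hlt] at h
  · rintro ⟨i, rfl, h⟩
    rw [mem_bag_natCast, List.getD_eq_getElem _ _ i.2]
    exact h

theorem mem_bag_fin {v : I.Vertex} {i : Fin I.bags.length} :
    v ∈ I.bag i ↔ v.1 ∈ I.bagGraph.bag (i : ℕ) := by
  rw [mem_bag_natCast, List.getD_eq_getElem _ _ i.2]
  rfl

theorem graph_adj {u v : I.Vertex} : I.graph.Adj u v ↔ I.bagGraph.Adj u.1 v.1 := by
  simp [graph, bagGraph, Subtype.ext_iff]

theorem mem_verts_of_mem_bag (hW : I.WellFormed) {v : ℕ} {m : ℤ} (h : v ∈ I.bagGraph.bag m) :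
    v ∈ I.verts := by
  obtain ⟨i, _, hi⟩ := mem_bag_iff.1 h
  exact hW.bags_mem _ (List.getElem_mem i.2) v hi

theorem Normalized.mem_verts_iff (hW : I.WellFormed) (hN : I.Normalized p ρ) {v : ℕ} :
    v ∈ I.verts ↔ ∃ m, v ∈ I.bagGraph.bag m := by
  refine ⟨fun hv => ?_, fun ⟨m, hm⟩ => mem_verts_of_mem_bag hW hm⟩
  obtain ⟨i, hi⟩ := hN.vertex_mem ⟨v, hv⟩
  exact ⟨_, mem_bag_fin.1 hi⟩

theorem adj_mem_verts (hW : I.WellFormed) {u v : ℕ} (h : I.bagGraph.Adj u v) :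
    u ∈ I.verts ∧ v ∈ I.verts := by
  obtain ⟨_, h | h⟩ := h
  · have := hW.edges_mem _ h; exact ⟨this.1, this.2.1⟩
  · have := hW.edges_mem _ h; exact ⟨this.2.1, this.1⟩

theorem Normalized.ranked (hW : I.WellFormed) (hN : I.Normalized p ρ) : I.bagGraph.Ranked ρ := by
  refine ⟨fun u v h => ?_, fun u v h => ⟨h.1.symm, h.2.symm⟩, fun v i j k hij hjk hi hk => ?_,
    fun k u hu v hv hr => ?_⟩
  · obtain ⟨hu, hv⟩ := adj_mem_verts hW h
    obtain ⟨i, h1, h2⟩ := hN.edge_mem ⟨u, hu⟩ ⟨v, hv⟩ (graph_adj.2 h)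
    exact ⟨_, mem_bag_fin.1 h1, mem_bag_fin.1 h2⟩
  · have hv := mem_verts_of_mem_bag hW hi
    rcases hij.eq_or_lt with rfl | hij
    · exact hi
    rcases hjk.eq_or_lt with rfl | hjk
    · exact hk
    obtain ⟨i', rfl, hi'⟩ := mem_bag_iff.1 hi
    obtain ⟨k', rfl, hk'⟩ := mem_bag_iff.1 hk
    obtain ⟨j', rfl⟩ : ∃ j' : ℕ, (j' : ℤ) = j := ⟨j.toNat, by omega⟩
    have hj' : j' < I.bags.length := by have := k'.2; omega
    have := hN.inter_subset i' ⟨j', hj'⟩ k' (by rw [Fin.lt_def]; simp; omega)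
      (by rw [Fin.lt_def]; simp; omega)
    exact mem_bag_fin.1 (this (a := ⟨v, hv⟩) ⟨hi', hk'⟩)
  · obtain ⟨i, rfl, hi⟩ := mem_bag_iff.1 hu
    obtain ⟨j, hj, hj'⟩ := mem_bag_iff.1 hv
    obtain rfl : j = i := by ext; omega
    have := hN.rank_inj j ⟨u, mem_verts_of_mem_bag hW hu⟩ hi ⟨v, mem_verts_of_mem_bag hW hv⟩ hj' hr
    exact congrArg Subtype.val this

theorem Normalized.neighbors_le (hW : I.WellFormed) (hN : I.Normalized p ρ) {v j : ℕ}
    (hv : ∃ m, v ∈ I.bagGraph.bag m) (hj : ρ v < j) (hp : j ≤ p) :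
    (I.bagGraph.neighbors ρ j v).encard ≤ 2 := by
  have hv' := (hN.mem_verts_iff hW).2 hv
  refine le_trans ?_ (hN.higher_rank ⟨v, hv'⟩ j hj hp)
  rw [← Function.Injective.encard_image Subtype.val_injective]
  refine Set.encard_le_encard ?_
  rintro u ⟨hu, k, hk, hk'⟩
  obtain ⟨i, rfl, hi⟩ := mem_bag_iff.1 hk
  exact ⟨⟨u, mem_verts_of_mem_bag hW hk⟩, ⟨hu, i, hi, mem_bag_fin.2 hk'⟩, rfl⟩

theorem Normalized.exists_new (hN : I.Normalized p ρ) {m : ℤ} (h1 : 1 ≤ m)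
    (h2 : m < I.bags.length) : ∃ u ∈ I.bagGraph.bag m, u ∉ I.bagGraph.bag (m - 1) := by
  obtain ⟨i, rfl⟩ : ∃ i : ℕ, m = (i + 1 : ℕ) := ⟨(m - 1).toNat, by omega⟩
  have hi : i + 1 < I.bags.length := by omega
  obtain ⟨u, hu, hu'⟩ := hN.new_vertex ⟨i, by omega⟩ ⟨i + 1, hi⟩ rfl
  refine ⟨u.1, mem_bag_fin.1 hu, fun h => hu' (mem_bag_fin.2 ?_)⟩
  simpa using h

theorem normalized_of (hR : I.bagGraph.Ranked ρ) (hv : ∀ v ∈ I.verts, ∃ m, v ∈ I.bagGraph.bag m)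
    (hρ : ∀ v ∈ I.verts, 1 ≤ ρ v ∧ ρ v ≤ p)
    (hn : ∀ v ∈ I.verts, ∀ j, ρ v < j → j ≤ p → (I.bagGraph.neighbors ρ j v).encard ≤ 2)
    (hnew : ∀ m : ℤ, 1 ≤ m → m < I.bags.length →
      ∃ u ∈ I.bagGraph.bag m, u ∉ I.bagGraph.bag (m - 1)) (hW : I.WellFormed) :
    I.Normalized p ρ := by
  refine ⟨⟨⟨fun v => ?_, fun u v h => ?_, fun i j k hij hjk v h => ?_⟩, fun v => hρ v.1 v.2,
    fun i u hu v hv h => ?_⟩, fun v j hj hp => ?_, fun i j hij => ?_⟩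
  · obtain ⟨m, hm⟩ := hv v.1 v.2
    obtain ⟨i, _, hi⟩ := mem_bag_iff.1 hm
    exact ⟨i, hi⟩
  · obtain ⟨m, hm, hm'⟩ := hR.cover _ _ (graph_adj.1 h)
    obtain ⟨i, rfl, hi⟩ := mem_bag_iff.1 hm
    exact ⟨i, hi, mem_bag_fin.2 hm'⟩
  · rw [Fin.lt_def] at hij hjk
    exact mem_bag_fin.2 (hR.interval v.1 i j k (by omega) (by omega) (mem_bag_fin.1 h.1)
      (mem_bag_fin.1 h.2))
  · exact Subtype.ext (hR.rank_inj i _ (mem_bag_fin.1 hu) _ (mem_bag_fin.1 hv) h)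
  · refine le_trans ?_ (hn v.1 v.2 j hj hp)
    rw [← Function.Injective.encard_image Subtype.val_injective]
    refine Set.encard_le_encard ?_
    rintro _ ⟨u, ⟨hu, k, hk, hk'⟩, rfl⟩
    exact ⟨hu, k, mem_bag_fin.1 hk, mem_bag_fin.1 hk'⟩
  · obtain ⟨u, hu, hu'⟩ := hnew (j : ℕ) (by omega) (by exact_mod_cast j.2)
    refine ⟨⟨u, mem_verts_of_mem_bag hW hu⟩, mem_bag_fin.2 hu, fun h => hu' ?_⟩
    convert mem_bag_fin.1 h using 2
    omega

end Presentation

/-! ### Correctness of the tests -/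

namespace Reduction

/-- A presented graph with bags and ranks as an instance. -/
def ofPresentation (I : Presentation) (ρ : ℕ → ℕ) : Instance :=
  ⟨I.verts, I.edges, I.bags, I.verts.map fun v => ((v, ρ v) : ℕ × ℕ)⟩

/-- An instance as a presented graph with bags. -/
def toPresentation (J : Instance) : Presentation := ⟨J.verts, J.edges, J.bags⟩

theorem enc_ofPresentation (I : Presentation) (ρ : ℕ → ℕ) :
    Enc.enc (ofPresentation I ρ) = encodeRanked I ρ := rfl

/-- A suitable place for a cut, described in terms of the graph. -/
structure Suitable (G : BagGraph) (ρ : ℕ → ℕ) (l : ℕ) (c : Place) : Prop where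
  one_le_g : 1 ≤ c.g
  one_le_D : 1 ≤ c.D
  one_le_d : 1 ≤ c.d
  left : c.x + 5 * (c.g * c.D) ≤ c.a
  right : c.a + c.d + 4 * (c.g * c.D) ≤ c.y
  lt : c.y < l
  short : ∀ j < l, c.x ≤ j → j + c.D ≤ c.y → ∀ v ∈ G.bag (j : ℕ), v ∈ G.bag (j + c.D : ℕ) →
    v ∈ G.bag c.x ∧ v ∈ G.bag c.y
  ends : ∀ i < l, i ≤ c.a → c.a ≤ i + 2 * (c.g * c.D) →
    G.letter ρ (i : ℕ) = G.letter ρ (i + c.d : ℕ)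
  frequent : ∀ s < l, c.x + 2 * (c.g * c.D) ≤ s → s + 4 * (c.g * c.D) ≤ c.y →
    ∃ T : Finset ℕ, c.g * (4 * (c.g * c.D) + 1) + 1 ≤ T.card ∧ ∀ n ∈ T,
      c.x + 4 * (c.g * c.D) ≤ n ∧ n + 6 * (c.g * c.D) ≤ c.y ∧
      (n + 2 * (c.g * c.D) ≤ c.a ∨ c.a + c.d < n) ∧
      ∀ t < 2 * (c.g * c.D) + 1, G.letter ρ (s + t : ℕ) = G.letter ρ (n + t : ℕ)

theorem mem_iff {u : Lab} {l : List Lab} : mem u l = true ↔ u ∈ l := by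
  simp [mem]

theorem memTriple_iff {s : Lab × Lab × Lab} {l : List (Lab × Lab × Lab)} :
    memTriple s l = true ↔ s ∈ l := by
  rw [memTriple, List.any_eq_true]
  constructor
  · rintro ⟨t, ht, h⟩
    simp only [Bool.and_eq_true, decide_eq_true_eq] at h
    rwa [show s = t from Prod.ext h.1 (Prod.ext h.2.1 h.2.2)]
  · exact fun h => ⟨s, h, by simp⟩

theorem adj_eq_true {edges : List (Lab × Lab)} {u v : Lab} : adj edges u v = true ↔
    ∃ e ∈ edges, (e.1 = u ∧ e.2 = v) ∨ (e.1 = v ∧ e.2 = u) := by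
  simp only [adj, List.any_eq_true, Bool.or_eq_true, Bool.and_eq_true, decide_eq_true_eq]

theorem mem_letter {J : Instance} {t : Lab × Lab × Lab} {i : ℕ} : t ∈ letter J i ↔
    ∃ u ∈ bagAt J.bags i, ∃ v ∈ bagAt J.bags i, t.2 = (rank J.ranks u, rank J.ranks v) ∧
      (t.1 = label 0 ∨ t.1 = label 1 ∧ adj J.edges u v = true ∨
        t.1 = label 2 ∧ mem u (prevBag J.bags i) = true) := by
  simp only [letter, List.mem_flatMap]
  refine exists_congr fun u => and_congr_right fun _ => exists_congr fun v =>
    and_congr_right fun _ => ?_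
  rw [List.mem_cons, List.mem_append, Prod.ext_iff]
  cases adj J.edges u v <;> cases mem u (prevBag J.bags i) <;>
    simp only [cond_true, cond_false, List.mem_singleton, List.not_mem_nil, Prod.ext_iff,
      and_true, and_false, or_false, false_or, Bool.false_eq_true] <;> tauto

theorem bagAt_eq (bags : List (List Lab)) (i : ℕ) : bagAt bags i = bags.getD i [] := by
  rw [bagAt, List.headD_eq_head?_getD, List.head?_drop, List.getD_eq_getElem?_getD]

section

variable {I : Presentation} {ρ : ℕ → ℕ} {p : ℕ}

theorem mem_bagAt {v i : ℕ} : v ∈ bagAt I.bags i ↔ v ∈ I.bagGraph.bag i := by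
  exact (Iff.of_eq (congrArg (fun l : List ℕ => v ∈ l) (bagAt_eq I.bags i))).trans
    Presentation.mem_bag_natCast.symm

theorem mem_prevBag {v i : ℕ} : v ∈ prevBag I.bags i ↔ v ∈ I.bagGraph.bag (i - 1 : ℤ) := by
  cases i with
  | zero => exact iff_of_false List.not_mem_nil (by simp [Presentation.bagGraph])
  | succ i =>
    have : ((i + 1 : ℕ) : ℤ) - 1 = (i : ℕ) := by omega
    rw [this, ← mem_bagAt]
    rfl

theorem rank_eq {v : ℕ} (hv : v ∈ I.verts) : rank (ofPresentation I ρ).ranks v = ρ v := by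
  have key : ∀ l : List ℕ, v ∈ l →
      (((l.map fun v => (v, ρ v)).filter fun e => decide (e.1 = v)).map Prod.snd).headD 0
        = ρ v := by
    intro l hl
    induction l with
    | nil => simp at hl
    | cons w l ih =>
      by_cases hw : w = v
      · simp [hw]
      · simpa [hw] using ih (by simpa [Ne.symm hw] using hl)
  exact key I.verts hv

theorem adj_iff (hW : I.WellFormed) {u v : ℕ} :
    adj I.edges u v = true ↔ I.bagGraph.Adj u v := by
  refine adj_eq_true.trans ⟨?_, ?_⟩
  · rintro ⟨⟨w, z⟩, he, ⟨rfl, rfl⟩ | ⟨rfl, rfl⟩⟩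
    · exact ⟨(hW.edges_mem _ he).2.2, .inl he⟩
    · exact ⟨(hW.edges_mem _ he).2.2.symm, .inr he⟩
  · rintro ⟨_, h | h⟩
    · exact ⟨_, h, .inl ⟨rfl, rfl⟩⟩
    · exact ⟨_, h, .inr ⟨rfl, rfl⟩⟩

theorem mem_letter_iff (hW : I.WellFormed) {t : ℕ × ℕ × ℕ} {i : ℕ} :
    t ∈ letter (ofPresentation I ρ) i ↔ t ∈ I.bagGraph.letter ρ i := by
  refine mem_letter.trans ⟨?_, ?_⟩
  · rintro ⟨u, hu, v, hv, h, h'⟩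
    have hu' : u ∈ I.bagGraph.bag i := mem_bagAt.1 hu
    have hv' : v ∈ I.bagGraph.bag i := mem_bagAt.1 hv
    rw [rank_eq (Presentation.mem_verts_of_mem_bag hW hu'),
      rank_eq (Presentation.mem_verts_of_mem_bag hW hv')] at h
    exact ⟨u, hu', v, hv', h, h'.imp_right (Or.imp (And.imp_right (adj_iff hW).1)
      (And.imp_right fun h => mem_prevBag.1 (mem_iff.1 h)))⟩
  · rintro ⟨u, hu, v, hv, h, h'⟩
    refine ⟨u, mem_bagAt.2 hu, v, mem_bagAt.2 hv, ?_, h'.imp_right (Or.imp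
      (And.imp_right (adj_iff hW).2) (And.imp_right fun h => mem_iff.2 (mem_prevBag.2 h)))⟩
    rw [rank_eq (Presentation.mem_verts_of_mem_bag hW hu),
      rank_eq (Presentation.mem_verts_of_mem_bag hW hv)]
    exact h

theorem sameLetter_iff (hW : I.WellFormed) {i j : ℕ} :
    sameLetter (ofPresentation I ρ) i j = true ↔
      I.bagGraph.letter ρ i = I.bagGraph.letter ρ j := by
  rw [sameLetter, Bool.and_eq_true, List.all_eq_true, List.all_eq_true, Set.Subset.antisymm_iff]
  refine and_congr ?_ ?_
  · exact ⟨fun h t ht => (mem_letter_iff hW).1 (memTriple_iff.1 (h t ((mem_letter_iff hW).2 ht))),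
      fun h t ht => memTriple_iff.2 ((mem_letter_iff hW).2 (h ((mem_letter_iff hW).1 ht)))⟩
  · exact ⟨fun h t ht => (mem_letter_iff hW).1 (memTriple_iff.1 (h t ((mem_letter_iff hW).2 ht))),
      fun h t ht => memTriple_iff.2 ((mem_letter_iff hW).2 (h ((mem_letter_iff hW).1 ht)))⟩

theorem sameWindow_iff (hW : I.WellFormed) {n i j : ℕ} :
    sameWindow (ofPresentation I ρ) n i j = true ↔
      ∀ t < n, I.bagGraph.letter ρ (i + t : ℕ) = I.bagGraph.letter ρ (j + t : ℕ) := by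
  simp only [sameWindow, List.all_eq_true, List.mem_range, sameLetter_iff hW]

theorem or_not_eq_true {b c : Bool} : (!b || c) = true ↔ (b = true → c = true) := by
  cases b <;> cases c <;> decide

theorem check_iff (hW : I.WellFormed) {c : Place} :
    check (ofPresentation I ρ) c = true ↔ Suitable I.bagGraph ρ I.bags.length c := by
  have hshort : checkShort (ofPresentation I ρ) c = true ↔
      ∀ j < I.bags.length, c.x ≤ j → j + c.D ≤ c.y → ∀ v ∈ I.bagGraph.bag (j : ℕ),
        v ∈ I.bagGraph.bag (j + c.D : ℕ) → v ∈ I.bagGraph.bag c.x ∧ v ∈ I.bagGraph.bag c.y := by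
    simp only [checkShort, List.all_eq_true, List.mem_range, or_not_eq_true, Bool.and_eq_true,
      decide_eq_true_eq, mem_iff, and_imp]
    simp only [← mem_bagAt]
    rfl
  have hends : checkEnds (ofPresentation I ρ) c = true ↔
      ∀ i < I.bags.length, i ≤ c.a → c.a ≤ i + 2 * (c.g * c.D) →
        I.bagGraph.letter ρ (i : ℕ) = I.bagGraph.letter ρ (i + c.d : ℕ) := by
    simp only [checkEnds, List.all_eq_true, List.mem_range, or_not_eq_true, Bool.and_eq_true,
      decide_eq_true_eq, and_imp, sameLetter_iff hW]
    rfl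
  have hfreq : checkFrequent (ofPresentation I ρ) c = true ↔
      ∀ s < I.bags.length, c.x + 2 * (c.g * c.D) ≤ s → s + 4 * (c.g * c.D) ≤ c.y →
      c.g * (4 * (c.g * c.D) + 1) + 1 ≤ ((List.range I.bags.length).filter fun s' =>
          (decide (c.x + 4 * (c.g * c.D) ≤ s') && decide (s' + 6 * (c.g * c.D) ≤ c.y)) &&
          ((decide (s' + 2 * (c.g * c.D) ≤ c.a) || decide (c.a + c.d < s')) &&
          sameWindow (ofPresentation I ρ) (2 * (c.g * c.D) + 1) s s')).length := by
    simp only [checkFrequent, List.all_eq_true, List.mem_range, or_not_eq_true, Bool.and_eq_true,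
      decide_eq_true_eq, and_imp]
    rfl
  have hnum : checkNumbers (ofPresentation I ρ) c = true ↔ 1 ≤ c.g ∧ 1 ≤ c.D ∧ 1 ≤ c.d ∧
      c.x + 5 * (c.g * c.D) ≤ c.a ∧ c.a + c.d + 4 * (c.g * c.D) ≤ c.y ∧ c.y < I.bags.length := by
    simp only [checkNumbers, Bool.and_eq_true, decide_eq_true_eq]
    rfl
  rw [check, Bool.and_eq_true, Bool.and_eq_true, Bool.and_eq_true, hnum, hshort, hends, hfreq]
  have hfreq' : ∀ s, c.g * (4 * (c.g * c.D) + 1) + 1 ≤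
      ((List.range I.bags.length).filter fun s' =>
          (decide (c.x + 4 * (c.g * c.D) ≤ s') && decide (s' + 6 * (c.g * c.D) ≤ c.y)) &&
          ((decide (s' + 2 * (c.g * c.D) ≤ c.a) || decide (c.a + c.d < s')) &&
          sameWindow (ofPresentation I ρ) (2 * (c.g * c.D) + 1) s s')).length → 
      ∃ T : Finset ℕ, c.g * (4 * (c.g * c.D) + 1) + 1 ≤ T.card ∧ ∀ n ∈ T,
      c.x + 4 * (c.g * c.D) ≤ n ∧ n + 6 * (c.g * c.D) ≤ c.y ∧
      (n + 2 * (c.g * c.D) ≤ c.a ∨ c.a + c.d < n) ∧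
      ∀ t < 2 * (c.g * c.D) + 1,
        I.bagGraph.letter ρ (s + t : ℕ) = I.bagGraph.letter ρ (n + t : ℕ) := by
    intro s hs
    refine ⟨_, hs.trans_eq (List.toFinset_card_of_nodup (List.nodup_range.filter _)).symm,
      fun n hn => ?_⟩
    simp only [List.mem_toFinset, List.mem_filter, Bool.and_eq_true, Bool.or_eq_true,
      decide_eq_true_eq, sameWindow_iff hW] at hn
    exact ⟨hn.2.1.1, hn.2.1.2, hn.2.2.1, hn.2.2.2⟩
  constructor
  · rintro ⟨⟨h1, h2, h3, h4, h5, h6⟩, h7, h8, h9⟩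
    exact ⟨h1, h2, h3, h4, h5, h6, h7, h8, fun s hs hs1 hs2 => hfreq' s (h9 s hs hs1 hs2)⟩
  · intro h
    refine ⟨⟨h.1, h.2, h.3, h.4, h.5, h.6⟩, h.7, h.8, fun s hs hs1 hs2 => ?_⟩
    obtain ⟨T, hT, hTn⟩ := h.9 s hs hs1 hs2
    refine hT.trans ?_
    rw [← List.toFinset_card_of_nodup (List.nodup_range.filter _)]
    refine Finset.card_le_card fun n hn => ?_
    have h1 := hTn n hn
    have := h.6
    simp only [List.mem_toFinset, List.mem_filter, Bool.and_eq_true, Bool.or_eq_true,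
      decide_eq_true_eq, sameWindow_iff hW, List.mem_range]
    exact ⟨by omega, ⟨h1.1, h1.2.1⟩, h1.2.2.1, h1.2.2.2⟩

end

end Reduction

/-! ### The presented graph after the cut -/

namespace Reduction

open BagGraph

theorem glue_of_mem {ranks : List (Lab × Lab)} {ba bb : List Lab} {u w : Lab} (hu : u ∈ bb)
    (hw : w ∈ ba) (hr : rank ranks w = rank ranks u) :
    glue ranks ba bb u ∈ ba ∧ rank ranks (glue ranks ba bb u) = rank ranks u := by
  rw [glue, mem_iff.2 hu, cond_true]
  have hmem : w ∈ ba.filter fun w => decide (rank ranks w = rank ranks u) := by simp [hw, hr]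
  cases h : ba.filter fun w => decide (rank ranks w = rank ranks u) with
  | nil => rw [h] at hmem; simp at hmem
  | cons z l =>
    have hz : z ∈ ba.filter fun w => decide (rank ranks w = rank ranks u) := by
      rw [h]; exact List.mem_cons_self
    simpa using hz

theorem glue_of_notMem {ranks : List (Lab × Lab)} {ba bb : List Lab} {u : Lab} (hu : u ∉ bb) :
    glue ranks ba bb u = u := by
  have : mem u bb = false := by rw [← Bool.not_eq_true, mem_iff]; exact hu
  rw [glue, this, cond_false]

theorem covered_iff {bags : List (List Lab)} {e : Lab × Lab} :
    covered bags e = true ↔ ∃ b ∈ bags, e.1 ∈ b ∧ e.2 ∈ b := by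
  simp only [covered, List.any_eq_true, Bool.and_eq_true, mem_iff]

variable {I : Presentation} {ρ : ℕ → ℕ} {p a d : ℕ}

/-- The gluing map of the algorithm. -/
def glueMap (I : Presentation) (ρ : ℕ → ℕ) (a d : ℕ) (u : ℕ) : ℕ :=
  glue (ofPresentation I ρ).ranks (bagAt I.bags a) (bagAt I.bags (a + d)) u

theorem gluing (hW : I.WellFormed) (hN : I.Normalized p ρ) (hd : 1 ≤ d)
    (h : I.bagGraph.letter ρ (a : ℕ) = I.bagGraph.letter ρ (a + d : ℕ)) :
    Gluing I.bagGraph ρ (glueMap I ρ a d) (a : ℕ) (a + d : ℕ) := by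
  have key : ∀ u ∈ I.bagGraph.bag (a + d : ℕ), glueMap I ρ a d u ∈ I.bagGraph.bag a ∧
      ρ (glueMap I ρ a d u) = ρ u := by
    intro u hu
    obtain ⟨w, hw, hr⟩ := exists_rank_eq_of_letter_eq h.symm hu
    have hru : rank (ofPresentation I ρ).ranks u = ρ u :=
      rank_eq (Presentation.mem_verts_of_mem_bag hW hu)
    have hrw : rank (ofPresentation I ρ).ranks w = ρ w :=
      rank_eq (Presentation.mem_verts_of_mem_bag hW hw)
    have := glue_of_mem (ranks := (ofPresentation I ρ).ranks) (mem_bagAt.2 hu) (mem_bagAt.2 hw)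
      (hrw.trans (hr.trans hru.symm))
    have h1 : glueMap I ρ a d u ∈ I.bagGraph.bag a := mem_bagAt.1 this.1
    refine ⟨h1, ?_⟩
    have h2 : rank (ofPresentation I ρ).ranks (glueMap I ρ a d u) = ρ (glueMap I ρ a d u) :=
      rank_eq (Presentation.mem_verts_of_mem_bag hW h1)
    exact h2.symm.trans (this.2.trans hru)
  exact ⟨hN.ranked hW, by omega, fun u hu => (key u hu).1, fun u hu => (key u hu).2,
    fun u hu => glue_of_notMem fun hu' => hu (mem_bagAt.1 hu'), h⟩

/-- The presented graph after the cut. -/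
def cutPresentation (I : Presentation) (ρ : ℕ → ℕ) (a d : ℕ) : Presentation :=
  toPresentation (cut (ofPresentation I ρ) a d)

theorem length_cutPresentation_bags (h : a + d < I.bags.length) :
    (cutPresentation I ρ a d).bags.length + d = I.bags.length := by
  change (cutBags (ofPresentation I ρ) a d).length + d = _
  have e : (ofPresentation I ρ).bags.length = I.bags.length := rfl
  simp only [cutBags, List.length_append, List.length_take, List.length_map, List.length_drop, e]
  omega

theorem getD_cutBags_left {i : ℕ} (h : a + d < I.bags.length) (hi : i ≤ a) :
    (cutPresentation I ρ a d).bags.getD i [] = I.bags.getD i [] := by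
  have e : (cutPresentation I ρ a d).bags = I.bags.take (a + 1) ++ (I.bags.drop (a + d + 1)).map
    fun b => b.map fun u => glueMap I ρ a d u := rfl
  rw [e, List.getD_append _ _ _ _ (by simp; omega)]
  simp only [List.getD_eq_getElem?_getD]
  rw [List.getElem?_take_of_lt (by omega)]

theorem getD_cutBags_right {i : ℕ} (h : a + d < I.bags.length) (hi : a < i) :
    (cutPresentation I ρ a d).bags.getD i [] = (I.bags.getD (i + d) []).map (glueMap I ρ a d) := by
  have e : (cutPresentation I ρ a d).bags = I.bags.take (a + 1) ++ (I.bags.drop (a + d + 1)).map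
    fun b => b.map fun u => glueMap I ρ a d u := rfl
  have hl : (I.bags.take (a + 1)).length = a + 1 := by simp; omega
  rw [e, List.getD_append_right _ _ _ _ (by omega), hl]
  simp only [List.getD_eq_getElem?_getD]
  rw [List.getElem?_map, List.getElem?_drop, show a + d + 1 + (i - (a + 1)) = i + d by omega]
  cases I.bags[i + d]? <;> simp

theorem bagGraph_cutPresentation_bag (h : a + d < I.bags.length) (m : ℤ) :
    (cutPresentation I ρ a d).bagGraph.bag m =
      (I.bagGraph.cut (glueMap I ρ a d) (a : ℕ) (a + d : ℕ)).bag m := by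
  ext v
  by_cases hm : m ≤ a
  · rw [Gluing.cut_bag_of_le hm]
    change (0 ≤ m ∧ v ∈ (cutPresentation I ρ a d).bags.getD m.toNat []) ↔
      (0 ≤ m ∧ v ∈ I.bags.getD m.toNat [])
    rw [getD_cutBags_left h (by omega)]
  · rw [Gluing.cut_bag_of_lt (by omega)]
    change (0 ≤ m ∧ v ∈ (cutPresentation I ρ a d).bags.getD m.toNat []) ↔
      v ∈ glueMap I ρ a d '' {v | 0 ≤ m + ((a + d : ℕ) - (a : ℕ) : ℤ) ∧
        v ∈ I.bags.getD (m + ((a + d : ℕ) - (a : ℕ) : ℤ)).toNat []}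
    rw [getD_cutBags_right h (by omega), List.mem_map,
      show (m + ((a + d : ℕ) - (a : ℕ) : ℤ)).toNat = m.toNat + d by omega]
    constructor
    · rintro ⟨h0, u, hu, rfl⟩
      exact ⟨u, ⟨by omega, hu⟩, rfl⟩
    · rintro ⟨u, ⟨_, hu⟩, rfl⟩
      exact ⟨by omega, u, hu, rfl⟩

theorem covered_take_iff {e : ℕ × ℕ} :
    covered (I.bags.take (a + 1)) e = true ↔
      ∃ m : ℤ, m ≤ a ∧ e.1 ∈ I.bagGraph.bag m ∧ e.2 ∈ I.bagGraph.bag m := by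
  have h : covered (I.bags.take (a + 1)) e = true ↔
    ∃ b ∈ I.bags.take (a + 1), e.1 ∈ b ∧ e.2 ∈ b := covered_iff
  refine h.trans ⟨?_, ?_⟩
  · rintro ⟨b, hb, h1, h2⟩
    obtain ⟨i, hi, rfl⟩ := List.mem_take_iff_getElem.1 hb
    exact ⟨i, by omega, Presentation.mem_bag_iff.2 ⟨⟨i, by omega⟩, rfl, h1⟩,
      Presentation.mem_bag_iff.2 ⟨⟨i, by omega⟩, rfl, h2⟩⟩
  · rintro ⟨m, hm, h1, h2⟩
    obtain ⟨i, rfl, h3⟩ := Presentation.mem_bag_iff.1 h1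
    rw [Presentation.mem_bag_natCast, List.getD_eq_getElem _ _ i.2] at h2
    exact ⟨_, List.mem_take_iff_getElem.2 ⟨i, by have := i.2; omega, rfl⟩, h3, h2⟩

theorem covered_drop_iff {k : ℕ} {e : ℕ × ℕ} :
    covered (I.bags.drop (k + 1)) e = true ↔
      ∃ m : ℤ, m > k ∧ e.1 ∈ I.bagGraph.bag m ∧ e.2 ∈ I.bagGraph.bag m := by
  have h : covered (I.bags.drop (k + 1)) e = true ↔
    ∃ b ∈ I.bags.drop (k + 1), e.1 ∈ b ∧ e.2 ∈ b := covered_iff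
  refine h.trans ⟨?_, ?_⟩
  · rintro ⟨b, hb, h1, h2⟩
    obtain ⟨i, hi, rfl⟩ := List.mem_drop_iff_getElem.1 hb
    exact ⟨(k + 1 + i : ℕ), by omega, Presentation.mem_bag_iff.2 ⟨⟨k + 1 + i, by omega⟩, rfl, h1⟩,
      Presentation.mem_bag_iff.2 ⟨⟨k + 1 + i, by omega⟩, rfl, h2⟩⟩
  · rintro ⟨m, hm, h1, h2⟩
    obtain ⟨i, rfl, h3⟩ := Presentation.mem_bag_iff.1 h1
    rw [Presentation.mem_bag_natCast, List.getD_eq_getElem _ _ i.2] at h2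
    refine ⟨I.bags[i], List.mem_drop_iff_getElem.2 ⟨i - (k + 1), by have := i.2; omega, ?_⟩, h3, h2⟩
    simp only [show k + 1 + (i.1 - (k + 1)) = i.1 by omega]
    rfl

theorem mem_cutEdges_iff {e : ℕ × ℕ} :
    e ∈ (cutPresentation I ρ a d).edges ↔
      (e ∈ I.edges ∧ ∃ m : ℤ, m ≤ a ∧ e.1 ∈ I.bagGraph.bag m ∧ e.2 ∈ I.bagGraph.bag m) ∨
      ∃ e' ∈ I.edges, (∃ m : ℤ, m > (a + d : ℕ) ∧
        e'.1 ∈ I.bagGraph.bag m ∧ e'.2 ∈ I.bagGraph.bag m) ∧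
        (glueMap I ρ a d e'.1, glueMap I ρ a d e'.2) = e := by
  have e1 : (cutPresentation I ρ a d).edges =
      (I.edges.filter fun e : ℕ × ℕ => covered (I.bags.take (a + 1)) e) ++
      (I.edges.filter fun e : ℕ × ℕ => covered (I.bags.drop (a + d + 1)) e).map fun e =>
        (glueMap I ρ a d e.1, glueMap I ρ a d e.2) := rfl
  rw [e1, List.mem_append, List.mem_map, List.mem_filter, covered_take_iff]
  simp only [List.mem_filter, covered_drop_iff, and_assoc]

theorem bagGraph_cutPresentation_adj (hg : Gluing I.bagGraph ρ (glueMap I ρ a d) (a : ℕ) (a + d : ℕ))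
    (u v : ℕ) :
    (cutPresentation I ρ a d).bagGraph.Adj u v ↔
      (I.bagGraph.cut (glueMap I ρ a d) (a : ℕ) (a + d : ℕ)).Adj u v := by
  change (u ≠ v ∧ ((u, v) ∈ (cutPresentation I ρ a d).edges ∨
    (v, u) ∈ (cutPresentation I ρ a d).edges)) ↔ _
  simp only [mem_cutEdges_iff, Prod.mk.injEq]
  constructor
  · rintro ⟨hne, (⟨h1, m, hm, h2, h3⟩ | ⟨⟨x, y⟩, h1, ⟨m, hm, h2, h3⟩, rfl, rfl⟩) |
      (⟨h1, m, hm, h2, h3⟩ | ⟨⟨x, y⟩, h1, ⟨m, hm, h2, h3⟩, rfl, rfl⟩)⟩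
    · exact .inl ⟨m, hm, h2, h3, hne, .inl h1⟩
    · exact .inr ⟨m, hm, x, h2, y, h3, ⟨fun e => hne (congrArg _ e), .inl h1⟩, rfl, rfl⟩
    · exact .inl ⟨m, hm, h3, h2, hne, .inr h1⟩
    · exact .inr ⟨m, hm, y, h3, x, h2, ⟨fun e => hne (congrArg _ e), .inr h1⟩, rfl, rfl⟩
  · rintro (⟨m, hm, h2, h3, hne, h1⟩ | ⟨m, hm, x, h2, y, h3, ⟨hne, h1⟩, rfl, rfl⟩)
    · exact ⟨hne, h1.imp (fun h1 => .inl ⟨h1, m, hm, h2, h3⟩) fun h1 => .inl ⟨h1, m, hm, h3, h2⟩⟩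
    · exact ⟨fun e => hne (hg.injOn hm.le hm.le h2 h3 e), h1.imp
        (fun h1 => .inr ⟨(x, y), h1, ⟨m, hm, h2, h3⟩, rfl, rfl⟩)
        fun h1 => .inr ⟨(y, x), h1, ⟨m, hm, h3, h2⟩, rfl, rfl⟩⟩

theorem bagGraph_cutPresentation (hg : Gluing I.bagGraph ρ (glueMap I ρ a d) (a : ℕ) (a + d : ℕ))
    (h : a + d < I.bags.length) : (cutPresentation I ρ a d).bagGraph =
      I.bagGraph.cut (glueMap I ρ a d) (a : ℕ) (a + d : ℕ) := by
  have h1 := bagGraph_cutPresentation_bag (ρ := ρ) h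
  have h2 := bagGraph_cutPresentation_adj hg
  revert h1 h2
  generalize (cutPresentation I ρ a d).bagGraph = G
  generalize I.bagGraph.cut (glueMap I ρ a d) (a : ℕ) (a + d : ℕ) = G'
  intro h1 h2
  cases G; cases G'
  congr 1
  · exact funext h1
  · exact funext fun u => funext fun v => propext (h2 u v)

theorem kept_iff {v : ℕ} : kept (ofPresentation I ρ) a d v = true ↔
    ∃ m, v ∈ (cutPresentation I ρ a d).bagGraph.bag m := by
  change (cutBags (ofPresentation I ρ) a d).any (fun b => mem v b) = true ↔ _
  rw [List.any_eq_true]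
  constructor
  · rintro ⟨b, hb, hv⟩
    obtain ⟨i, hi, rfl⟩ := List.mem_iff_getElem.1 hb
    exact ⟨i, Presentation.mem_bag_iff.2 ⟨⟨i, hi⟩, rfl, mem_iff.1 hv⟩⟩
  · rintro ⟨m, hm⟩
    obtain ⟨i, _, hi⟩ := Presentation.mem_bag_iff.1 hm
    exact ⟨_, List.getElem_mem i.2, mem_iff.2 hi⟩

theorem mem_cutPresentation_verts {v : ℕ} : v ∈ (cutPresentation I ρ a d).verts ↔
    v ∈ I.verts ∧ ∃ m, v ∈ (cutPresentation I ρ a d).bagGraph.bag m := by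
  have e : (cutPresentation I ρ a d).verts =
    I.verts.filter fun v : ℕ => kept (ofPresentation I ρ) a d v := rfl
  rw [e, List.mem_filter, kept_iff]

/-- Vertices and rank table are filtered by the same test, so the table remains the one that belongs
to the remaining vertices. -/
theorem enc_cut : Enc.enc (cut (ofPresentation I ρ) a d) =
    encodeRanked (cutPresentation I ρ a d) ρ := by
  rw [← enc_ofPresentation]
  congr 1
  have e : (I.verts.map fun v => ((v, ρ v) : ℕ × ℕ)).filter
      (fun e => kept (ofPresentation I ρ) a d e.1) =
      (I.verts.filter fun v => kept (ofPresentation I ρ) a d v).map fun v => (v, ρ v) := by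
    rw [List.filter_map]
    rfl
  change Instance.mk _ _ _ _ = Instance.mk _ _ _ _
  congr 1

theorem cut_bag_subset_verts (hW : I.WellFormed)
    (hg : Gluing I.bagGraph ρ (glueMap I ρ a d) (a : ℕ) (a + d : ℕ)) {v : ℕ} {m : ℤ}
    (hv : v ∈ (I.bagGraph.cut (glueMap I ρ a d) (a : ℕ) (a + d : ℕ)).bag m) : v ∈ I.verts := by
  by_cases hm : m ≤ a
  · rw [Gluing.cut_bag_of_le hm] at hv
    exact Presentation.mem_verts_of_mem_bag hW hv
  · rw [Gluing.cut_bag_of_lt (by omega)] at hv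
    obtain ⟨u, hu, rfl⟩ := hv
    by_cases hub : u ∈ I.bagGraph.bag (a + d : ℕ)
    · exact Presentation.mem_verts_of_mem_bag hW (hg.mem u hub)
    · rw [hg.eq u hub]
      exact Presentation.mem_verts_of_mem_bag hW hu

theorem cutPresentation_mem_verts_iff (hW : I.WellFormed) (h : a + d < I.bags.length)
    (hg : Gluing I.bagGraph ρ (glueMap I ρ a d) (a : ℕ) (a + d : ℕ)) {v : ℕ} :
    v ∈ (cutPresentation I ρ a d).verts ↔ ∃ m, v ∈ (cutPresentation I ρ a d).bagGraph.bag m := by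
  rw [mem_cutPresentation_verts, and_iff_right_iff_imp]
  rintro ⟨m, hm⟩
  rw [bagGraph_cutPresentation hg h] at hm
  exact cut_bag_subset_verts hW hg hm

theorem cutPresentation_wellFormed (hW : I.WellFormed) (h : a + d < I.bags.length)
    (hg : Gluing I.bagGraph ρ (glueMap I ρ a d) (a : ℕ) (a + d : ℕ)) :
    (cutPresentation I ρ a d).WellFormed := by
  refine ⟨hW.verts_nodup.filter _, fun e he => ?_, fun b hb v hv => ?_⟩
  · have hne : e.1 ≠ e.2 := by
      rcases mem_cutEdges_iff.1 he with ⟨h1, _⟩ | ⟨e', h1, ⟨m, hm, h2, h3⟩, rfl⟩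
      · exact (hW.edges_mem e h1).2.2
      · exact fun heq => (hW.edges_mem e' h1).2.2 (hg.injOn hm.le hm.le h2 h3 heq)
    have hadj : (cutPresentation I ρ a d).bagGraph.Adj e.1 e.2 := ⟨hne, .inl he⟩
    obtain ⟨m, h1, h2⟩ : ∃ m, e.1 ∈ (cutPresentation I ρ a d).bagGraph.bag m ∧
        e.2 ∈ (cutPresentation I ρ a d).bagGraph.bag m := by
      rw [bagGraph_cutPresentation hg h] at hadj ⊢
      exact hg.cut_ranked.cover _ _ hadj
    exact ⟨(cutPresentation_mem_verts_iff hW h hg).2 ⟨m, h1⟩,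
      (cutPresentation_mem_verts_iff hW h hg).2 ⟨m, h2⟩, hne⟩
  · obtain ⟨i, hi, rfl⟩ := List.mem_iff_getElem.1 hb
    exact (cutPresentation_mem_verts_iff hW h hg).2
      ⟨i, Presentation.mem_bag_iff.2 ⟨⟨i, hi⟩, rfl, hv⟩⟩

/-- The first removed bag contains a vertex that is new there, and by `notMem_cut_bag` such a vertex
disappears. -/
theorem cutPresentation_length_lt (hW : I.WellFormed) (hN : I.Normalized p ρ) (hd : 1 ≤ d)
    (h : a + d < I.bags.length)
    (hg : Gluing I.bagGraph ρ (glueMap I ρ a d) (a : ℕ) (a + d : ℕ)) :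
    (cutPresentation I ρ a d).verts.length < I.verts.length := by
  obtain ⟨u, hu, hu'⟩ := hN.exists_new (m := (a + 1 : ℕ)) (by omega) (by omega)
  have hnot : kept (ofPresentation I ρ) a d u ≠ true := by
    rw [Ne, kept_iff, bagGraph_cutPresentation hg h]
    rintro ⟨m, hm⟩
    exact hg.notMem_cut_bag (k := (a + 1 : ℕ)) (by omega) (by omega) hu hu' hm
  exact List.length_filter_lt_length_iff_exists.2
    ⟨u, Presentation.mem_verts_of_mem_bag hW hu, hnot⟩

variable {S : Set ℕ} {D : ℕ} {x y : ℤ}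

theorem cutPresentation_normalized (hW : I.WellFormed) (hN : I.Normalized p ρ)
    (h : a + d < I.bags.length)
    (hz : ZoneGluing I.bagGraph ρ (glueMap I ρ a d) S D x y (a : ℕ) (a + d : ℕ)) :
    (cutPresentation I ρ a d).Normalized p ρ := by
  have hg := hz.toGluing
  have e := bagGraph_cutPresentation hg h
  have hverts : ∀ v ∈ (cutPresentation I ρ a d).verts, v ∈ I.verts := fun v hv =>
    (mem_cutPresentation_verts.1 hv).1
  refine Presentation.normalized_of (e ▸ hg.cut_ranked) (fun v hv =>
    (mem_cutPresentation_verts.1 hv).2) (fun v hv => hN.rank_mem ⟨v, hverts v hv⟩)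
    (fun v hv j hj hp => ?_) (fun m h1 h2 => ?_) (cutPresentation_wellFormed hW h hg)
  · have hvm := (mem_cutPresentation_verts.1 hv).2
    rw [e] at hvm ⊢
    obtain ⟨w, hwr, hw, hle⟩ := hz.cut_neighbors (j := j) hvm
    exact hle.trans (hN.neighbors_le hW hw (hwr ▸ hj) hp)
  · have := length_cutPresentation_bags (ρ := ρ) h
    rw [e]
    exact hg.exists_new (fun hm => hN.exists_new h1 (by omega))
      fun hm => hN.exists_new (by omega) (by omega)

variable {c : Place}

/-- The margin of `3 * (g * D)` on both sides makes the test of shortness available at all positions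
within `D` of the zone. -/
theorem Suitable.zone (hN : I.bagGraph.Ranked ρ)
    (hc : Suitable I.bagGraph ρ I.bags.length c) :
    Zone I.bagGraph ρ (I.bagGraph.bag c.x ∩ I.bagGraph.bag c.y) c.D
      (c.x + 3 * (c.g * c.D) : ℕ) (c.y - 3 * (c.g * c.D) : ℕ) := by
  have hg := hc.one_le_g
  have h1 := hc.one_le_D
  have h2 := hc.left
  have h3 := hc.right
  have h4 := hc.lt
  have h5 : c.D ≤ c.g * c.D := Nat.le_mul_of_pos_left _ hg
  set R := c.g * c.D
  have key : ∀ v ∉ I.bagGraph.bag c.x ∩ I.bagGraph.bag c.y, ∀ i j : ℤ, c.x ≤ i → i + c.D ≤ c.y →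
      i + c.D ≤ j → v ∈ I.bagGraph.bag i → v ∈ I.bagGraph.bag j → False := by
    intro v hv i j hxi hiy hij hi hj
    obtain ⟨i, rfl⟩ : ∃ n : ℕ, (n : ℤ) = i := ⟨i.toNat, by omega⟩
    refine hv (hc.short i (by omega) (by omega) (by omega) v hi ?_)
    exact hN.interval v i _ j (by omega) (by push_cast; omega) hi hj
  refine ⟨hN, fun s hs m hm hm' => ?_, fun v hv m k hm hm' hvm hvk => ?_⟩
  · exact hN.interval s c.x m c.y (by omega) (by omega) hs.1 hs.2
  · rw [abs_le]
    constructor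
    · by_contra hlt
      exact key v hv m k (by omega) (by omega) (by omega) hvm hvk
    · by_contra hlt
      exact key v hv (m - c.D) m (by omega) (by omega) (by omega)
        (hN.interval v k _ m (by omega) (by omega) hvk hvm) hvm

theorem Suitable.letter_eq (hc : Suitable I.bagGraph ρ I.bags.length c) {t : ℤ} (h0 : 0 ≤ t)
    (ht : t ≤ 2 * (c.g * c.D : ℕ)) :
    I.bagGraph.letter ρ ((c.a : ℕ) - t) = I.bagGraph.letter ρ ((c.a + c.d : ℕ) - t) := by
  have h2 := hc.left
  have h3 := hc.right
  have h4 := hc.lt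
  set R := c.g * c.D
  have := hc.ends (c.a - t.toNat) (by omega) (by omega) (by omega)
  convert this using 2 <;> omega

theorem Suitable.zoneGluing (hW : I.WellFormed) (hN : I.Normalized p ρ)
    (hc : Suitable I.bagGraph ρ I.bags.length c) :
    ZoneGluing I.bagGraph ρ (glueMap I ρ c.a c.d) (I.bagGraph.bag c.x ∩ I.bagGraph.bag c.y) c.D
      (c.x + 3 * (c.g * c.D) : ℕ) (c.y - 3 * (c.g * c.D) : ℕ) (c.a : ℕ) (c.a + c.d : ℕ) := by
  have hg := hc.one_le_g
  have h2 := hc.left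
  have h3 := hc.right
  have h5 : c.D ≤ c.g * c.D := Nat.le_mul_of_pos_left _ hg
  refine ⟨gluing hW hN hc.one_le_d (by simpa using hc.letter_eq (t := 0) le_rfl (by omega)),
    hc.zone (hN.ranked hW), by omega, by omega, fun t h0 ht => hc.letter_eq h0 ?_⟩
  omega

/-- A place names windows by their first bag, `WordCut` by their centre; the difference is `R = g *
D`. -/
theorem Suitable.wordCut (hc : Suitable I.bagGraph ρ I.bags.length c)
    (hg : Gluing I.bagGraph ρ (glueMap I ρ c.a c.d) (c.a : ℕ) (c.a + c.d : ℕ)) :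
    WordCut (I.bagGraph.letter ρ)
      ((I.bagGraph.cut (glueMap I ρ c.a c.d) (c.a : ℕ) (c.a + c.d : ℕ)).letter ρ)
      (c.x + 3 * (c.g * c.D) : ℕ) (c.y - 3 * (c.g * c.D) : ℕ) (c.a : ℕ) (c.a + c.d : ℕ)
      (c.g * c.D) (c.g * (4 * (c.g * c.D) + 1)) := by
  have h1 := hc.one_le_d
  have h2 := hc.left
  have h3 := hc.right
  have h4 := hc.lt
  have hfr := hc.frequent
  have hle := fun t : ℤ => hc.letter_eq (t := t)
  set R := c.g * c.D
  refine ⟨by omega, by omega, by omega, fun m hm => hg.cut_letter_left hm,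
    fun m hm => hg.cut_letter_right hm, fun t h0 ht => hle t h0 ht, fun m hm hm' => ?_⟩
  obtain ⟨T, hT, hTn⟩ := hfr (m - R).toNat (by omega) (by omega) (by omega)
  refine ⟨T.image fun n : ℕ => (n : ℤ) + R, ?_, fun n hn => ?_⟩
  · rw [Finset.card_image_of_injective _ fun n n' h => by simpa using h]; omega
  · obtain ⟨k, hk, rfl⟩ := Finset.mem_image.1 hn
    obtain ⟨h5, h6, h7, h8⟩ := hTn k hk
    refine ⟨by omega, by omega, by omega, fun t ht1 ht2 => ?_⟩
    have := h8 (t + R).toNat (by omega)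
    convert this using 2 <;> omega

/-- A cut at a suitable place is correct. -/
theorem Suitable.models_iff (hW : I.WellFormed) (hN : I.Normalized p ρ)
    (hc : Suitable I.bagGraph ρ I.bags.length c) {q : ℕ} (hq : 2 * 3 ^ q ≤ c.g) {ψ : Formula}
    (hψ : ψ.quantifiers ≤ q) :
    Models I.graph ψ ↔ Models (cutPresentation I ρ c.a c.d).graph ψ := by
  have hz := hc.zoneGluing hW hN
  have hg := hz.toGluing
  have hlt : c.a + c.d < I.bags.length := by
    have h3 := hc.right
    have h4 := hc.lt
    omega
  have hcut := hc.wordCut hg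
  have e := bagGraph_cutPresentation hg hlt
  have hqg : q ≤ c.g := by
    have : q < 3 ^ q := Nat.lt_pow_self (by norm_num)
    omega
  refine BagGraph.models_iff (f := Subtype.val) (f' := Subtype.val) Subtype.val_injective
    Subtype.val_injective (fun u => ?_) (fun u => ?_) (fun u v => Presentation.graph_adj)
    (fun u v => e ▸ Presentation.graph_adj) (q := q) ?_ ?_ hz.zone hz.cut_zone
    hz.agreeOutside hcut.similar hcut.similar' hψ
  · rw [← hN.mem_verts_iff hW]; simp
  · rw [← e, ← cutPresentation_mem_verts_iff hW hlt hg]; simp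
  · calc 3 ^ q * (2 * c.D) = (2 * 3 ^ q) * c.D := by ring
      _ ≤ c.g * c.D := Nat.mul_le_mul_right _ hq
  · exact Nat.mul_le_mul_right _ hqg

/-! ### The search -/

theorem mem_places {n : ℕ} {c : Place} {g : ℕ} : c ∈ places n g ↔
    c.g = g ∧ c.D < n ∧ c.x < n ∧ c.y < n ∧ c.a < n ∧ c.d < n := by
  simp only [places, List.mem_flatMap, List.mem_map, List.mem_range]
  constructor
  · rintro ⟨D, hD, x, hx, y, hy, a, ha, d, hd, rfl⟩
    exact ⟨rfl, hD, hx, hy, ha, hd⟩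
  · rintro ⟨rfl, hD, hx, hy, ha, hd⟩
    exact ⟨_, hD, _, hx, _, hy, _, ha, _, hd, rfl⟩

theorem pairwise_allPlaces (n : ℕ) : (allPlaces n).Pairwise fun c c' => c'.g ≤ c.g := by
  rw [allPlaces, List.pairwise_flatMap]
  constructor
  · intro g _
    refine List.pairwise_of_forall_mem_list fun c hc c' hc' => ?_
    rw [(mem_places.1 hc).1, (mem_places.1 hc').1]
  · rw [List.pairwise_reverse]
    refine List.pairwise_lt_range.imp fun {g g'} hgg' c hc c' hc' => ?_
    rw [(mem_places.1 hc).1, (mem_places.1 hc').1]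
    exact hgg'.le

/-- The numerical requirements put all entries of a suitable place below the number of bags, so it
is among the candidates, and these are ordered by descending `g`. -/
theorem search_spec {J : Instance} {c : Place} (hc : check J c = true)
    (hg : c.g < J.bags.length) : check J (search J) = true ∧ c.g ≤ (search J).g := by
  have hnum : 1 ≤ c.g ∧ 1 ≤ c.D ∧ 1 ≤ c.d ∧ c.x + 5 * (c.g * c.D) ≤ c.a ∧
      c.a + c.d + 4 * (c.g * c.D) ≤ c.y ∧ c.y < J.bags.length := by
    rw [check, Bool.and_eq_true] at hc
    simpa only [checkNumbers, Bool.and_eq_true, decide_eq_true_eq] using hc.1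
  have hD : c.D ≤ c.g * c.D := Nat.le_mul_of_pos_left _ hnum.1
  have hmem : c ∈ (allPlaces J.bags.length).filter fun c => check J c := by
    refine List.mem_filter.2 ⟨List.mem_flatMap.2 ⟨c.g, by simpa using hg, mem_places.2 ?_⟩, hc⟩
    omega
  have hpw := (pairwise_allPlaces J.bags.length).filter fun c => check J c
  rw [search]
  cases h : (allPlaces J.bags.length).filter fun c => check J c with
  | nil => rw [h] at hmem; simp at hmem
  | cons c' l =>
    rw [h] at hmem hpw
    rw [List.headD_cons]
    have hc' : c' ∈ (allPlaces J.bags.length).filter fun c => check J c := by rw [h]; simp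
    refine ⟨(List.mem_filter.1 hc').2, ?_⟩
    rcases List.mem_cons.1 hmem with rfl | hmem
    · exact le_rfl
    · exact (List.pairwise_cons.1 hpw).1 c hmem

end Reduction

namespace Reduction

open BagGraph

/-! ### Existence of a suitable place -/

/-- A long word with few letters has a nonempty factor in which each letter occurs often. -/
theorem exists_frequent_factor {α : Type*} [DecidableEq α] (w : ℕ → α) (K : ℕ) :
    ∀ (n : ℕ) (U : Finset α) (s L : ℕ), U.card ≤ n → K ^ n ≤ L → 1 ≤ K →
      (∀ i, s ≤ i → i < s + L → w i ∈ U) →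
      ∃ s' L', s ≤ s' ∧ s' + L' ≤ s + L ∧ 1 ≤ L' ∧ ∀ i, s' ≤ i → i < s' + L' →
        K ≤ ((Finset.Ico s' (s' + L')).filter fun j => w j = w i).card := by
  intro n
  induction n with
  | zero =>
    intro U s L hU hL _ hw
    have := hw s le_rfl (by rw [pow_zero] at hL; omega)
    rw [Finset.card_eq_zero.1 (Nat.le_zero.1 hU)] at this
    simp at this
  | succ n ih =>
    intro U s L hU hL hK hw
    have hpos : 1 ≤ K ^ n := Nat.one_le_pow _ _ hK
    have hLL : K * K ^ n ≤ L := by rwa [pow_succ'] at hL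
    by_cases hall : ∀ i, s ≤ i → i < s + L →
        K ≤ ((Finset.Ico s (s + L)).filter fun j => w j = w i).card
    · exact ⟨s, L, le_rfl, le_rfl, hpos.trans ((Nat.le_mul_of_pos_left _ hK).trans hLL), hall⟩
    push Not at hall
    obtain ⟨i, hi, hi', hlt⟩ := hall
    -- A letter with fewer than `K` occurrences misses one of `K` disjoint blocks of length `K ^ n`;
    -- the induction continues in that block with a smaller alphabet.
    obtain ⟨k, hk, hblock⟩ : ∃ k < K, ∀ j, s + k * K ^ n ≤ j → j < s + k * K ^ n + K ^ n →
        w j ≠ w i := by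
      by_contra hcon
      push Not at hcon
      choose! f hf1 hf2 hf3 using hcon
      have hle : (Finset.range K).card ≤
          ((Finset.Ico s (s + L)).filter fun j => w j = w i).card := by
        refine Finset.card_le_card_of_injOn f (fun k hk => ?_) fun k hk k' hk' e => ?_
        · have hk := Finset.mem_range.1 hk
          have h1 := hf1 k hk
          have h2 := hf2 k hk
          have h3 : (k + 1) * K ^ n ≤ K * K ^ n := Nat.mul_le_mul_right _ hk
          rw [add_mul, one_mul] at h3
          simp only [Finset.coe_filter, Finset.mem_Ico]
          exact ⟨⟨by omega, by omega⟩, hf3 k hk⟩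
        · have hk := Finset.mem_range.1 hk
          have hk' := Finset.mem_range.1 hk'
          have h1 := hf1 k hk
          have h2 := hf2 k hk
          have h1' := hf1 k' hk'
          have h2' := hf2 k' hk'
          rcases lt_trichotomy k k' with h | h | h
          · have h3 : (k + 1) * K ^ n ≤ k' * K ^ n := Nat.mul_le_mul_right _ h
            rw [add_mul, one_mul] at h3
            omega
          · exact h
          · have h3 : (k' + 1) * K ^ n ≤ k * K ^ n := Nat.mul_le_mul_right _ h
            rw [add_mul, one_mul] at h3
            omega
      rw [Finset.card_range] at hle
      omega
    have h3 : (k + 1) * K ^ n ≤ K * K ^ n := Nat.mul_le_mul_right _ hk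
    rw [add_mul, one_mul] at h3
    obtain ⟨s', L', h4, h5, h6, h7⟩ := ih (U.erase (w i)) (s + k * K ^ n) (K ^ n)
      (by rw [Finset.card_erase_of_mem (hw i hi hi')]; omega) le_rfl hK fun j hj hj' =>
        Finset.mem_erase.2 ⟨hblock j hj hj', hw j (by omega) (by omega)⟩
    exact ⟨s', L', by omega, by omega, h6, h7⟩

variable {G : BagGraph} {ρ : ℕ → ℕ}

/-- A long stretch of bags has a part in which each of finitely many given vertices is either
everywhere or nowhere. -/
theorem exists_constant_part (hG : G.Ranked ρ) (W : Finset ℕ) : ∀ s L : ℕ,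
    ∃ s', s ≤ s' ∧ s' + L ≤ s + 3 ^ W.card * L ∧ ∀ w ∈ W,
      (∀ j : ℕ, s' ≤ j → j < s' + L → w ∈ G.bag j) ∨
      (∀ j : ℕ, s' ≤ j → j < s' + L → w ∉ G.bag j) := by
  induction W using Finset.induction_on with
  | empty => exact fun s L => ⟨s, le_rfl, by simp, by simp⟩
  | insert w W hw ih =>
    intro s L
    obtain ⟨s₁, h1, h2, h3⟩ := ih s (3 * L)
    rw [Finset.card_insert_of_notMem hw]
    have h4 : 3 ^ (W.card + 1) * L = 3 ^ W.card * (3 * L) := by ring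
    -- If `w` occurs in the first and in the last third, it fills the middle third.
    have key : ∃ s', s₁ ≤ s' ∧ s' + L ≤ s₁ + 3 * L ∧
        ((∀ j : ℕ, s' ≤ j → j < s' + L → w ∈ G.bag j) ∨
          (∀ j : ℕ, s' ≤ j → j < s' + L → w ∉ G.bag j)) := by
      by_cases hl : ∀ j : ℕ, s₁ ≤ j → j < s₁ + L → w ∉ G.bag j
      · exact ⟨s₁, le_rfl, by omega, .inr hl⟩
      by_cases hr : ∀ j : ℕ, s₁ + 2 * L ≤ j → j < s₁ + 2 * L + L → w ∉ G.bag j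
      · exact ⟨s₁ + 2 * L, by omega, by omega, .inr hr⟩
      push Not at hl hr
      obtain ⟨i, hi, hi', hwi⟩ := hl
      obtain ⟨k, hk, hk', hwk⟩ := hr
      exact ⟨s₁ + L, by omega, by omega, .inl fun j hj hj' =>
        hG.interval w i j k (by omega) (by omega) hwi hwk⟩
    obtain ⟨s', h5, h6, h7⟩ := key
    refine ⟨s', by omega, by omega, fun u hu => ?_⟩
    rcases Finset.mem_insert.1 hu with rfl | hu
    · exact h7
    · exact (h3 u hu).imp (fun h j hj hj' => h j (by omega) (by omega))
        fun h j hj hj' => h j (by omega) (by omega)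

/-- The number of windows of radius `R` over letters that are sets of at most `n` triples. -/
def windowCount (n R : ℕ) : ℕ := (2 ^ n) ^ (2 * R + 1)

/-- How often each window has to occur. -/
def windowFrequency (n g R : ℕ) : ℕ := g * (4 * R + 1) + 6 * R + windowCount n R + 2

/-- In a factor where all windows are frequent, two equal windows are found among `N + 1`
consecutive starts, `N` being the number of windows. The cut between them has length at most `N`,
and `windowFrequency` is large enough to tolerate the occurrences lost to it. -/
theorem exists_suitable {l : ℕ} {A : Finset (ℕ × ℕ × ℕ)}
    (hA : ∀ m : ℕ, G.letter ρ m ⊆ A) {g D x L : ℕ} (hg : 1 ≤ g) (hD : 1 ≤ D) (hx : x + L ≤ l)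
    (hshort : ∀ j : ℕ, x ≤ j → j + D < x + L → ∀ v ∈ G.bag j, v ∈ G.bag (j + D : ℕ) →
      ∀ k : ℕ, x ≤ k → k < x + L → v ∈ G.bag k)
    (hL : windowFrequency A.card g (g * D) ^ windowCount A.card (g * D) + 6 * (g * D) ≤ L) :
    ∃ c : Place, c.g = g ∧ Suitable G ρ l c := by
  classical
  have hR : 1 ≤ g * D := Nat.mul_pos hg hD
  have hDR : D ≤ g * D := Nat.le_mul_of_pos_left _ hg
  set R := g * D with hRdef
  set N := windowCount A.card R with hN
  set K := windowFrequency A.card g R with hK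
  have hK' : K = g * (4 * R + 1) + 6 * R + N + 2 := rfl
  let w : ℕ → Fin (2 * R + 1) → Set (ℕ × ℕ × ℕ) := fun m t => G.letter ρ (m + t : ℕ)
  let letters : Finset (Set (ℕ × ℕ × ℕ)) :=
    Finset.image (fun B : Finset (ℕ × ℕ × ℕ) => (B : Set (ℕ × ℕ × ℕ))) A.powerset
  let U : Finset (Fin (2 * R + 1) → Set (ℕ × ℕ × ℕ)) := Fintype.piFinset fun _ => letters
  have hU : U.card ≤ N := by
    rw [Fintype.card_piFinset, Finset.prod_const, Finset.card_univ, Fintype.card_fin]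
    refine Nat.pow_le_pow_left (Finset.card_image_le.trans ?_) _
    rw [Finset.card_powerset]
  have hw : ∀ m, w m ∈ U := fun m => Fintype.mem_piFinset.2 fun t => Finset.mem_image.2
    ⟨A.filter fun z => z ∈ G.letter ρ (m + t : ℕ), by simp, by
      ext z
      simp only [Finset.coe_filter]
      exact ⟨fun h => h.2, fun h => ⟨hA _ h, h⟩⟩⟩
  -- The surplus of `6 * R` bags is divided: `2 * R` before the factor and `4 * R` after it.
  obtain ⟨s, n, h1, h2, h3, h4⟩ := exists_frequent_factor w K N U (x + 2 * R) (K ^ N) hU le_rfl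
    (by omega) fun i _ _ => hw i
  have hKn : K ≤ n := by
    refine (h4 s le_rfl (by omega)).trans ((Finset.card_filter_le _ _).trans ?_)
    simp
  obtain ⟨e, he, e', he', hne, hee'⟩ : ∃ e ∈ Finset.Icc (s + R) (s + R + N),
      ∃ e' ∈ Finset.Icc (s + R) (s + R + N), e ≠ e' ∧ w e = w e' :=
    Finset.exists_ne_map_eq_of_card_lt_of_maps_to (t := U) (by rw [Nat.card_Icc]; omega)
      fun i _ => hw i
  rw [Finset.mem_Icc] at he he'
  wlog hlt : e < e' generalizing e e'
  · exact this e' he' e he hne.symm hee'.symm (by omega)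
  -- The equal windows are `[e, e + 2 * R]` and `[e', e' + 2 * R]`; the cut runs from the end of the
  -- first to the end of the second.
  refine ⟨⟨g, D, s - 2 * R, s + n - 1 + 4 * R, e + 2 * R, e' - e⟩, rfl, ?_⟩
  refine ⟨hg, hD, ?_, ?_, ?_, ?_, ?_, ?_, ?_⟩
  · change 1 ≤ e' - e
    omega
  · change s - 2 * R + 5 * R ≤ e + 2 * R
    omega
  · change e + 2 * R + (e' - e) + 4 * R ≤ s + n - 1 + 4 * R
    omega
  · change s + n - 1 + 4 * R < l
    omega
  · intro j _ hj hj' v hv hv'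
    change s - 2 * R ≤ j at hj
    change j + D ≤ s + n - 1 + 4 * R at hj'
    have := hshort j (by omega) (by omega) v hv hv'
    exact ⟨this (s - 2 * R) (by omega) (by omega), this (s + n - 1 + 4 * R) (by omega) (by omega)⟩
  · intro i _ hi hi'
    change i ≤ e + 2 * R at hi
    change e + 2 * R ≤ i + 2 * R at hi'
    change G.letter ρ (i : ℕ) = G.letter ρ (i + (e' - e) : ℕ)
    have := congrFun hee' ⟨i - e, by omega⟩
    change G.letter ρ (e + (i - e) : ℕ) = G.letter ρ (e' + (i - e) : ℕ) at this
    rwa [show e + (i - e) = i by omega, show e' + (i - e) = i + (e' - e) by omega] at this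
  · intro i _ hi hi'
    change s - 2 * R + 2 * R ≤ i at hi
    change i + 4 * R ≤ s + n - 1 + 4 * R at hi'
    let F := (Finset.Ico s (s + n)).filter fun j => w j = w i
    -- Unusable starts: those close to the ends of the factor, and in the last set those whose
    -- window meets a removed bag.
    let bad := Finset.Ico s (s + 2 * R) ∪ (Finset.Ico (s + n - 2 * R) (s + n) ∪
      Finset.Ioc e (e' + 2 * R))
    have hbad : bad.card ≤ 2 * R + (2 * R + (N + 2 * R)) := by
      refine (Finset.card_union_le _ _).trans (Nat.add_le_add ?_
        ((Finset.card_union_le _ _).trans (Nat.add_le_add ?_ ?_)))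
      · rw [Nat.card_Ico]; omega
      · rw [Nat.card_Ico]; omega
      · rw [Nat.card_Ioc]; omega
    have hF : K ≤ F.card := h4 i (by omega) (by omega)
    refine ⟨F \ bad, ?_, fun k hk => ?_⟩
    · have := Finset.le_card_sdiff bad F
      change g * (4 * R + 1) + 1 ≤ _
      omega
    · simp only [F, bad, Finset.mem_sdiff, Finset.mem_filter, Finset.mem_union, Finset.mem_Ico,
        Finset.mem_Ioc, not_or] at hk
      obtain ⟨⟨h5, h6⟩, h7, h8, h9⟩ := hk
      change s - 2 * R + 4 * R ≤ k ∧ k + 6 * R ≤ s + n - 1 + 4 * R ∧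
        (k + 2 * R ≤ e + 2 * R ∨ e + 2 * R + (e' - e) < k) ∧ ∀ t < 2 * R + 1,
          G.letter ρ (i + t : ℕ) = G.letter ρ (k + t : ℕ)
      exact ⟨by omega, by omega, by omega, fun t ht => (congrFun h6 ⟨t, ht⟩).symm⟩

/-! ### Occurrences -/

variable {I : Presentation} {p : ℕ}

theorem exists_interval_of_le_occurrences (hW : I.WellFormed) (hN : I.Normalized p ρ)
    {v : I.Vertex} {n : ℕ} (h : n ≤ occurrences I.bag v) :
    ∃ s, s + n ≤ I.bags.length ∧ ∀ j : ℕ, s ≤ j → j < s + n → v.1 ∈ I.bagGraph.bag j := by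
  classical
  have hR := hN.ranked hW
  let F : Finset ℕ := (Finset.range I.bags.length).filter fun j => v.1 ∈ I.bagGraph.bag (j : ℕ)
  have hF : n ≤ F.card := by
    refine h.trans ?_
    rw [occurrences, ← Set.ncard_image_of_injective _ Fin.val_injective, ← Set.ncard_coe_finset]
    refine Set.ncard_le_ncard ?_ (Finset.finite_toSet _)
    rintro _ ⟨i, hi, rfl⟩
    simp only [F, Finset.coe_filter, Finset.mem_range]
    exact ⟨i.2, Presentation.mem_bag_fin.1 hi⟩
  rcases F.eq_empty_or_nonempty with h0 | h0
  · rw [h0, Finset.card_empty] at hF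
    exact ⟨0, by omega, fun j _ _ => by omega⟩
  have hmin := Finset.mem_filter.1 (F.min'_mem h0)
  have hmax := Finset.mem_filter.1 (F.max'_mem h0)
  have hlt := Finset.mem_range.1 hmax.1
  have hle := F.min'_le _ (F.max'_mem h0)
  have hcard : F.card ≤ F.max' h0 + 1 - F.min' h0 := by
    rw [← Nat.card_Icc]
    exact Finset.card_le_card fun j hj => Finset.mem_Icc.2 ⟨F.min'_le j hj, F.le_max' j hj⟩
  exact ⟨F.min' h0, by omega, fun j hj hj' =>
    hR.interval v.1 _ j _ (by omega) (by omega) hmin.2 hmax.2⟩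

theorem lt_occurrences (hW : I.WellFormed) (hN : I.Normalized p ρ) {v : I.Vertex} {s n : ℕ}
    (h : v.1 ∈ I.bagGraph.bag s) (h' : v.1 ∈ I.bagGraph.bag (s + n : ℕ)) :
    n < occurrences I.bag v := by
  have hR := hN.ranked hW
  obtain ⟨k, hk, _⟩ := Presentation.mem_bag_iff.1 h'
  have hlt : s + n < I.bags.length := by have := k.2; omega
  have hcard : ((Finset.Icc s (s + n)).attachFin fun i hi => by
      rw [Finset.mem_Icc] at hi; omega : Finset (Fin I.bags.length)).card = n + 1 := by
    rw [Finset.card_attachFin, Nat.card_Icc]; omega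
  rw [← Nat.add_one_le_iff, ← hcard, ← Set.ncard_coe_finset, occurrences]
  refine Set.ncard_le_ncard (fun i hi => ?_) (Set.toFinite _)
  rw [Finset.mem_coe, Finset.mem_attachFin, Finset.mem_Icc] at hi
  exact Presentation.mem_bag_fin.2 (hR.interval v.1 s _ (s + n : ℕ) (by omega) (by omega) h h')

/-- A vertex shares bags with at most `2 * p` vertices of higher rank. -/
theorem exists_higher_neighbors (hW : I.WellFormed) (hN : I.Normalized p ρ) {v : ℕ}
    (hv : v ∈ I.verts) : ∃ W : Finset ℕ, W.card ≤ 2 * p ∧ ∀ u m, u ∈ I.bagGraph.bag m →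
      v ∈ I.bagGraph.bag m → ρ v < ρ u → u ∈ W := by
  classical
  have hle : ∀ j ∈ Finset.Ioc (ρ v) p, (I.bagGraph.neighbors ρ j v).encard ≤ 2 := fun j hj => by
    rw [Finset.mem_Ioc] at hj
    exact hN.neighbors_le hW ((hN.mem_verts_iff hW).1 hv) hj.1 hj.2
  have hfin : ∀ j ∈ Finset.Ioc (ρ v) p, (I.bagGraph.neighbors ρ j v).Finite := fun j hj =>
    Set.finite_of_encard_le_coe (k := 2) (by exact_mod_cast hle j hj)
  let W : Finset ℕ := (Finset.Ioc (ρ v) p).attach.biUnion fun j => (hfin j.1 j.2).toFinset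
  refine ⟨W, ?_, fun u m hu hvm hlt => ?_⟩
  · refine (Finset.card_biUnion_le_card_mul _ _ 2 fun j _ => ?_).trans ?_
    · have := hle j.1 j.2
      rw [(hfin j.1 j.2).encard_eq_coe_toFinset_card] at this
      exact_mod_cast this
    · rw [Finset.card_attach, Nat.card_Ioc]; omega
  · have hu' := hN.rank_mem ⟨u, Presentation.mem_verts_of_mem_bag hW hu⟩
    refine Finset.mem_biUnion.2 ⟨⟨ρ u, Finset.mem_Ioc.2 ⟨hlt, hu'.2⟩⟩, Finset.mem_attach _ _, ?_⟩
    rw [Set.Finite.mem_toFinset]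
    exact ⟨rfl, m, hu, hvm⟩

/-- A vertex of rank `1` appears in few bags. -/
theorem rank_one_short (hW : I.WellFormed) (hN : I.Normalized p ρ) {v s n : ℕ}
    (hn : s + n < I.bags.length) (hr : ρ v = 1)
    (h : ∀ j : ℕ, s ≤ j → j ≤ s + n → v ∈ I.bagGraph.bag j) : n ≤ 2 * p := by
  classical
  have hR := hN.ranked hW
  have hv := Presentation.mem_verts_of_mem_bag hW (h s le_rfl (by omega))
  obtain ⟨W, hWc, hWm⟩ := exists_higher_neighbors hW hN hv
  -- The new vertices are distinct by the interval property, and their rank is not `1`, since `v`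
  -- occupies that rank. So they are among the higher neighbours of `v`.
  have hnew : ∀ j < n, ∃ u ∈ I.bagGraph.bag (s + j + 1 : ℕ), u ∉ I.bagGraph.bag (s + j : ℕ) :=
    fun j hj => by
      obtain ⟨u, hu, hu'⟩ := hN.exists_new (m := (s + j + 1 : ℕ)) (by omega) (by omega)
      refine ⟨u, hu, fun h => hu' ?_⟩
      convert h using 2
      omega
  choose! f hf hf' using hnew
  refine le_trans ?_ hWc
  rw [← Finset.card_range n]
  refine Finset.card_le_card_of_injOn f (fun j hj => ?_) fun j hj j' hj' e => ?_
  · have hj := Finset.mem_range.1 hj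
    have hvj := h (s + j + 1) (by omega) (by omega)
    refine hWm _ _ (hf j hj) hvj ?_
    have h1 := (hN.rank_mem ⟨f j, Presentation.mem_verts_of_mem_bag hW (hf j hj)⟩).1
    have h2 : ρ (f j) ≠ 1 := fun h2 => by
      have := hR.rank_inj _ _ (hf j hj) _ hvj (h2.trans hr.symm)
      exact hf' j hj (this ▸ h (s + j) (by omega) (by omega))
    simp only at h1
    omega
  · have hj := Finset.mem_range.1 hj
    have hj' := Finset.mem_range.1 hj'
    have key : ∀ i i', i < n → i' < n → i < i' → f i ≠ f i' := fun i i' hi hi' hlt e =>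
      hf' i' hi' (hR.interval _ (s + i + 1 : ℕ) _ (s + i' + 1 : ℕ) (by omega) (by omega)
        (e ▸ hf i hi) (hf i' hi'))
    rcases lt_trichotomy j j' with hlt | hlt | hlt
    · exact absurd e (key j j' hj hj' hlt)
    · exact hlt
    · exact absurd e.symm (key j' j hj' hj hlt)

theorem letter_subset (hW : I.WellFormed) (hN : I.Normalized p ρ) (m : ℤ) :
    I.bagGraph.letter ρ m ⊆
      (Finset.range 3 ×ˢ (Finset.Icc 1 p ×ˢ Finset.Icc 1 p) : Finset (ℕ × ℕ × ℕ)) := by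
  rintro ⟨t0, t1⟩ ⟨u, hu, v, hv, h, h'⟩
  simp only at h h'
  subst h
  have h1 := hN.rank_mem ⟨u, Presentation.mem_verts_of_mem_bag hW hu⟩
  have h2 := hN.rank_mem ⟨v, Presentation.mem_verts_of_mem_bag hW hv⟩
  simp only [Finset.coe_product, Set.mem_prod, Finset.coe_range, Set.mem_Iio, Finset.coe_Icc,
    Set.mem_Icc]
  refine ⟨?_, h1, h2⟩
  rcases h' with h' | ⟨h', _⟩ | ⟨h', _⟩ <;> omega

/-! ### Bounds -/

/-- There are `2 ^ e` windows with `e = n * (2 * R + 1)`; the remaining terms are quadratic in `R`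
and fit into another `2 ^ e`. -/
theorem windowFrequency_le {n g R : ℕ} (hn : 3 ≤ n) (hg : g ≤ R) (hR : 1 ≤ R) :
    windowFrequency n g R ≤ 2 ^ (2 * (n * (2 * R + 1))) := by
  have hN : windowCount n R = 2 ^ (n * (2 * R + 1)) := by rw [windowCount, ← pow_mul]
  set e := n * (2 * R + 1) with he
  have he6 : 6 * R + 3 ≤ e := by rw [he]; nlinarith
  have h1 : R ≤ 2 ^ R := Nat.lt_two_pow_self.le
  have h2 : g * (4 * R + 1) + 6 * R + 2 ≤ 2 ^ e :=
    calc g * (4 * R + 1) + 6 * R + 2 ≤ 16 * (R * R) := by nlinarith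
      _ ≤ 16 * (2 ^ R * 2 ^ R) := Nat.mul_le_mul_left _ (Nat.mul_le_mul h1 h1)
      _ = 2 ^ (4 + (R + R)) := by rw [pow_add, pow_add]; norm_num
      _ ≤ 2 ^ e := Nat.pow_le_pow_right (by norm_num) (by omega)
  calc windowFrequency n g R ≤ 2 ^ e + 2 ^ e := by rw [windowFrequency, hN]; omega
    _ = 2 ^ (e + 1) := by ring
    _ ≤ 2 ^ (2 * e) := Nat.pow_le_pow_right (by norm_num) (by omega)

/-- The left side is `3 * e`, where `2 ^ e` is the number of windows. The stretch that is needed has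
length at most `2 ^ (2 ^ (3 * e))`, so this inequality is what the exponent in `Delta` has to
provide. -/
theorem exponent_bound {p q X : ℕ} (hp : 1 ≤ p) (hq : 1 ≤ q) (hX : 1 ≤ X) :
    3 * (3 * p ^ 2 * (2 * (2 * 3 ^ q * (3 * p * X)) + 1)) ≤ X * 2 ^ (20 * q * p ^ 2) := by
  have h3 : 1 ≤ 3 ^ q := Nat.one_le_pow _ _ (by norm_num)
  have h1 : 1 ≤ 2 * 3 ^ q * (3 * p * X) :=
    Nat.mul_pos (by omega) (Nat.mul_pos (by omega) hX)
  have hpp : p ≤ 2 ^ p := Nat.lt_two_pow_self.le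
  have h4 : 3 ^ q ≤ 2 ^ (2 * q) := by
    rw [pow_mul]; exact Nat.pow_le_pow_left (by norm_num) q
  have hexp : 8 + 3 * p + 2 * q ≤ 20 * q * p ^ 2 := by
    have e1 : 1 ≤ q * p ^ 2 := Nat.mul_pos hq (by positivity)
    have e2 : p ≤ q * p ^ 2 := by
      rw [sq]; exact (Nat.le_mul_of_pos_left p hp).trans (Nat.le_mul_of_pos_left _ hq)
    have e3 : q ≤ q * p ^ 2 := Nat.le_mul_of_pos_right _ (by positivity)
    have e4 : 20 * q * p ^ 2 = 20 * (q * p ^ 2) := by ring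
    omega
  calc 3 * (3 * p ^ 2 * (2 * (2 * 3 ^ q * (3 * p * X)) + 1))
      ≤ 3 * (3 * p ^ 2 * (3 * (2 * 3 ^ q * (3 * p * X)))) := by
        refine Nat.mul_le_mul_left _ (Nat.mul_le_mul_left _ ?_)
        omega
    _ = X * (162 * (p ^ 3 * 3 ^ q)) := by ring
    _ ≤ X * (2 ^ 8 * ((2 ^ p) ^ 3 * 2 ^ (2 * q))) := by
        refine Nat.mul_le_mul_left _ (Nat.mul_le_mul (by norm_num) (Nat.mul_le_mul ?_ h4))
        exact Nat.pow_le_pow_left hpp 3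
    _ = X * 2 ^ (8 + 3 * p + 2 * q) := by
        rw [← pow_mul, ← pow_add, ← pow_add]; congr 2; ring
    _ ≤ X * 2 ^ (20 * q * p ^ 2) :=
        Nat.mul_le_mul_left _ (Nat.pow_le_pow_right (by norm_num) hexp)

/-- The stretches are long enough. -/
theorem stretch_bound {p q X : ℕ} (hp : 1 ≤ p) (hq : 1 ≤ q) (hX : 1 ≤ X) :
    3 ^ (2 * p) * (windowFrequency (3 * p ^ 2) (2 * 3 ^ q) (2 * 3 ^ q * (3 * p * X)) ^
      windowCount (3 * p ^ 2) (2 * 3 ^ q * (3 * p * X)) + 6 * (2 * 3 ^ q * (3 * p * X))) ≤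
      2 ^ (2 ^ (X * 2 ^ (20 * q * p ^ 2))) := by
  have hbound := exponent_bound hp hq hX
  have h3 : 1 ≤ 3 ^ q := Nat.one_le_pow _ _ (by norm_num)
  have hpX : 1 ≤ 3 * p * X := Nat.mul_pos (by omega) hX
  have hgR : 2 * 3 ^ q ≤ 2 * 3 ^ q * (3 * p * X) := Nat.le_mul_of_pos_right _ hpX
  have hpR : 3 * p ≤ 2 * 3 ^ q * (3 * p * X) := by
    calc 3 * p ≤ 3 * p * X := Nat.le_mul_of_pos_right _ hX
      _ ≤ _ := Nat.le_mul_of_pos_left _ (by omega)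
  generalize 2 * 3 ^ q * (3 * p * X) = R at *
  have hp2 : 1 ≤ p ^ 2 := Nat.one_le_pow _ _ hp
  have hn : 3 ≤ 3 * p ^ 2 := by omega
  have hfreq := windowFrequency_le hn hgR (by omega)
  have hN : windowCount (3 * p ^ 2) R = 2 ^ (3 * p ^ 2 * (2 * R + 1)) := by
    rw [windowCount, ← pow_mul]
  have he : 6 * R + 3 ≤ 3 * p ^ 2 * (2 * R + 1) := by nlinarith
  rw [hN]
  generalize 3 * p ^ 2 * (2 * R + 1) = e at *
  generalize windowFrequency (3 * p ^ 2) (2 * 3 ^ q) R = K at *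
  have h1 : K ^ 2 ^ e ≤ 2 ^ (2 * e * 2 ^ e) := by
    rw [pow_mul 2 (2 * e)]; exact Nat.pow_le_pow_left hfreq _
  have heN : e ≤ e * 2 ^ e := Nat.le_mul_of_pos_right _ (by positivity)
  have h2 : 6 * R ≤ 2 ^ (2 * e * 2 ^ e) := by
    refine le_trans (by omega : 6 * R ≤ e) (Nat.lt_two_pow_self.le.trans
      (Nat.pow_le_pow_right (by norm_num) ?_))
    rw [mul_assoc]; omega
  have h4 : 3 ^ (2 * p) ≤ 2 ^ (4 * p) := by
    rw [pow_mul, pow_mul 2 4]; exact Nat.pow_le_pow_left (by norm_num) p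
  -- The main term is `K ^ 2 ^ e` with `K ≤ 2 ^ (2 * e)`; everything else is absorbed when the
  -- exponent `2 * e * 2 ^ e` grows to `3 * e * 2 ^ e`.
  calc 3 ^ (2 * p) * (K ^ 2 ^ e + 6 * R)
      ≤ 2 ^ (4 * p) * (2 ^ (2 * e * 2 ^ e) + 2 ^ (2 * e * 2 ^ e)) :=
        Nat.mul_le_mul h4 (Nat.add_le_add h1 h2)
    _ = 2 ^ (4 * p + 2 * e * 2 ^ e + 1) := by rw [pow_add, pow_add]; ring
    _ ≤ 2 ^ (2 ^ (X * 2 ^ (20 * q * p ^ 2))) := by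
        refine Nat.pow_le_pow_right (by norm_num) ?_
        calc 4 * p + 2 * e * 2 ^ e + 1 ≤ 3 * e * 2 ^ e := by
              rw [mul_assoc, mul_assoc]; omega
          _ ≤ 2 ^ (2 * e) * 2 ^ e := by
              refine Nat.mul_le_mul_right _ ?_
              calc 3 * e ≤ 2 ^ e * 2 ^ e := by
                    have : e ≤ 2 ^ e := Nat.lt_two_pow_self.le
                    exact Nat.mul_le_mul (by omega) this
                _ = 2 ^ (2 * e) := by ring
          _ = 2 ^ (3 * e) := by rw [← pow_add]; congr 1; ring
          _ ≤ _ := Nat.pow_le_pow_right (by norm_num) hbound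

theorem Delta_pos {p q i : ℕ} (hp : 1 ≤ p) (hi : 1 ≤ i) : 1 ≤ Delta p q i := by
  match i, hi with
  | 1, _ => rw [Delta]; omega
  | i + 2, _ => rw [Delta]; exact Nat.one_le_two_pow

theorem Delta_le_succ (p q i : ℕ) : Delta p q i ≤ Delta p q (i + 1) := by
  match i with
  | 0 => exact Nat.zero_le _
  | i + 1 =>
    rw [Delta]
    refine (Nat.lt_two_pow_self.le.trans (Nat.pow_le_pow_right (by norm_num) ?_))
    refine Nat.lt_two_pow_self.le.trans (Nat.pow_le_pow_right (by norm_num) ?_)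
    exact Nat.le_mul_of_pos_right _ (by positivity)

theorem Delta_mono (p q : ℕ) : Monotone (Delta p q) := monotone_nat_of_le_succ (Delta_le_succ p q)

/-- If some vertex appears in many bags, there is a suitable place. -/
theorem exists_suitable_of_occurrences (hW : I.WellFormed) (hN : I.Normalized p ρ) {q : ℕ}
    (hq : 1 ≤ q) (h : ∃ v : I.Vertex, 3 * p * Delta p q p ≤ occurrences I.bag v) :
    ∃ c : Place, c.g = 2 * 3 ^ q ∧ Suitable I.bagGraph ρ I.bags.length c := by
  classical
  have hR := hN.ranked hW
  -- The least rank with a vertex above its own threshold; all vertices of smaller rank are then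
  -- short-lived.
  have hex : ∃ i, ∃ v : I.Vertex, ρ v.1 = i ∧ 3 * p * Delta p q i ≤ occurrences I.bag v := by
    obtain ⟨v, hv⟩ := h
    exact ⟨ρ v.1, v, rfl, (Nat.mul_le_mul_left _ (Delta_mono p q (hN.rank_mem v).2)).trans hv⟩
  obtain ⟨v, hvi, hv⟩ := Nat.find_spec hex
  have hmin : ∀ u : I.Vertex, ρ u.1 < Nat.find hex →
      occurrences I.bag u < 3 * p * Delta p q (ρ u.1) := fun u hu => by
    by_contra hcon
    exact Nat.find_min hex hu ⟨u, rfl, by omega⟩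
  generalize Nat.find hex = i at *
  obtain ⟨hv1, hvp⟩ := hN.rank_mem v
  have hp : 1 ≤ p := hv1.trans hvp
  obtain ⟨s, hs, hsv⟩ := exists_interval_of_le_occurrences hW hN hv
  have hpd : ∀ i, 1 ≤ i → 3 * p ≤ 3 * p * Delta p q i := fun i hi =>
    Nat.le_mul_of_pos_right _ (Delta_pos hp hi)
  obtain ⟨i, rfl⟩ : ∃ i', i = i' + 1 := ⟨i - 1, by omega⟩
  -- Rank `1` is impossible: the threshold is `9 * p ^ 2`, but `rank_one_short` allows at most `2 *
  -- p + 1` consecutive bags.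
  rcases Nat.eq_zero_or_pos i with rfl | hi
  · exfalso
    rw [zero_add, Delta] at hs hsv
    have h1 : 3 * p * 1 ≤ 3 * p * p := Nat.mul_le_mul_left _ hp
    have h2 : 3 * p * (3 * p) = 3 * (3 * p * p) := by ring
    have := rank_one_short hW hN (v := v.1) (s := s) (n := 3 * p * (3 * p) - 1) (by omega) hvi
      fun j hj hj' => hsv j hj (by omega)
    omega
  obtain ⟨i, rfl⟩ : ∃ i', i = i' + 1 := ⟨i - 1, by omega⟩
  set X := Delta p q (i + 1) with hX
  have hX1 : 1 ≤ X := Delta_pos hp (by omega)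
  obtain ⟨W, hWc, hWm⟩ := exists_higher_neighbors hW hN v.2
  set D := 3 * p * X with hD
  set g := 2 * 3 ^ q with hg
  set A : Finset (ℕ × ℕ × ℕ) := Finset.range 3 ×ˢ (Finset.Icc 1 p ×ˢ Finset.Icc 1 p) with hA
  have hAc : A.card = 3 * p ^ 2 := by
    simp [hA, Finset.card_product, sq]
  set L := windowFrequency A.card g (g * D) ^ windowCount A.card (g * D) + 6 * (g * D) with hL
  obtain ⟨x, hx1, hx2, hx3⟩ := exists_constant_part hR W s L
  have hlong : 3 ^ W.card * L ≤ 3 * p * Delta p q (i + 1 + 1) := by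
    calc 3 ^ W.card * L ≤ 3 ^ (2 * p) * L :=
          Nat.mul_le_mul_right _ (Nat.pow_le_pow_right (by norm_num) hWc)
      _ ≤ Delta p q (i + 1 + 1) := by
          rw [hL, hAc, Delta]
          exact stretch_bound hp hq hX1
      _ ≤ _ := Nat.le_mul_of_pos_left _ (by omega)
  refine exists_suitable (A := A) (fun m => letter_subset hW hN m) (g := g) (D := D) (x := x)
    (L := L) ?_ ?_ (by omega) ?_ le_rfl |>.imp fun c hc => hc
  · have : 1 ≤ 3 ^ q := Nat.one_le_pow _ _ (by norm_num)
    omega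
  · exact le_trans (by omega) (hpd (i + 1) (by omega))
  · intro j hj hj' u hu hu' k hk hk'
    have hvj : v.1 ∈ I.bagGraph.bag j := hsv j (by omega) (by omega)
    have huv := Presentation.mem_verts_of_mem_bag hW hu
    -- A vertex in the bags `j` and `j + D` is constant if its rank is higher, by the choice of the
    -- part; it is `v` if the ranks are equal; and a lower rank contradicts minimality.
    rcases lt_trichotomy (ρ v.1) (ρ u) with hlt | heq | hlt
    · rcases hx3 u (hWm u j hu hvj hlt) with h1 | h1
      · exact h1 k hk hk'
      · exact absurd hu (h1 j hj (by omega))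
    · have := hR.rank_inj j _ hvj _ hu heq
      rw [← this]
      exact hsv k (by omega) (by omega)
    · exfalso
      have h1 := lt_occurrences hW hN (v := ⟨u, huv⟩) hu hu'
      have h2 := hmin ⟨u, huv⟩ (by simp only; omega)
      have h3 : 3 * p * Delta p q (ρ u) ≤ D :=
        Nat.mul_le_mul_left _ (Delta_mono p q (by omega))
      simp only at h2
      omega

end Reduction

/-! ### The program and the theorem -/

open Reduction

/-- Atoms have free variables, and only `∃` removes them. The estimate in `exponent_bound` relies on
`1 ≤ q`. -/
theorem Formula.one_le_quantifiers {φ : Formula} (h : φ.IsSentence) : 1 ≤ φ.quantifiers := by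
  have key : ∀ φ : Formula, φ.quantifiers = 0 → φ.freeVars.Nonempty := by
    intro φ
    induction φ with
    | ex x φ ih => intro h; simp [Formula.quantifiers] at h
    | neg φ ih => exact ih
    | or φ ψ ih _ =>
      intro h
      simp only [Formula.quantifiers] at h
      exact (ih (by omega)).mono Finset.subset_union_left
    | adj x y => exact fun _ => ⟨x, by simp [Formula.freeVars]⟩
    | eq x y => exact fun _ => ⟨x, by simp [Formula.freeVars]⟩
  by_contra hcon
  have := key φ (by omega)
  rw [h] at this
  simp at this

theorem size_encodeRanked_le (φ : Formula) (p : ℕ) (I : Presentation) (ρ : ℕ → ℕ) :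
    (encodeRanked I ρ).size ≤ (encodeInput φ p I ρ).size := by
  simp only [encodeInput, Val.size]
  omega

/-- The program of the reduction, which ignores the formula and the number of ranks. -/
theorem exists_reduction_program : ∃ (M : Prog) (P : Polynomial ℕ),
    ∀ (φ : Formula) (p : ℕ) (I : Presentation) (ρ : ℕ → ℕ), ∃ t,
      Eval M [encodeInput φ p I ρ] (Enc.enc (reduce (ofPresentation I ρ))) t ∧
      t ≤ P.eval (encodeInput φ p I ρ).size := by
  obtain ⟨M, b, ⟨c, hc⟩, hm, h⟩ := pt_reduce
  refine ⟨.letin (.tl (.tl (.var 0))) M, (Polynomial.X + 2) ^ c + 4, fun φ p I ρ => ?_⟩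
  obtain ⟨t, ht, he⟩ := (h (ofPresentation I ρ)).2 [encodeInput φ p I ρ]
  have e0 := Eval.var 0 [encodeInput φ p I ρ]
  refine ⟨3 + t + 1, .letin (.tl (.tl e0)) he, ?_⟩
  have h1 : b (esize (ofPresentation I ρ)) ≤ b (encodeInput φ p I ρ).size :=
    hm (size_encodeRanked_le φ p I ρ)
  have h2 := hc (encodeInput φ p I ρ).size
  simp only [Polynomial.eval_add, Polynomial.eval_pow, Polynomial.eval_X, Polynomial.eval_ofNat]
  omega

end FOPathwidth

open FOPathwidth
theorem mainTheorem2 :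
    ∃ (M : Prog) (P : Polynomial ℕ),
      ∀ (φ : Formula) (p : ℕ) (I : Presentation) (ρ : ℕ → ℕ),
        φ.IsSentence → I.WellFormed → I.Normalized p ρ →
        (∃ v : I.Vertex, 3 * p * Delta p φ.quantifiers p ≤ occurrences I.bag v) →
        ∃ (I' : Presentation) (t : ℕ),
          Eval M [encodeInput φ p I ρ] (encodeRanked I' ρ) t ∧
          t ≤ P.eval (encodeInput φ p I ρ).size ∧
          I'.WellFormed ∧
          I'.verts ⊆ I.verts ∧
          I'.verts.length < I.verts.length ∧
          I'.Normalized p ρ ∧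
          ∀ ψ : Formula, ψ.IsSentence → ψ.quantifiers ≤ φ.quantifiers →
            (Models I.graph ψ ↔ Models I'.graph ψ) := by
  obtain ⟨M, P, hMP⟩ := exists_reduction_program
  refine ⟨M, P, fun φ p I ρ hφ hW hN hocc => ?_⟩
  obtain ⟨t, he, ht⟩ := hMP φ p I ρ
  -- The place `c₀` only guarantees success of the search; the place that is found may be another
  -- one, with `g` at least as large.
  obtain ⟨c₀, hg₀, hc₀⟩ :=
    Reduction.exists_suitable_of_occurrences hW hN (Formula.one_le_quantifiers hφ) hocc
  have hlt₀ : c₀.g < I.bags.length := by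
    have h1 := hc₀.left
    have h2 := hc₀.right
    have h3 := hc₀.lt
    have h4 : c₀.g ≤ c₀.g * c₀.D := Nat.le_mul_of_pos_right _ hc₀.one_le_D
    omega
  obtain ⟨hc, hg⟩ := Reduction.search_spec ((Reduction.check_iff (ρ := ρ) hW).2 hc₀) hlt₀
  rw [Reduction.check_iff hW] at hc
  have hz := hc.zoneGluing hW hN
  have hlt : (Reduction.search (Reduction.ofPresentation I ρ)).a +
      (Reduction.search (Reduction.ofPresentation I ρ)).d < I.bags.length := by
    have h2 := hc.right
    have h3 := hc.lt
    omega
  refine ⟨_, t, Reduction.enc_cut ▸ he, ht,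
    Reduction.cutPresentation_wellFormed hW hlt hz.toGluing,
    fun v hv => (Reduction.mem_cutPresentation_verts.1 hv).1,
    Reduction.cutPresentation_length_lt hW hN hc.one_le_d hlt hz.toGluing,
    Reduction.cutPresentation_normalized hW hN hlt hz,
    fun ψ _ hψ => hc.models_iff hW hN (by omega) hψ⟩
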